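/- Let $\Omega\subset\mathbb R^3$ be a bounded open set with smooth boundary and outer unit normal $\nu$. Let $C_T^{0,1}(\Omega,\mathbb R^3)$ be the space of Lipschitz vector fields $B$ on $\overline\Omega$ with $B\times\nu=0$ on $\partial\Omega$, normed by $\sup|B|+\mathrm{Lip}(B)$. Let $\mathcal N$ be the space of normal $1$-currents supported in $\overline\Omega$ which are divergence free in $\Omega$ (i.e. whose boundary is supported on $\partial\Omega$), let $|T|$ be the mass of $T$, $\langle B,T\rangle$ the value of $T$ on the field $B$, and $\|T\|_*=\sup\{\langle B,T\rangle:\|B\|_{C_T^{0,1}}\le 1\}$. Let $X$ be the set of currents carried by simple oriented Lipschitz curves in $\overline\Omega$ which are either loops or have their two distinct endpoints on $\partial\Omega$. Let $B_0\in C_T^{0,1}(\Omega,\mathbb R^3)$ and $R(T)=\langle B_0,T\rangle/|T|$ for $T\neq 0$. Let $\Gamma_0:[0,L_0]\to\overline\Omega$, $L_0>0$, be a smooth simple curve parametrized by arclength, with endpoints on $\partial\Omega$, and suppose that $B_0$ is of class $C^2$ up to $\partial\Omega$ in a neighborhood of $\Gamma_0$ in $\overline\Omega$. Assume that (i) $R$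 attains its maximum over $\mathcal N\setminus\{0\}$ at $\Gamma_0$, and every other maximizer is a multiple of $\Gamma_0$; (ii) the second derivative of $R$ at $\Gamma_0$ is negative definite, in the following sense. In tube coordinates $\Phi$ around $\Gamma_0$, the quadratic form $$Q(u)=-\frac{d^2}{dt^2}\Big|_{t=0}R(\Gamma_t),\qquad \Gamma_t(z)=\Phi(t\,u(z),z),\quad z\in[0,L_0],$$ satisfies $Q(u)>0$ for every nonzero $u\in H^1((0,L_0),\mathbb R^2)$. Here tube coordinates are given by a smooth diffeomorphism $\Phi$ from a cylinder $\{|v|\le\delta\}\times[0,L_0]$, $\delta>0$, onto a neighborhood of $\Gamma_0$ in $\overline\Omega$, such that $\Phi(0,z)=\Gamma_0(z)$, such that $\Phi$ maps the bases $\{z=0\}$ and $\{z=L_0\}$ into $\partial\Omega$, and such that $\partial_z\Phi$ is orthogonal to $\partial_{v_1}\Phi$ and $\partial_{v_2}\Phi$. Then $\Gamma_0\in X$, it is the only element of $X$ that maximizes $R$ over $\mathcal N\setminus\{0\}$, and there exists $\alpha>0$ such that for every curve $\Gamma\in X$ $$R(\Gamma_0)-R(\Gamma)\ \ge\ \alpha\,\min\left(\|\Gamma-\Gamma_0\|_*^2,\,1\right).$$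 In other words, the weak nondegeneracy condition holds with exponent $P=2$. -/

import Mathlib

open Set Filter Topology MeasureTheory
open scoped ContDiff NNReal RealInnerProductSpace Matrix

namespace Isoflux

/-- Euclidean space `ℝ³`. -/
abbrev E3 : Type := EuclideanSpace ℝ (Fin 3)

/-- Euclidean plane `ℝ²`, for the horizontal coordinates of a tube. -/
abbrev E2 : Type := EuclideanSpace ℝ (Fin 2)

/-! ### Smooth bounded domains -/

/-- `ρ` is a smooth local defining function of `Ω` at `x`: its gradient does not vanish at `x`, and
near `x` the set `Ω` is `{ρ < 0}`. -/
def IsDefiningFunction (Ω : Set E3) (x : E3) (ρ : E3 → ℝ) : Prop :=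
  ContDiff ℝ ∞ ρ ∧ gradient ρ x ≠ 0 ∧ ∀ᶠ y in 𝓝 x, (y ∈ Ω ↔ ρ y < 0)

/-- A bounded open subset of `ℝ³` with smooth boundary. -/
structure SmoothDomain where
  carrier : Set E3
  isOpen : IsOpen carrier
  isBounded : Bornology.IsBounded carrier
  smooth_boundary : ∀ x ∈ frontier carrier, ∃ ρ, IsDefiningFunction carrier x ρ

/-- The closed set `Ω̄`, as a type. -/
abbrev SmoothDomain.Closure (Ω : SmoothDomain) : Type := closure Ω.carrier

instance (Ω : SmoothDomain) : CompactSpace Ω.Closure :=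
  isCompact_iff_compactSpace.mp Ω.isBounded.isCompact_closure

/-- `n` is the outer unit normal to `∂Ω` at `x`. -/
def IsOuterUnitNormal (Ω : SmoothDomain) (x n : E3) : Prop :=
  x ∈ frontier Ω.carrier ∧
    ∃ ρ, IsDefiningFunction Ω.carrier x ρ ∧ n = ‖gradient ρ x‖⁻¹ • gradient ρ x

/-! ### Vector fields of class `C^{0,1}_T` -/

/-- The vector field `B` on `Ω̄` satisfies `B × ν = 0` on `∂Ω`. -/
def IsNormalOnBoundary (Ω : SmoothDomain) (B : C(Ω.Closure, E3)) : Prop :=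
  ∀ (x : Ω.Closure) (n : E3), IsOuterUnitNormal Ω x n →
    crossProduct (WithLp.ofLp (B x)) (WithLp.ofLp n) = 0

/-- `B ∈ C_T^{0,1}(Ω, ℝ³)`: `B` is Lipschitz on `Ω̄` and `B × ν = 0` on `∂Ω`. -/
def IsCT (Ω : SmoothDomain) (B : C(Ω.Closure, E3)) : Prop :=
  (∃ K : ℝ≥0, LipschitzWith K B) ∧ IsNormalOnBoundary Ω B

/-- The unit ball of `C_T^{0,1}(Ω, ℝ³)` for the norm `sup |B| + Lip(B)`. -/
def ctUnitBall (Ω : SmoothDomain) : Set C(Ω.Closure, E3) :=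
  {B | IsNormalOnBoundary Ω B ∧ ∃ K : ℝ≥0, LipschitzWith K B ∧ ‖B‖ + K ≤ 1}

/-- A field on `Ω̄`, as a function on `ℝ³` (by the value `0` outside `Ω̄`, which plays no role). -/
noncomputable def toFun (Ω : SmoothDomain) (B : C(Ω.Closure, E3)) (x : E3) : E3 :=
  open Classical in if h : x ∈ closure Ω.carrier then B ⟨x, h⟩ else 0

/-! ### Currents -/

/-- A `1`-current of finite mass supported in the compact set `Ω̄`. Such a current extends uniquely
from smooth compactly supported `1`-forms to a bounded linear functional on the continuous `1`-forms
(that is, vector fields) on `Ω̄`, and every such functional arises in this way. The value of the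
current `T` on the field `B` is `T B`, and the mass `|T|`, which is the supremum of `T B` over
`‖B‖_∞ ≤ 1`, is the operator norm `‖T‖`. -/
abbrev FiniteMassCurrent (Ω : SmoothDomain) : Type := C(Ω.Closure, E3) →L[ℝ] ℝ

/-- The differential `dφ` of a smooth function, as a continuous vector field on `Ω̄`. -/
noncomputable def gradField (Ω : SmoothDomain) (φ : E3 → ℝ) (hφ : ContDiff ℝ ∞ φ) :
    C(Ω.Closure, E3) where
  toFun x := gradient φ x
  continuous_toFun := by
    have h : Continuous (fderiv ℝ φ) := hφ.continuous_fderiv (by simp)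
    exact ((InnerProductSpace.toDual ℝ E3).symm.continuous.comp h).comp continuous_subtype_val

/-- The boundary `∂T : φ ↦ T (dφ)` has finite mass. -/
def HasFiniteMassBoundary (Ω : SmoothDomain) (T : FiniteMassCurrent Ω) : Prop :=
  ∃ C : ℝ, ∀ (φ : E3 → ℝ) (hφ : ContDiff ℝ ∞ φ), HasCompactSupport φ →
    (∀ x, |φ x| ≤ 1) → T (gradField Ω φ hφ) ≤ C

/-- `T` has zero boundary relative to `Ω`, that is, `T` is divergence free in `Ω`. -/
def IsDivFree (Ω : SmoothDomain) (T : FiniteMassCurrent Ω) : Prop :=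
  ∀ (φ : E3 → ℝ) (hφ : ContDiff ℝ ∞ φ), HasCompactSupport φ → tsupport φ ⊆ Ω.carrier →
    T (gradField Ω φ hφ) = 0

/-- The space `𝒩` of normal `1`-currents supported in `Ω̄` and divergence free in `Ω`, i.e. with
boundary supported on `∂Ω`. -/
def normalCurrents (Ω : SmoothDomain) : Set (FiniteMassCurrent Ω) :=
  {T | HasFiniteMassBoundary Ω T ∧ IsDivFree Ω T}

/-- The norm `‖T‖_*`, dual to the norm of `C_T^{0,1}(Ω, ℝ³)`. -/
noncomputable def starNorm (Ω : SmoothDomain) (T : FiniteMassCurrent Ω) : ℝ :=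
  sSup ((fun B => T B) '' ctUnitBall Ω)

/-- The ratio `R(T) = ⟨B₀, T⟩ / |T|`. -/
noncomputable def ratio (Ω : SmoothDomain) (B₀ : C(Ω.Closure, E3)) (T : FiniteMassCurrent Ω) : ℝ :=
  T B₀ / ‖T‖

/-! ### Curves as currents -/

/-- `γ`, restricted to `[a, b]`, is a continuous curve in `Ω̄` with integrable velocity. -/
def IsCurveIn (Ω : SmoothDomain) (γ : ℝ → E3) (a b : ℝ) : Prop :=
  a ≤ b ∧ ContinuousOn γ (Icc a b) ∧ MapsTo γ (Icc a b) (closure Ω.carrier) ∧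
    IntervalIntegrable (deriv γ) volume a b

theorem toFun_norm_le (Ω : SmoothDomain) (B : C(Ω.Closure, E3)) (x : E3) :
    ‖toFun Ω B x‖ ≤ ‖B‖ := by
  unfold toFun
  split_ifs with h
  · exact B.norm_coe_le_norm _
  · simp

theorem integrable_circulation (Ω : SmoothDomain) {γ : ℝ → E3} {a b : ℝ}
    (h : IsCurveIn Ω γ a b) (B : C(Ω.Closure, E3)) :
    IntervalIntegrable (fun t => ⟪toFun Ω B (γ t), deriv γ t⟫) volume a b := by
  obtain ⟨hab, hc, hm, hi⟩ := h
  have hcont : ContinuousOn (fun t => toFun Ω B (γ t)) (Icc a b) := by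
    rw [continuousOn_iff_continuous_domRestrict]
    have : (Icc a b).domRestrict (fun t => toFun Ω B (γ t))
        = fun t : Icc a b => B ⟨γ t, hm t.2⟩ := by
      ext1 t
      have ht : γ t ∈ closure Ω.carrier := hm t.2
      simp [Set.domRestrict, toFun, ht]
    rw [this]
    exact B.continuous.comp
      (Continuous.subtype_mk (continuousOn_iff_continuous_domRestrict.mp hc) _)
  rw [intervalIntegrable_iff_integrableOn_Ioc_of_le hab] at hi ⊢
  have hms : AEStronglyMeasurable (fun t => toFun Ω B (γ t)) (volume.restrict (Ioc a b)) :=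
    (hcont.mono Ioc_subset_Icc_self).aestronglyMeasurable measurableSet_Ioc
  refine Integrable.mono' (hi.norm.const_mul ‖B‖) (hms.inner hi.aestronglyMeasurable) ?_
  refine Eventually.of_forall fun t => ?_
  exact (norm_inner_le_norm _ _).trans
    (mul_le_mul_of_nonneg_right (toFun_norm_le Ω B _) (norm_nonneg _))

/-- The circulation `B ↦ ∫_γ B` along a curve in `Ω̄`. -/
noncomputable def circulation (Ω : SmoothDomain) {γ : ℝ → E3} {a b : ℝ}
    (h : IsCurveIn Ω γ a b) : FiniteMassCurrent Ω :=
  LinearMap.mkContinuous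
    { toFun := fun B => ∫ t in a..b, ⟪toFun Ω B (γ t), deriv γ t⟫
      map_add' := fun B B' => by
        rw [← intervalIntegral.integral_add (integrable_circulation Ω h B)
          (integrable_circulation Ω h B')]
        congr 1
        ext t
        rw [← inner_add_left]
        congr 1
        unfold toFun
        split_ifs <;> simp
      map_smul' := fun c B => by
        rw [RingHom.id_apply, smul_eq_mul, ← intervalIntegral.integral_const_mul]
        congr 1
        ext t
        rw [← real_inner_smul_left]
        congr 1
        unfold toFun
        split_ifs <;> simp }
    (∫ t in a..b, ‖deriv γ t‖) (fun B => by
      change ‖∫ t in a..b, ⟪toFun Ω B (γ t), deriv γ t⟫‖ ≤ _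
      rw [← intervalIntegral.integral_mul_const]
      refine intervalIntegral.norm_integral_le_of_norm_le h.1 ?_ (h.2.2.2.norm.mul_const _)
      refine Eventually.of_forall fun t _ => ?_
      rw [mul_comm]
      exact (norm_inner_le_norm _ _).trans
        (mul_le_mul_of_nonneg_right (toFun_norm_le Ω B _) (norm_nonneg _)))

/-- The current carried by the curve `γ : [a, b] → Ω̄` (the zero current if `γ` is not a curve
in `Ω̄`). -/
noncomputable def curveCurrent (Ω : SmoothDomain) (γ : ℝ → E3) (a b : ℝ) : FiniteMassCurrent Ω :=
  open Classical in if h : IsCurveIn Ω γ a b then circulation Ω h else 0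

/-- The class `X` of simple oriented Lipschitz curves in `Ω̄`, which are either arcs with their two
(distinct) endpoints on `∂Ω` or loops. -/
def simpleCurves (Ω : SmoothDomain) : Set (FiniteMassCurrent Ω) :=
  {T | ∃ (γ : ℝ → E3) (a b : ℝ), a < b ∧ (∃ K : ℝ≥0, LipschitzOnWith K γ (Icc a b)) ∧
    MapsTo γ (Icc a b) (closure Ω.carrier) ∧
    ((InjOn γ (Icc a b) ∧ γ a ∈ frontier Ω.carrier ∧ γ b ∈ frontier Ω.carrier) ∨
      (InjOn γ (Ico a b) ∧ γ a = γ b)) ∧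
    T = curveCurrent Ω γ a b}

/-- `γ : [0, L] → Ω̄` is an arclength parametrization of a smooth simple curve (of length `L`) with
endpoints on `∂Ω`. -/
structure IsSmoothSimpleArc (Ω : SmoothDomain) (γ : ℝ → E3) (L : ℝ) : Prop where
  length_pos : 0 < L
  smooth : ContDiffOn ℝ ∞ γ (Icc 0 L)
  arclength : ∀ z ∈ Icc 0 L, ‖derivWithin γ (Icc 0 L) z‖ = 1
  simple : InjOn γ (Icc 0 L)
  mapsTo : MapsTo γ (Icc 0 L) (closure Ω.carrier)
  left_mem : γ 0 ∈ frontier Ω.carrier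
  right_mem : γ L ∈ frontier Ω.carrier

/-- The vector field `B` is of class `C²`, up to `∂Ω`, in a neighborhood of the arc. -/
def IsC2Near (Ω : SmoothDomain) (B : C(Ω.Closure, E3)) (γ : ℝ → E3) (L : ℝ) : Prop :=
  ∃ U : Set E3, IsOpen U ∧ γ '' Icc 0 L ⊆ U ∧
    ContDiffOn ℝ 2 (toFun Ω B) (U ∩ closure Ω.carrier)

/-! ### Tube coordinates and the second derivative of the ratio -/

/-- The closed cylinder of radius `δ` and height `L`. -/
def cylinder (δ L : ℝ) : Set (E2 × ℝ) := Metric.closedBall 0 δ ×ˢ Icc 0 L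

/-- `Φ` (the inverse of the chart) gives tube coordinates around the curve `γ : [0, L] → Ω̄`: it is a
smooth diffeomorphism from a cylinder onto a neighborhood of the curve in `Ω̄`, it maps the vertical
axis to the curve and the two bases of the cylinder into `∂Ω`, and the Euclidean metric `g`
in these coordinates satisfies `g₁₃ = g₂₃ = 0`. -/
structure IsTubeCoordinates (Ω : SmoothDomain) (γ : ℝ → E3) (L δ : ℝ) (Φ : E2 × ℝ → E3) :
    Prop where
  radius_pos : 0 < δ
  smooth : ContDiffOn ℝ ∞ Φ (cylinder δ L)
  injOn : InjOn Φ (cylinder δ L)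
  immersion : ∀ p ∈ cylinder δ L, Function.Injective (fderivWithin ℝ Φ (cylinder δ L) p)
  mapsTo : MapsTo Φ (cylinder δ L) (closure Ω.carrier)
  nhd : ∃ U : Set E3, IsOpen U ∧ γ '' Icc 0 L ⊆ U ∧ U ∩ closure Ω.carrier ⊆ Φ '' cylinder δ L
  axis : ∀ z ∈ Icc 0 L, Φ (0, z) = γ z
  orthogonal : ∀ p ∈ cylinder δ L, ∀ v : E2,
    ⟪fderivWithin ℝ Φ (cylinder δ L) p (v, 0), fderivWithin ℝ Φ (cylinder δ L) p (0, 1)⟫ = 0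
  bottom : ∀ v ∈ Metric.closedBall (0 : E2) δ, Φ (v, 0) ∈ frontier Ω.carrier
  top : ∀ v ∈ Metric.closedBall (0 : E2) δ, Φ (v, L) ∈ frontier Ω.carrier

/-- `u ∈ H¹((0, L), ℝ²)`, where `u` is the continuous representative: `u` is a primitive of an
`L²` function. -/
def IsH1 (L : ℝ) (u : ℝ → E2) : Prop :=
  ∃ w : ℝ → E2, MemLp w 2 (volume.restrict (Ioc 0 L)) ∧
    ∀ z ∈ Icc 0 L, u z = u 0 + ∫ s in (0 : ℝ)..z, w s

/-- `Q(u) = - d²/dt²|_{t = 0} R(Γ_t)`, where, in the coordinates `Φ`, the curve `Γ_t` is the graph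
`z ↦ Γ₀(z) + t u(z)`. -/
noncomputable def Q (Ω : SmoothDomain) (B₀ : C(Ω.Closure, E3)) (Φ : E2 × ℝ → E3) (L : ℝ)
    (u : ℝ → E2) : ℝ :=
  - iteratedDeriv 2 (fun t : ℝ => ratio Ω B₀ (curveCurrent Ω (fun z => Φ (t • u z, z)) 0 L)) 0

/-- The second derivative of the ratio at `γ : [0, L] → Ω̄` is negative definite: in tube coordinates
around the curve, the quadratic form `Q` is positive definite on `H¹((0, L), ℝ²)`. -/
def HasNegDefSecondDeriv (Ω : SmoothDomain) (B₀ : C(Ω.Closure, E3)) (γ : ℝ → E3) (L : ℝ) : Prop :=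
  ∃ (δ : ℝ) (Φ : E2 × ℝ → E3), IsTubeCoordinates Ω γ L δ Φ ∧
    ∀ u : ℝ → E2, IsH1 L u → (∃ z ∈ Icc 0 L, u z ≠ 0) → 0 < Q Ω B₀ Φ L u

/-- `T₀` maximizes the ratio among the nonzero currents of `𝒩`. -/
def MaximizesRatio (Ω : SmoothDomain) (B₀ : C(Ω.Closure, E3)) (T₀ : FiniteMassCurrent Ω) : Prop :=
  T₀ ∈ normalCurrents Ω ∧ T₀ ≠ 0 ∧
    ∀ T ∈ normalCurrents Ω, T ≠ 0 → ratio Ω B₀ T ≤ ratio Ω B₀ T₀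

end Isoflux

open Isoflux

/-!
Write `m` for the ratio of `Γ₀`, and call `m |Γ| - ⟨B₀, Γ⟩` the deficit of a curve `Γ`. It is
nonnegative because `Γ₀` maximizes the ratio, and `m > 0`, for otherwise the ratio would vanish
identically and so would `Q` (`MaximizesRatio.ratio_pos`). As `R(Γ₀) - R(Γ)` is the deficit divided
by `|Γ|`, the theorem asserts that the deficit dominates `‖Γ - Γ₀‖_*²` near `Γ₀`, and that `R(Γ)`
stays away from `m` elsewhere.

*Near the axis.* In the tube, a curve from base to base has coordinates `(v, z)` and velocity
`(w, ζ)`. The vertical direction being orthogonal to the horizontal ones, its speed exceeds `|∂_z Φ| ζ`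
by about half of `|D_w Φ|² / |∂_z Φ|`. What remains of the deficit is the integral of a `1`-form,
`deficitForm`, whose horizontal part vanishes on the bases because `B₀` is normal to `∂Ω`. Such an
integral depends only on the exterior derivative of the form: subtracting the differential of a
function that vanishes at the ends of the curve gives its expansion to second order in `v`, where
only a product `|v| |w|` and no `|w|²` occurs (`exists_integral_form_expansion`). The linear term
vanishes, as the first variation of the deficit (`IsDeficitTube.axisLin_eq_zero`). The quadratic
term is half of `quadForm`, which is positive on `H¹ ∖ {0}`: since `Q(u) > 0`, the ratio decreases
quadratically along the graphs of `t u` (`IsDeficitTube.quadForm_pos`). Hence it is coercive, by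
weak compactness in `H¹` (`exists_coercive`). The same expansion holds for all curves close to the
axis, even if they are not graphs, as long as their speed is almost `1`
(`IsDeficitTube.exists_deficit_ge`). The dual norm of `Γ - Γ₀` is bounded by the `H¹` norm of `v`
(`IsTubeCoordinates.exists_starNorm_sq_le`), and the estimate follows near the axis
(`IsDeficitTube.exists_local_estimate`).

*Away from the axis.* It remains to see that a maximizing sequence in `X`, parametrized on `[0, L₀]`
with constant speed, converges uniformly to the axis (`exists_close`). Loops have no boundary, and
the boundary of a long arc is negligible with respect to its mass; a weak limit of the normalized
currents would be a maximizer without boundary, hence not a multiple of `Γ₀`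
(`MaximizesRatio.false_of_boundary_tendsto_zero`). An arc that shrinks to a boundary point has small
ratio, since its chord is almost tangent to `∂Ω` while `B₀` is normal to it
(`exists_radius_short_arc`). In the other cases a limit arc exists and is a maximizer, hence carries
the current of the axis, and so it is the axis itself (`IsBoundaryArc.eqOn_of_maximizes`). Finally,
an arc between boundary points that is uniformly close to the axis lies in the tube and joins its
two bases (`IsTubeCoordinates.exists_tubeCurve_of_close`).
-/

set_option maxSynthPendingDepth 3

namespace Isoflux

/-! ### Absolutely continuous curves -/

section

variable {E F : Type*} [NormedAddCommGroup E] [NormedSpace ℝ E] [NormedAddCommGroup F]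
  [NormedSpace ℝ F]

/-- On `[a, b]`, the curve `p` is a primitive of the integrable function `p'`; in other words, `p`
is absolutely continuous with velocity `p'`. The velocity is an explicit argument, so that it may be
any representative of its class modulo null functions, rather than `deriv p`. -/
structure IsPrimitiveOn (p p' : ℝ → E) (a b : ℝ) : Prop where
  integrable : IntervalIntegrable p' volume a b
  eq : ∀ t ∈ Icc a b, p t = p a + ∫ s in a..t, p' s

theorem absolutelyContinuousOnInterval_of_dist_le {X Y : Type*} [PseudoMetricSpace X]
    [PseudoMetricSpace Y] {f : ℝ → X} {g : ℝ → Y} {a b : ℝ}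
    (hg : AbsolutelyContinuousOnInterval g a b)
    (h : ∀ x ∈ uIcc a b, ∀ y ∈ uIcc a b, dist (f x) (f y) ≤ dist (g x) (g y)) :
    AbsolutelyContinuousOnInterval f a b := by
  rw [absolutelyContinuousOnInterval_iff] at hg ⊢
  intro ε hε
  obtain ⟨δ, hδ, H⟩ := hg ε hε
  refine ⟨δ, hδ, fun I hI hlt => lt_of_le_of_lt (Finset.sum_le_sum fun i hi => ?_) (H I hI hlt)⟩
  exact h _ (hI.1 i hi).1 _ (hI.1 i hi).2

theorem ae_restrict_Ioc_of_Ioo {P : ℝ → Prop} {a b : ℝ} (h : ∀ᵐ t, t ∈ Ioo a b → P t) :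
    ∀ᵐ t ∂volume.restrict (Ioc a b), P t := by
  rw [← Measure.restrict_congr_set Ioo_ae_eq_Ioc]
  exact (ae_restrict_iff' measurableSet_Ioo).mpr h

/-- The fundamental theorem of calculus for curves whose increments are dominated by those of a
primitive of an integrable function. -/
theorem isPrimitiveOn_of_norm_sub_le [CompleteSpace F] {f f' : ℝ → F} {g : ℝ → ℝ} {a b : ℝ}
    (hab : a ≤ b) (hg : IntervalIntegrable g volume a b)
    (hfg : ∀ x ∈ Icc a b, ∀ y ∈ Icc a b, ‖f y - f x‖ ≤ |∫ s in x..y, g s|)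
    (hf : ∀ᵐ t, t ∈ Ioo a b → HasDerivAt f (f' t) t) : IsPrimitiveOn f f' a b := by
  have hna : ∀ᵐ x : ℝ, x ≠ a := by simp [ae_iff, measure_singleton]
  have hnb : ∀ᵐ x : ℝ, x ≠ b := by simp [ae_iff, measure_singleton]
  have hsub : ∀ x ∈ Icc a b, ∀ y ∈ Icc a b,
      (∫ s in a..y, g s) - ∫ s in a..x, g s = ∫ s in x..y, g s := by
    intro x hx y hy
    apply intervalIntegral.integral_interval_sub_left
    · exact hg.mono_set (by rw [uIcc_of_le hab, uIcc_of_le hy.1]; exact Icc_subset_Icc le_rfl hy.2)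
    · exact hg.mono_set (by rw [uIcc_of_le hab, uIcc_of_le hx.1]; exact Icc_subset_Icc le_rfl hx.2)
  have hG : AbsolutelyContinuousOnInterval (fun x => ∫ s in a..x, g s) a b :=
    hg.absolutelyContinuousOnInterval_intervalIntegral left_mem_uIcc
  have hfac : AbsolutelyContinuousOnInterval f a b := by
    refine absolutelyContinuousOnInterval_of_dist_le hG fun x hx y hy => ?_
    rw [uIcc_of_le hab] at hx hy
    rw [dist_eq_norm, Real.dist_eq, hsub y hy x hx]
    exact hfg y hy x hx
  -- compare the difference quotients of `f` with those of the primitive of `g`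
  have hbound : ∀ᵐ t, t ∈ Ioo a b → ‖f' t‖ ≤ ‖g t‖ := by
    filter_upwards [hf, hg.ae_hasDerivAt_integral] with t h1 h2 ht
    have h1 := h1 ht
    have h2 := h2 (by rw [uIcc_of_le hab]; exact Ioo_subset_Icc_self ht) a left_mem_uIcc
    have l1 := (hasDerivAt_iff_tendsto_slope.mp h1).norm
    have l2 := (hasDerivAt_iff_tendsto_slope.mp h2).norm
    refine le_of_tendsto_of_tendsto l1 l2 ?_
    filter_upwards [mem_nhdsWithin_of_mem_nhds (Icc_mem_nhds ht.1 ht.2)] with y hy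
    rw [slope_def_module, slope_def_module, norm_smul, norm_smul]
    refine mul_le_mul_of_nonneg_left ?_ (norm_nonneg _)
    rw [hsub t (Ioo_subset_Icc_self ht) y hy]
    exact hfg t (Ioo_subset_Icc_self ht) y hy
  have hint : IntervalIntegrable f' volume a b := by
    rw [intervalIntegrable_iff_integrableOn_Ioc_of_le hab] at hg ⊢
    have hae : deriv f =ᵐ[volume.restrict (Ioc a b)] f' :=
      ae_restrict_Ioc_of_Ioo (hf.mono fun t ht h => (ht h).deriv)
    exact Integrable.mono hg ((aestronglyMeasurable_deriv f _).congr hae)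
      (ae_restrict_Ioc_of_Ioo hbound)
  refine ⟨hint, fun t ht => ?_⟩
  have hI : AbsolutelyContinuousOnInterval (fun x => ∫ s in a..x, f' s) a b := by
    refine absolutelyContinuousOnInterval_of_dist_le
      (hint.norm.absolutelyContinuousOnInterval_intervalIntegral left_mem_uIcc) fun x hx y hy => ?_
    have hx' := (uIcc_subset_uIcc left_mem_uIcc hx)
    have hy' := (uIcc_subset_uIcc left_mem_uIcc hy)
    rw [dist_eq_norm, Real.dist_eq, intervalIntegral.integral_interval_sub_left
      (hint.mono_set hx') (hint.mono_set hy'), intervalIntegral.integral_interval_sub_left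
      (hint.norm.mono_set hx') (hint.norm.mono_set hy')]
    exact intervalIntegral.norm_integral_le_abs_integral_norm
  -- an absolutely continuous function with zero derivative almost everywhere is constant
  obtain ⟨c, hc⟩ := (hfac.sub hI).const_of_ae_hasDerivAt_zero (by
    filter_upwards [hf, hint.ae_hasDerivAt_integral, hna, hnb] with t h1 h2 ha hb ht
    have h2 := h2 ht a left_mem_uIcc
    rw [uIcc_of_le hab] at ht
    simpa using (h1 ⟨lt_of_le_of_ne ht.1 (Ne.symm ha), lt_of_le_of_ne ht.2 hb⟩).sub h2)
  rw [uIcc_of_le hab] at hc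
  have h1 := hc t ht
  have h2 := hc a ⟨le_rfl, hab⟩
  simp only [Pi.sub_apply, intervalIntegral.integral_same, sub_zero] at h1 h2
  rw [h2, ← h1]; abel

namespace IsPrimitiveOn

variable {p p' q q' : ℝ → E} {a b : ℝ}

theorem ae_hasDerivAt [CompleteSpace E] (h : IsPrimitiveOn p p' a b) (hab : a ≤ b) :
    ∀ᵐ t, t ∈ Ioo a b → HasDerivAt p (p' t) t := by
  filter_upwards [h.integrable.ae_hasDerivAt_integral] with t h2 ht
  have h2 := h2 (by rw [uIcc_of_le hab]; exact Ioo_subset_Icc_self ht) a left_mem_uIcc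
  refine (h2.const_add (p a)).congr_of_eventuallyEq ?_
  filter_upwards [Icc_mem_nhds ht.1 ht.2] with y hy using h.eq y hy

theorem integrableOn (h : IsPrimitiveOn p p' a b) (hab : a ≤ b) :
    IntegrableOn p' (Ioc a b) :=
  (intervalIntegrable_iff_integrableOn_Ioc_of_le hab).mp h.integrable

theorem sub_eq (h : IsPrimitiveOn p p' a b) (hab : a ≤ b) {x y : ℝ} (hx : x ∈ Icc a b)
    (hy : y ∈ Icc a b) : p y - p x = ∫ s in x..y, p' s := by
  rw [← intervalIntegral.integral_interval_sub_left (a := a), h.eq x hx, h.eq y hy]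
  · abel
  · exact h.integrable.mono_set (by
      rw [uIcc_of_le hab, uIcc_of_le hy.1]; exact Icc_subset_Icc le_rfl hy.2)
  · exact h.integrable.mono_set (by
      rw [uIcc_of_le hab, uIcc_of_le hx.1]; exact Icc_subset_Icc le_rfl hx.2)

theorem continuousOn [CompleteSpace E] (h : IsPrimitiveOn p p' a b) (hab : a ≤ b) :
    ContinuousOn p (Icc a b) := by
  have h1 : ContinuousOn (fun t => p a + ∫ s in a..t, p' s) (Icc a b) := by
    refine continuousOn_const.add ?_
    have := intervalIntegral.continuousOn_primitive_interval' h.integrable left_mem_uIcc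
    rwa [uIcc_of_le hab] at this
  exact h1.congr fun t ht => h.eq t ht

theorem aestronglyMeasurable [CompleteSpace E] (h : IsPrimitiveOn p p' a b) (hab : a ≤ b) :
    AEStronglyMeasurable p (volume.restrict (Ioc a b)) :=
  ((h.continuousOn hab).mono Ioc_subset_Icc_self).aestronglyMeasurable measurableSet_Ioc

theorem sub_left_eq_integral (h : IsPrimitiveOn p p' a b) (hab : a ≤ b) :
    ∫ s in a..b, p' s = p b - p a := by
  rw [h.eq b ⟨hab, le_rfl⟩]; abel

theorem norm_sub_le_abs (h : IsPrimitiveOn p p' a b) (hab : a ≤ b) {x y : ℝ} (hx : x ∈ Icc a b)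
    (hy : y ∈ Icc a b) : ‖p y - p x‖ ≤ |∫ s in x..y, ‖p' s‖| := by
  rw [h.sub_eq hab hx hy]; exact intervalIntegral.norm_integral_le_abs_integral_norm

/-- The chain rule: a Lipschitz differentiable function of an absolutely continuous curve is
absolutely continuous. -/
theorem comp [CompleteSpace E] [CompleteSpace F] (h : IsPrimitiveOn p p' a b) (hab : a ≤ b)
    {f : E → F} {f' : E → E →L[ℝ] F} {s : Set E} {C : ℝ≥0}
    (hf : ∀ x ∈ s, HasFDerivWithinAt f (f' x) s x) (hC : LipschitzOnWith C f s)
    (hp : MapsTo p (Icc a b) s) :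
    IsPrimitiveOn (fun t => f (p t)) (fun t => f' (p t) (p' t)) a b := by
  refine isPrimitiveOn_of_norm_sub_le hab (h.integrable.norm.const_mul C) ?_ ?_
  · intro x hx y hy
    rw [intervalIntegral.integral_const_mul, abs_mul, abs_of_nonneg C.coe_nonneg]
    exact (hC.norm_sub_le (hp hy) (hp hx)).trans
      (mul_le_mul_of_nonneg_left (h.norm_sub_le_abs hab hx hy) C.2)
  · filter_upwards [h.ae_hasDerivAt hab] with t h1 ht
    have := (hf _ (hp (Ioo_subset_Icc_self ht))).comp_hasDerivAt t (h1 ht)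
      (by filter_upwards [Icc_mem_nhds ht.1 ht.2] with y hy using hp hy)
    exact this

/-- Rademacher's theorem for curves. -/
theorem of_lipschitzOnWith [FiniteDimensional ℝ E] {K : ℝ≥0} (hab : a ≤ b)
    (h : LipschitzOnWith K p (Icc a b)) : IsPrimitiveOn p (deriv p) a b := by
  have : CompleteSpace E := FiniteDimensional.complete ℝ E
  refine isPrimitiveOn_of_norm_sub_le hab (g := fun _ => K) intervalIntegrable_const ?_ ?_
  · intro x hx y hy
    rw [intervalIntegral.integral_const, smul_eq_mul, abs_mul, abs_of_nonneg K.coe_nonneg, mul_comm,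
      ← Real.norm_eq_abs]
    exact h.norm_sub_le hy hx
  · filter_upwards [h.ae_differentiableWithinAt_of_mem_real] with t h1 ht
    exact ((h1 (Ioo_subset_Icc_self ht)).differentiableAt (Icc_mem_nhds ht.1 ht.2)).hasDerivAt

end IsPrimitiveOn

theorem norm_deriv_le_of_lipschitzOnWith_Icc {p : ℝ → E} {a b : ℝ} {K : ℝ≥0}
    (h : LipschitzOnWith K p (Icc a b)) {t : ℝ} (ht : t ∈ Ioo a b) : ‖deriv p t‖ ≤ K :=
  norm_deriv_le_of_lipschitzOn (Icc_mem_nhds ht.1 ht.2) h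

end

/-! ### Currents carried by curves -/

section

variable {Ω : SmoothDomain}

theorem toFun_of_mem (B : C(Ω.Closure, E3)) {x : E3} (hx : x ∈ closure Ω.carrier) :
    toFun Ω B x = B ⟨x, hx⟩ := by
  simp [toFun, hx]

theorem continuousOn_toFun (B : C(Ω.Closure, E3)) :
    ContinuousOn (toFun Ω B) (closure Ω.carrier) := by
  rw [continuousOn_iff_continuous_domRestrict]
  refine B.continuous.congr fun x => ?_
  simp [Set.domRestrict, toFun]

theorem exists_uniform_toFun (B : C(Ω.Closure, E3)) {ε : ℝ} (hε : 0 < ε) :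
    ∃ η > 0, ∀ x ∈ closure Ω.carrier, ∀ y ∈ closure Ω.carrier, ‖x - y‖ < η →
      ‖toFun Ω B x - toFun Ω B y‖ ≤ ε := by
  have hK : IsCompact (closure Ω.carrier) := Ω.isBounded.isCompact_closure
  obtain ⟨η, hη, h⟩ := Metric.uniformContinuousOn_iff.mp
    (hK.uniformContinuousOn_of_continuous (continuousOn_toFun B)) ε hε
  refine ⟨η, hη, fun x hx y hy hxy => ?_⟩
  rw [← dist_eq_norm] at hxy ⊢
  exact (h x hx y hy hxy).le

section Curve

variable {γ γ' : ℝ → E3} {a b : ℝ}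

theorem intervalIntegrable_inner_left (v : E3) (h : IntervalIntegrable γ volume a b) :
    IntervalIntegrable (fun t => ⟪v, γ t⟫) volume a b :=
  ⟨(innerSL ℝ v).integrable_comp h.1, (innerSL ℝ v).integrable_comp h.2⟩

theorem IsPrimitiveOn.deriv_ae_eq (h : IsPrimitiveOn γ γ' a b) (hab : a ≤ b) :
    deriv γ =ᵐ[volume.restrict (Ioc a b)] γ' :=
  ae_restrict_Ioc_of_Ioo ((h.ae_hasDerivAt hab).mono fun _ ht h => (ht h).deriv)

theorem IsPrimitiveOn.isCurveIn (h : IsPrimitiveOn γ γ' a b) (hab : a ≤ b)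
    (hm : MapsTo γ (Icc a b) (closure Ω.carrier)) : IsCurveIn Ω γ a b := by
  refine ⟨hab, h.continuousOn hab, hm, ?_⟩
  rw [intervalIntegrable_iff_integrableOn_Ioc_of_le hab]
  exact (h.integrableOn hab).congr (h.deriv_ae_eq hab).symm

theorem curveCurrent_apply (h : IsPrimitiveOn γ γ' a b) (hab : a ≤ b)
    (hm : MapsTo γ (Icc a b) (closure Ω.carrier)) (B : C(Ω.Closure, E3)) :
    curveCurrent Ω γ a b B = ∫ t in a..b, ⟪toFun Ω B (γ t), γ' t⟫ := by
  have hc := h.isCurveIn hab hm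
  rw [curveCurrent, dif_pos hc]
  change ∫ t in a..b, ⟪toFun Ω B (γ t), deriv γ t⟫ = _
  rw [intervalIntegral.integral_of_le hab, intervalIntegral.integral_of_le hab]
  refine integral_congr_ae ?_
  filter_upwards [h.deriv_ae_eq hab] with t ht
  rw [ht]

theorem IsPrimitiveOn.intervalIntegrable_inner (h : IsPrimitiveOn γ γ' a b) (hab : a ≤ b)
    (hm : MapsTo γ (Icc a b) (closure Ω.carrier)) (B : C(Ω.Closure, E3)) :
    IntervalIntegrable (fun t => ⟪toFun Ω B (γ t), γ' t⟫) volume a b := by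
  have := integrable_circulation Ω (h.isCurveIn hab hm) B
  rw [intervalIntegrable_iff_integrableOn_Ioc_of_le hab] at this ⊢
  refine this.congr ?_
  filter_upwards [h.deriv_ae_eq hab] with t ht
  rw [ht]

theorem norm_curveCurrent_le (h : IsPrimitiveOn γ γ' a b) (hab : a ≤ b)
    (hm : MapsTo γ (Icc a b) (closure Ω.carrier)) :
    ‖curveCurrent Ω γ a b‖ ≤ ∫ t in a..b, ‖γ' t‖ := by
  refine ContinuousLinearMap.opNorm_le_bound _
    (intervalIntegral.integral_nonneg hab fun _ _ => norm_nonneg _) fun B => ?_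
  rw [curveCurrent_apply h hab hm, ← intervalIntegral.integral_mul_const]
  refine intervalIntegral.norm_integral_le_of_norm_le hab ?_ (h.integrable.norm.mul_const _)
  refine Eventually.of_forall fun t _ => ?_
  rw [mul_comm]
  exact (norm_inner_le_norm _ _).trans
    (mul_le_mul_of_nonneg_right (toFun_norm_le Ω B _) (norm_nonneg _))

/-- The boundary of the current carried by a curve is the difference of the endpoints. -/
theorem curveCurrent_gradField (h : IsPrimitiveOn γ γ' a b) (hab : a ≤ b)
    (hm : MapsTo γ (Icc a b) (closure Ω.carrier)) {φ : E3 → ℝ} (hφ : ContDiff ℝ ∞ φ)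
    (hc : HasCompactSupport φ) :
    curveCurrent Ω γ a b (gradField Ω φ hφ) = φ (γ b) - φ (γ a) := by
  obtain ⟨C, hC⟩ := hφ.lipschitzWith_of_hasCompactSupport hc (by simp)
  have h1 : IsPrimitiveOn (fun t => φ (γ t)) (fun t => fderiv ℝ φ (γ t) (γ' t)) a b :=
    h.comp hab (s := univ) (f' := fderiv ℝ φ)
      (fun x _ => ((hφ.differentiable (by simp)) x).hasFDerivAt.hasFDerivWithinAt)
      hC.lipschitzOnWith (fun _ _ => mem_univ _)
  rw [curveCurrent_apply h hab hm, ← h1.sub_left_eq_integral hab]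
  refine intervalIntegral.integral_congr fun t ht => ?_
  rw [uIcc_of_le hab] at ht
  simp only [toFun_of_mem _ (hm ht)]
  exact InnerProductSpace.toDual_symm_apply

theorem frontier_disjoint_carrier {x : E3} (hx : x ∈ frontier Ω.carrier) : x ∉ Ω.carrier := by
  rw [Ω.isOpen.frontier_eq] at hx
  exact hx.2

theorem curveCurrent_mem_normalCurrents (h : IsPrimitiveOn γ γ' a b) (hab : a ≤ b)
    (hm : MapsTo γ (Icc a b) (closure Ω.carrier))
    (he : (γ a ∈ frontier Ω.carrier ∧ γ b ∈ frontier Ω.carrier) ∨ γ a = γ b) :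
    curveCurrent Ω γ a b ∈ normalCurrents Ω := by
  refine ⟨⟨2, fun φ hφ hc hb => ?_⟩, fun φ hφ hc hs => ?_⟩
  · rw [curveCurrent_gradField h hab hm hφ hc]
    have h1 := abs_le.mp (hb (γ a))
    have h2 := abs_le.mp (hb (γ b))
    linarith [h1.1, h2.2]
  · rw [curveCurrent_gradField h hab hm hφ hc]
    rcases he with he | he
    · have h0 : ∀ x ∈ frontier Ω.carrier, φ x = 0 := fun x hx =>
        image_eq_zero_of_notMem_tsupport fun hx' => frontier_disjoint_carrier hx (hs hx')
      rw [h0 _ he.1, h0 _ he.2, sub_zero]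
    · rw [he, sub_self]

/-- The value of a curve on a field is approximated by Riemann sums. -/
theorem abs_curveCurrent_sub_sum_le (h : IsPrimitiveOn γ γ' a b) (hab : a ≤ b)
    (hm : MapsTo γ (Icc a b) (closure Ω.carrier)) (B : C(Ω.Closure, E3)) {ε : ℝ}
    {N : ℕ} {t : ℕ → ℝ} (ht : Monotone t) (h0 : t 0 = a) (hN : t N = b)
    (hε : ∀ i < N, ∀ x ∈ Icc (t i) (t (i + 1)),
      ‖toFun Ω B (γ x) - toFun Ω B (γ (t i))‖ ≤ ε) :
    |curveCurrent Ω γ a b B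
      - ∑ i ∈ Finset.range N, ⟪toFun Ω B (γ (t i)), γ (t (i + 1)) - γ (t i)⟫| ≤
      ε * ∫ t in a..b, ‖γ' t‖ := by
  have hmem : ∀ i ≤ N, t i ∈ Icc a b := fun i hi =>
    ⟨h0 ▸ ht (Nat.zero_le i), hN ▸ ht hi⟩
  have hsub : ∀ i < N, uIcc (t i) (t (i + 1)) ⊆ uIcc a b := fun i hi => by
    rw [uIcc_of_le hab, uIcc_of_le (ht i.le_succ)]
    exact Icc_subset_Icc (hmem i hi.le).1 (hmem (i + 1) hi).2
  have hint := h.intervalIntegrable_inner hab hm B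
  rw [curveCurrent_apply h hab hm, ← h0, ← hN,
    ← intervalIntegral.sum_integral_adjacent_intervals
      (fun i hi => hint.mono_set (hsub i hi)),
    ← intervalIntegral.sum_integral_adjacent_intervals
      (fun i hi => h.integrable.norm.mono_set (hsub i hi)), ← Finset.sum_sub_distrib,
    Finset.mul_sum]
  refine (Finset.abs_sum_le_sum_abs _ _).trans (Finset.sum_le_sum fun i hi => ?_)
  have hi : i < N := by simpa using hi
  have hle := ht i.le_succ
  have h1 : ⟪toFun Ω B (γ (t i)), γ (t (i + 1)) - γ (t i)⟫
      = ∫ x in t i..t (i + 1), ⟪toFun Ω B (γ (t i)), γ' x⟫ := by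
    rw [h.sub_eq hab (hmem i hi.le) (hmem (i + 1) hi)]
    exact ((innerSL ℝ (toFun Ω B (γ (t i)))).intervalIntegral_comp_comm
      (h.integrable.mono_set (hsub i hi))).symm
  rw [h1, ← intervalIntegral.integral_sub (hint.mono_set (hsub i hi))
    (intervalIntegrable_inner_left _ (h.integrable.mono_set (hsub i hi))),
    ← intervalIntegral.integral_const_mul, ← Real.norm_eq_abs]
  refine intervalIntegral.norm_integral_le_of_norm_le hle ?_
    ((h.integrable.norm.mono_set (hsub i hi)).const_mul _)
  refine Eventually.of_forall fun x hx => ?_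
  rw [← inner_sub_left]
  exact (norm_inner_le_norm _ _).trans
    (mul_le_mul_of_nonneg_right (hε i hi x (Ioc_subset_Icc_self hx)) (norm_nonneg _))

/-- Along a simple arc, a continuous field of vectors of norm at most `1` extends to `Ω̄`. -/
theorem exists_field_extension (hc : ContinuousOn γ (Icc a b))
    (hm : MapsTo γ (Icc a b) (closure Ω.carrier)) (hinj : InjOn γ (Icc a b)) {h : ℝ → E3}
    (hh : ContinuousOn h (Icc a b)) (h1 : ∀ t ∈ Icc a b, ‖h t‖ ≤ 1) :
    ∃ B : C(Ω.Closure, E3), ‖B‖ ≤ 1 ∧ ∀ t ∈ Icc a b, toFun Ω B (γ t) = h t := by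
  let e : Icc a b → Ω.Closure := fun t => ⟨γ t, hm t.2⟩
  have he : Continuous e :=
    Continuous.subtype_mk (continuousOn_iff_continuous_domRestrict.mp hc) _
  have hei : Function.Injective e := fun x y hxy =>
    Subtype.ext (hinj x.2 y.2 (congrArg Subtype.val hxy))
  let f : C(Icc a b, Metric.closedBall (0 : E3) 1) :=
    ⟨fun t => ⟨h t, mem_closedBall_zero_iff.mpr (h1 t t.2)⟩,
      Continuous.subtype_mk (continuousOn_iff_continuous_domRestrict.mp hh)
        fun t => mem_closedBall_zero_iff.mpr (h1 t t.2)⟩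
  have : TietzeExtension (Metric.closedBall (0 : E3) 1) :=
    Set.instTietzeExtensionUnitClosedBall (𝕜 := ℝ)
  obtain ⟨g, hg⟩ := f.exists_extension' (he.isClosedEmbedding hei)
  refine ⟨⟨fun x => (g x : E3), continuous_subtype_val.comp g.continuous⟩, ?_, fun t ht => ?_⟩
  · rw [ContinuousMap.norm_le _ zero_le_one]
    intro x
    exact mem_closedBall_zero_iff.mp (g x).2
  · rw [toFun_of_mem _ (hm ht)]
    exact congrArg Subtype.val (congrFun hg ⟨t, ht⟩)

/-- If `g` approximates `w`, then the field `g / (|g| + ε)`, of norm less than `1`, almost realizes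
the norm of `w`. -/
theorem inner_normalized_ge {E : Type*} [NormedAddCommGroup E] [InnerProductSpace ℝ E] {ε : ℝ}
    (hε : 0 < ε) (g w : E) :
    ‖w‖ - ε - 2 * ‖w - g‖ ≤ ⟪(‖g‖ + ε)⁻¹ • g, w⟫ := by
  have hp : 0 < ‖g‖ + ε := by positivity
  have e : w = g + (w - g) := by abel
  have h1 : ⟪(‖g‖ + ε)⁻¹ • g, w⟫ = (‖g‖ + ε)⁻¹ * ‖g‖ ^ 2 + ⟪(‖g‖ + ε)⁻¹ • g, w - g⟫ := by
    conv_lhs => rw [e, inner_add_right]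
    rw [real_inner_smul_left, real_inner_self_eq_norm_sq]
  have h2 : ‖(‖g‖ + ε)⁻¹ • g‖ ≤ 1 := by
    rw [norm_smul, norm_inv, Real.norm_of_nonneg hp.le, inv_mul_le_iff₀ hp]
    linarith
  have h3 : -‖w - g‖ ≤ ⟪(‖g‖ + ε)⁻¹ • g, w - g⟫ := by
    have := abs_le.mp (abs_real_inner_le_norm ((‖g‖ + ε)⁻¹ • g) (w - g))
    nlinarith [this.1, norm_nonneg (w - g)]
  have h4 : ‖g‖ - ε ≤ (‖g‖ + ε)⁻¹ * ‖g‖ ^ 2 := by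
    rw [le_inv_mul_iff₀ hp]; nlinarith
  have h5 : ‖w‖ - ‖w - g‖ ≤ ‖g‖ := by
    have := norm_sub_norm_le w (w - g)
    simpa using this
  rw [h1]; linarith

/-- The mass of the current carried by a simple arc is at least its length: along the arc, the unit
tangent vector is approximated in `L¹` by continuous fields, and these extend to `Ω̄`. -/
theorem integral_norm_le_norm_curveCurrent (h : IsPrimitiveOn γ γ' a b) (hab : a ≤ b)
    (hm : MapsTo γ (Icc a b) (closure Ω.carrier)) (hinj : InjOn γ (Icc a b)) :
    ∫ t in a..b, ‖γ' t‖ ≤ ‖curveCurrent Ω γ a b‖ := by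
  refine le_of_forall_pos_le_add fun δ hδ => ?_
  set ε := δ / (b - a + 2) with hεdef
  have hε : 0 < ε := div_pos hδ (by linarith)
  have hi := h.integrableOn hab
  obtain ⟨g, hg, hgi⟩ := Integrable.exists_boundedContinuous_integral_sub_le hi hε
  have hcont : Continuous fun t => (‖g t‖ + ε)⁻¹ • g t :=
    ((g.continuous.norm.add continuous_const).inv₀ fun t =>
      (add_pos_of_nonneg_of_pos (norm_nonneg (g t)) hε).ne').smul g.continuous
  obtain ⟨B, hB1, hB⟩ := exists_field_extension (h := fun t => (‖g t‖ + ε)⁻¹ • g t)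
    (h.continuousOn hab) hm hinj hcont.continuousOn (fun t _ => by
      rw [norm_smul, norm_inv, Real.norm_of_nonneg (by positivity),
        inv_mul_le_iff₀ (by positivity)]
      linarith)
  have h1 : curveCurrent Ω γ a b B ≤ ‖curveCurrent Ω γ a b‖ := by
    refine (le_abs_self _).trans (((curveCurrent Ω γ a b).le_opNorm B).trans ?_)
    exact mul_le_of_le_one_right (norm_nonneg _) hB1
  have hni : IntervalIntegrable (fun t => ‖γ' t‖) volume a b := h.integrable.norm
  have hdi : IntervalIntegrable (fun t => 2 * ‖γ' t - g t‖) volume a b :=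
    ((intervalIntegrable_iff_integrableOn_Ioc_of_le hab).mpr (hi.sub hgi)).norm.const_mul 2
  have h2 : ∫ t in a..b, (‖γ' t‖ - ε - 2 * ‖γ' t - g t‖) ≤ curveCurrent Ω γ a b B := by
    rw [curveCurrent_apply h hab hm]
    refine intervalIntegral.integral_mono_on hab ((hni.sub intervalIntegrable_const).sub hdi)
      (h.intervalIntegrable_inner hab hm B) fun t ht => ?_
    rw [hB t ht]
    exact inner_normalized_ge hε _ _
  rw [intervalIntegral.integral_sub (hni.sub intervalIntegrable_const) hdi,
    intervalIntegral.integral_sub hni intervalIntegrable_const, intervalIntegral.integral_const,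
    intervalIntegral.integral_const_mul, smul_eq_mul] at h2
  rw [← intervalIntegral.integral_of_le hab] at hg
  have h3 : ε * (b - a + 2) = δ := div_mul_cancel₀ _ (by linarith)
  nlinarith

theorem norm_curveCurrent_of_injOn (h : IsPrimitiveOn γ γ' a b) (hab : a ≤ b)
    (hm : MapsTo γ (Icc a b) (closure Ω.carrier)) (hinj : InjOn γ (Icc a b)) :
    ‖curveCurrent Ω γ a b‖ = ∫ t in a..b, ‖γ' t‖ :=
  le_antisymm (norm_curveCurrent_le h hab hm) (integral_norm_le_norm_curveCurrent h hab hm hinj)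

end Curve

end

/-! ### Riemann sums and reparametrization -/

section

variable {Ω : SmoothDomain}

/-- The Riemann sum for the circulation of `B` along `γ : [0, L] → Ω̄`, with `N` equal steps. -/
noncomputable def riemannSum (Ω : SmoothDomain) (B : C(Ω.Closure, E3)) (L : ℝ) (N : ℕ)
    (γ : ℝ → E3) : ℝ :=
  ∑ i ∈ Finset.range N, ⟪toFun Ω B (γ (i * (L / N))),
    γ ((i + 1 : ℕ) * (L / N)) - γ (i * (L / N))⟫

theorem integral_norm_deriv_le {γ : ℝ → E3} {a b : ℝ} {K : ℝ≥0} (hab : a ≤ b)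
    (hK : LipschitzOnWith K γ (Icc a b)) : ∫ t in a..b, ‖deriv γ t‖ ≤ K * (b - a) := by
  have h := (IsPrimitiveOn.of_lipschitzOnWith hab hK).integrable.norm
  have : ∫ t in a..b, ‖deriv γ t‖ ≤ ∫ t in a..b, (K : ℝ) := by
    refine intervalIntegral.integral_mono_ae_restrict hab h intervalIntegrable_const ?_
    rw [Measure.restrict_congr_set Ioo_ae_eq_Icc.symm]
    exact (ae_restrict_iff' measurableSet_Ioo).mpr
      (Eventually.of_forall fun t ht => norm_deriv_le_of_lipschitzOnWith_Icc hK ht)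
  simpa [mul_comm] using this

/-- Riemann sums approximate the circulation uniformly over equi-Lipschitz curves. -/
theorem exists_riemannSum_approx {L : ℝ} (hL : 0 < L) (Λ : ℝ≥0) (B : C(Ω.Closure, E3)) {ε : ℝ}
    (hε : 0 < ε) : ∃ N : ℕ, 0 < N ∧ (∀ x ∈ closure Ω.carrier, ∀ y ∈ closure Ω.carrier,
      ‖x - y‖ ≤ Λ * (L / N) → ‖toFun Ω B x - toFun Ω B y‖ ≤ ε) ∧
      ∀ γ : ℝ → E3, LipschitzOnWith Λ γ (Icc 0 L) → MapsTo γ (Icc 0 L) (closure Ω.carrier) →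
        |curveCurrent Ω γ 0 L B - riemannSum Ω B L N γ| ≤ ε * (Λ * L) := by
  obtain ⟨η, hη, H⟩ := exists_uniform_toFun B hε
  obtain ⟨N, hN⟩ := exists_nat_gt (Λ * L / η)
  have hN0 : (0 : ℝ) < N := lt_of_le_of_lt (by positivity) hN
  have hNL : Λ * (L / N) < η := by
    rw [div_lt_iff₀ hη] at hN
    rw [← mul_div_assoc, div_lt_iff₀ hN0]; linarith
  refine ⟨N, by exact_mod_cast hN0, fun x hx y hy hxy => H x hx y hy (lt_of_le_of_lt hxy hNL),
    fun γ hγ hm => ?_⟩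
  have hp := IsPrimitiveOn.of_lipschitzOnWith hL.le hγ
  have hNN : (N : ℝ) * (L / N) = L := mul_div_cancel₀ _ hN0.ne'
  have hLN : 0 ≤ L / N := by positivity
  refine (abs_curveCurrent_sub_sum_le hp hL.le hm B (N := N) (ε := ε)
    (t := fun i : ℕ => i * (L / N)) ?_ (by simp) hNN ?_).trans ?_
  · intro i j hij
    exact mul_le_mul_of_nonneg_right (by exact_mod_cast hij) hLN
  · intro i hi x hx
    have h1 : (0 : ℝ) ≤ i * (L / N) := by positivity
    have h2 : ((i + 1 : ℕ) : ℝ) * (L / N) ≤ L := by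
      calc ((i + 1 : ℕ) : ℝ) * (L / N) ≤ N * (L / N) :=
            mul_le_mul_of_nonneg_right (by exact_mod_cast hi) hLN
        _ = L := hNN
    have hi0 : (i : ℝ) * (L / N) ∈ Icc 0 L := ⟨h1, (hx.1.trans hx.2).trans h2⟩
    have hx0 : x ∈ Icc 0 L := ⟨h1.trans hx.1, hx.2.trans h2⟩
    refine H _ (hm hx0) _ (hm hi0) (lt_of_le_of_lt ((hγ.norm_sub_le hx0 hi0).trans ?_) hNL)
    rw [Real.norm_of_nonneg (by linarith [hx.1])]
    refine mul_le_mul_of_nonneg_left ?_ Λ.coe_nonneg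
    have := hx.2
    push_cast at this
    linarith
  · refine mul_le_mul_of_nonneg_left ?_ hε.le
    simpa using integral_norm_deriv_le hL.le hγ

/-- The current carried by an equi-Lipschitz family of curves depends continuously on the curve. -/
theorem tendsto_curveCurrent {ι : Type*} {l : Filter ι} {L : ℝ} (hL : 0 < L) {Λ : ℝ≥0}
    {γ : ι → ℝ → E3} {γ₁ : ℝ → E3} (hγ : ∀ᶠ n in l, LipschitzOnWith Λ (γ n) (Icc 0 L))
    (hm : ∀ᶠ n in l, MapsTo (γ n) (Icc 0 L) (closure Ω.carrier))
    (hγ₁ : LipschitzOnWith Λ γ₁ (Icc 0 L)) (hm₁ : MapsTo γ₁ (Icc 0 L) (closure Ω.carrier))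
    (ht : ∀ t ∈ Icc 0 L, Tendsto (fun n => γ n t) l (𝓝 (γ₁ t))) (B : C(Ω.Closure, E3)) :
    Tendsto (fun n => curveCurrent Ω (γ n) 0 L B) l (𝓝 (curveCurrent Ω γ₁ 0 L B)) := by
  rw [Metric.tendsto_nhds]
  intro δ hδ
  have hpos : 0 < (Λ : ℝ) * L + 1 := by positivity
  obtain ⟨N, hN, -, H⟩ := exists_riemannSum_approx hL Λ B (ε := δ / 3 / (Λ * L + 1)) (by positivity)
  have hN0 : (0 : ℝ) < N := by exact_mod_cast hN
  have hsmall : δ / 3 / (Λ * L + 1) * (Λ * L) < δ / 3 := by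
    rw [div_mul_eq_mul_div, div_lt_iff₀ hpos]
    exact mul_lt_mul_of_pos_left (by linarith) (by positivity)
  have hmem : ∀ i ≤ N, (i : ℝ) * (L / N) ∈ Icc 0 L := fun i hi => by
    refine ⟨by positivity, ?_⟩
    calc (i : ℝ) * (L / N) ≤ N * (L / N) :=
          mul_le_mul_of_nonneg_right (by exact_mod_cast hi) (by positivity)
      _ = L := mul_div_cancel₀ _ hN0.ne'
  have hsum : Tendsto (fun n => riemannSum Ω B L N (γ n)) l (𝓝 (riemannSum Ω B L N γ₁)) := by
    refine tendsto_finsetSum _ fun i hi => ?_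
    have hi : i < N := by simpa using hi
    have h1 := hmem i hi.le
    have h2 := hmem (i + 1) hi
    refine Tendsto.inner ?_ ((ht _ h2).sub (ht _ h1))
    refine ((continuousOn_toFun B) _ (hm₁ h1)).tendsto.comp (tendsto_nhdsWithin_iff.mpr
      ⟨ht _ h1, hm.mono fun n hn => hn h1⟩)
  filter_upwards [hγ, hm, (Metric.tendsto_nhds.mp hsum) (δ / 3) (by positivity)] with n h1 h2 h3
  have e1 := abs_le.mp (H _ h1 h2)
  have e2 := abs_le.mp (H _ hγ₁ hm₁)
  rw [Real.dist_eq] at h3 ⊢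
  have e3 := abs_lt.mp h3
  rw [abs_lt]
  constructor <;> linarith [e1.1, e1.2, e2.1, e2.2, e3.1, e3.2]

/-- A simple arc can be parametrized on a given interval `[0, L]` with constant speed. -/
theorem exists_constant_speed {L : ℝ} (hL : 0 < L) {γ : ℝ → E3} {a b : ℝ} {K : ℝ≥0} (hab : a < b)
    (hK : LipschitzOnWith K γ (Icc a b)) (hm : MapsTo γ (Icc a b) (closure Ω.carrier))
    (hinj : InjOn γ (Icc a b)) :
    ∃ (γ₁ : ℝ → E3) (s : ℝ≥0), 0 < s ∧ LipschitzOnWith s γ₁ (Icc 0 L) ∧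
      MapsTo γ₁ (Icc 0 L) (closure Ω.carrier) ∧ γ₁ 0 = γ a ∧ γ₁ L = γ b ∧
      curveCurrent Ω γ₁ 0 L = curveCurrent Ω γ a b ∧ ‖curveCurrent Ω γ a b‖ = s * L := by
  have hp := IsPrimitiveOn.of_lipschitzOnWith hab.le hK
  have hpn := hp.integrable.norm
  set ℓ := ∫ t in a..b, ‖deriv γ t‖ with hℓ
  have hinc : ∀ x ∈ Icc a b, ∀ y ∈ Icc a b, x < y → 0 < ∫ t in x..y, ‖deriv γ t‖ := by
    intro x hx y hy hxy
    have h1 := hp.norm_sub_le_abs hab.le hx hy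
    rw [abs_of_nonneg (intervalIntegral.integral_nonneg hxy.le fun _ _ => norm_nonneg _)] at h1
    refine lt_of_lt_of_le (norm_pos_iff.mpr (sub_ne_zero.mpr fun h => ?_)) h1
    exact hxy.ne' (hinj hy hx h)
  have ha : a ∈ Icc a b := left_mem_Icc.mpr hab.le
  have hb : b ∈ Icc a b := right_mem_Icc.mpr hab.le
  have hℓ0 : 0 < ℓ := hinc a ha b hb hab
  have hs0 : 0 < ℓ / L := div_pos hℓ0 hL
  let s : ℝ≥0 := ⟨ℓ / L, hs0.le⟩
  have hsv : (s : ℝ) = ℓ / L := rfl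
  have hsL : (s : ℝ) * L = ℓ := div_mul_cancel₀ _ hL.ne'
  have hs : (0 : ℝ) < s := hs0
  -- arc length, normalized so that `τ` maps `[a, b]` onto `[0, L]`; its inverse is `θ`
  let τ : ℝ → ℝ := fun x => (s : ℝ)⁻¹ * ∫ t in a..x, ‖deriv γ t‖
  have hτsub : ∀ x ∈ Icc a b, ∀ y ∈ Icc a b, s * (τ y - τ x) = ∫ t in x..y, ‖deriv γ t‖ := by
    intro x hx y hy
    rw [← intervalIntegral.integral_interval_sub_left (a := a)
      (hpn.mono_set (uIcc_subset_uIcc left_mem_uIcc (by rwa [uIcc_of_le hab.le])))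
      (hpn.mono_set (uIcc_subset_uIcc left_mem_uIcc (by rwa [uIcc_of_le hab.le])))]
    simp only [τ, ← mul_sub]
    rw [mul_inv_cancel_left₀ hs.ne']
  have hτ0 : τ a = 0 := by simp [τ]
  have hτL : τ b = L := by
    have := hτsub a ha b hb
    rw [hτ0, sub_zero, ← hℓ, ← hsL] at this
    exact mul_left_cancel₀ hs.ne' this
  have hmono : StrictMonoOn τ (Icc a b) := by
    intro x hx y hy hxy
    have h1 := hτsub x hx y hy
    have h2 := hinc x hx y hy hxy
    rw [← h1] at h2
    exact sub_pos.mp (pos_of_mul_pos_right h2 hs.le)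
  have hcont : ContinuousOn τ (Icc a b) := by
    refine continuousOn_const.mul ?_
    have := intervalIntegral.continuousOn_primitive_interval' hpn left_mem_uIcc
    rwa [uIcc_of_le hab.le] at this
  have hsurj : ∀ x, ∃ y, x ∈ Icc 0 L → y ∈ Icc a b ∧ τ y = x := by
    intro x
    by_cases hx : x ∈ Icc 0 L
    · rw [← hτ0, ← hτL] at hx
      obtain ⟨y, hy, e⟩ := intermediate_value_Icc hab.le hcont hx
      exact ⟨y, fun _ => ⟨hy, e⟩⟩
    · exact ⟨0, fun h => absurd h hx⟩
  choose θ hθ using hsurj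
  have hθm : ∀ x ∈ Icc 0 L, ∀ y ∈ Icc 0 L, x ≤ y → θ x ≤ θ y := by
    intro x hx y hy hxy
    rw [← hmono.le_iff_le (hθ x hx).1 (hθ y hy).1, (hθ x hx).2, (hθ y hy).2]
    exact hxy
  have h0 : (0 : ℝ) ∈ Icc 0 L := ⟨le_rfl, hL.le⟩
  have hL' : L ∈ Icc 0 L := ⟨hL.le, le_rfl⟩
  have hθ0 : θ 0 = a := hmono.injOn (hθ 0 h0).1 ha (by rw [(hθ 0 h0).2, hτ0])
  have hθL : θ L = b := hmono.injOn (hθ L hL').1 hb (by rw [(hθ L hL').2, hτL])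
  have hdist : ∀ x ∈ Icc a b, ∀ y ∈ Icc a b, ‖γ y - γ x‖ ≤ s * |τ y - τ x| := by
    intro x hx y hy
    have h1 : (s : ℝ) * |τ y - τ x| = |(s : ℝ) * (τ y - τ x)| := by
      rw [abs_mul, abs_of_nonneg s.coe_nonneg]
    rw [h1, hτsub x hx y hy]
    exact hp.norm_sub_le_abs hab.le hx hy
  have hlip : LipschitzOnWith s (fun x => γ (θ x)) (Icc 0 L) := by
    refine LipschitzOnWith.of_dist_le_mul fun x hx y hy => ?_
    rw [dist_eq_norm, Real.dist_eq]
    have := hdist _ (hθ y hy).1 _ (hθ x hx).1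
    rwa [(hθ x hx).2, (hθ y hy).2] at this
  have hm₁ : MapsTo (fun x => γ (θ x)) (Icc 0 L) (closure Ω.carrier) := fun x hx => hm (hθ x hx).1
  refine ⟨fun x => γ (θ x), s, hs, hlip, hm₁, by simp only [hθ0], by simp only [hθL], ?_, ?_⟩
  -- the new parametrization need not be differentiable where `γ` has zero velocity, so that the two
  -- currents are compared through Riemann sums instead of a change of variables
  · ext B
    refine (eq_of_forall_dist_le fun δ hδ => ?_)
    rw [Real.dist_eq]
    obtain ⟨N, hN, hosc, H⟩ := exists_riemannSum_approx hL s B (ε := δ / 2 / (s * L))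
      (by positivity)
    have hN0 : (0 : ℝ) < N := by exact_mod_cast hN
    have hNN : (N : ℝ) * (L / N) = L := mul_div_cancel₀ _ hN0.ne'
    have hLN : 0 ≤ L / N := by positivity
    have hmem : ∀ i ≤ N, (i : ℝ) * (L / N) ∈ Icc 0 L := fun i hi => by
      refine ⟨by positivity, ?_⟩
      calc (i : ℝ) * (L / N) ≤ N * (L / N) :=
            mul_le_mul_of_nonneg_right (by exact_mod_cast hi) hLN
        _ = L := hNN
    have e1 := H _ hlip hm₁
    -- the partition of `[a, b]` that corresponds to equal steps in the new parameter; the minimum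
    -- only serves to define it for indices beyond `N`
    let t : ℕ → ℝ := fun i => θ (min (i * (L / N)) L)
    have htm : ∀ i : ℕ, min (i * (L / N)) L ∈ Icc 0 L := fun i =>
      ⟨le_min (by positivity) hL.le, min_le_right _ _⟩
    have hti : ∀ i ≤ N, t i = θ (i * (L / N)) := fun i hi => by
      simp only [t, min_eq_left (hmem i hi).2]
    have e2 := abs_curveCurrent_sub_sum_le hp hab.le hm B (N := N) (ε := δ / 2 / (s * L))
      (t := t) (fun i j hij => hθm _ (htm i) _ (htm j)
        (min_le_min_right _ (mul_le_mul_of_nonneg_right (by exact_mod_cast hij) hLN)))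
      (by simp [t, hθ0, min_eq_left hL.le]) (by rw [hti N le_rfl, hNN, hθL]) (by
        intro i hi x hx
        rw [hti i hi.le, hti (i + 1) hi] at hx
        rw [hti i hi.le]
        have m1 := hθ _ (hmem i hi.le)
        have m2 := hθ _ (hmem (i + 1) hi)
        have hxI : x ∈ Icc a b := ⟨m1.1.1.trans hx.1, hx.2.trans m2.1.2⟩
        refine hosc _ (hm hxI) _ (hm m1.1) ((hdist _ m1.1 _ hxI).trans ?_)
        refine mul_le_mul_of_nonneg_left ?_ s.coe_nonneg
        have l1 := hmono.monotoneOn m1.1 hxI hx.1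
        have l2 := hmono.monotoneOn hxI m2.1 hx.2
        rw [abs_of_nonneg (by linarith)]
        rw [m1.2] at l1 ⊢
        rw [m2.2] at l2
        push_cast at l2
        linarith)
    have e3 : ∑ i ∈ Finset.range N, ⟪toFun Ω B (γ (t i)), γ (t (i + 1)) - γ (t i)⟫
        = riemannSum Ω B L N (fun x => γ (θ x)) := by
      refine Finset.sum_congr rfl fun i hi => ?_
      have hi : i < N := by simpa using hi
      rw [hti i hi.le, hti (i + 1) hi]
    have e4 : δ / 2 / (s * L) * (s * L) = δ / 2 := div_mul_cancel₀ _ (by positivity)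
    rw [e3, ← hℓ, ← hsL, e4] at e2
    rw [e4] at e1
    have a1 := abs_le.mp e1
    have a2 := abs_le.mp e2
    rw [abs_le]
    constructor <;> linarith [a1.1, a1.2, a2.1, a2.2]
  · rw [norm_curveCurrent_of_injOn hp hab.le hm hinj, hsL]

end

/-! ### Weak compactness and Sobolev functions -/

section

/-- Weak-* compactness of the unit ball of a dual space, along an ultrafilter. -/
theorem exists_weak_limit {ι V : Type*} [NormedAddCommGroup V] [NormedSpace ℝ V]
    (𝒰 : Ultrafilter ι) {T : ι → V →L[ℝ] ℝ} (hT : ∀ n, ‖T n‖ ≤ 1) :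
    ∃ T₁ : V →L[ℝ] ℝ, ‖T₁‖ ≤ 1 ∧ ∀ x, Tendsto (fun n => T n x) 𝒰 (𝓝 (T₁ x)) := by
  have hc := WeakDual.isCompact_closedBall (𝕜 := ℝ) (0 : StrongDual ℝ V) 1
  obtain ⟨x, hx, hle⟩ := hc.ultrafilter_le_nhds (𝒰.map fun n => StrongDual.toWeakDual (T n)) (by
    rw [le_principal_iff]
    refine mem_map.mpr (Eventually.of_forall fun n => ?_)
    simpa using hT n)
  refine ⟨WeakDual.toStrongDual x, by simpa using hx, fun v => ?_⟩
  have h1 : Tendsto (fun n => StrongDual.toWeakDual (T n)) (𝒰 : Filter ι) (𝓝 x) := hle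
  exact ((WeakDual.eval_continuous v).tendsto x).comp h1

/-- A pointwise limit of equicontinuous curves on a compact interval is a uniform limit. -/
theorem eventually_uniform_of_pointwise {ι E : Type*} [NormedAddCommGroup E] {l : Filter ι}
    {a b : ℝ} {f : ι → ℝ → E} {g : ℝ → E}
    (hf : ∀ ε > 0, ∃ δ > 0, ∀ᶠ n in l, ∀ x ∈ Icc a b, ∀ y ∈ Icc a b, |x - y| < δ →
      ‖f n x - f n y‖ ≤ ε)
    (hg : ∀ ε > 0, ∃ δ > 0, ∀ x ∈ Icc a b, ∀ y ∈ Icc a b, |x - y| < δ → ‖g x - g y‖ ≤ ε)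
    (h : ∀ x ∈ Icc a b, Tendsto (fun n => f n x) l (𝓝 (g x))) {ε : ℝ} (hε : 0 < ε) :
    ∀ᶠ n in l, ∀ x ∈ Icc a b, ‖f n x - g x‖ ≤ ε := by
  obtain ⟨δ₁, hδ₁, H₁⟩ := hf (ε / 3) (by positivity)
  obtain ⟨δ₂, hδ₂, H₂⟩ := hg (ε / 3) (by positivity)
  obtain ⟨t, ht, hfin, hcov⟩ := (isCompact_Icc (a := a) (b := b)).finite_cover_balls
    (lt_min hδ₁ hδ₂)
  have h3 : ∀ᶠ n in l, ∀ y ∈ t, ‖f n y - g y‖ ≤ ε / 3 := by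
    refine hfin.eventually_all.mpr fun y hy => ?_
    filter_upwards [Metric.tendsto_nhds.mp (h y (ht hy)) (ε / 3) (by positivity)] with n hn
    rw [← dist_eq_norm]; exact hn.le
  filter_upwards [H₁, h3] with n h1 h3 x hx
  obtain ⟨y, hy, hxy⟩ := mem_iUnion₂.mp (hcov hx)
  rw [Metric.mem_ball, Real.dist_eq] at hxy
  have e1 := h1 x hx y (ht hy) (lt_of_lt_of_le hxy (min_le_left _ _))
  have e2 := H₂ x hx y (ht hy) (lt_of_lt_of_le hxy (min_le_right _ _))
  have e3 := h3 y hy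
  have e : f n x - g x = (f n x - f n y) + (f n y - g y) - (g x - g y) := by abel
  rw [e]
  refine (norm_sub_le _ _).trans ?_
  have := norm_add_le (f n x - f n y) (f n y - g y)
  linarith

variable {E F : Type*} [NormedAddCommGroup E] [InnerProductSpace ℝ E]
  [NormedAddCommGroup F] [NormedSpace ℝ F] {L : ℝ}

/-- `u ∈ H¹((0, L), E)`, with derivative `w`; here `u` is the continuous representative. -/
structure IsSobolev (L : ℝ) (u w : ℝ → E) : Prop where
  memLp : MemLp w 2 (volume.restrict (Ioc 0 L))
  primitive : IsPrimitiveOn u w 0 L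

/-- The quadratic functional `∫ A(u', u') + N(u, u) + M(u, u')`, where `w` stands for `u'`. -/
noncomputable def quadForm (A N M : ℝ → E →L[ℝ] E →L[ℝ] ℝ) (L : ℝ) (u w : ℝ → E) : ℝ :=
  ∫ z in 0..L, (A z (w z) (w z) + N z (u z) (u z) + M z (u z) (w z))

theorem exists_bound_of_continuousOn {F : Type*} [NormedAddCommGroup F] {L : ℝ} {a : ℝ → F}
    (ha : ContinuousOn a (Icc 0 L)) :
    ∃ C, 0 ≤ C ∧ ∀ z ∈ Icc 0 L, ‖a z‖ ≤ C := by
  obtain ⟨C, hC⟩ := isCompact_Icc.exists_bound_of_continuousOn ha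
  exact ⟨max C 0, le_max_right _ _, fun z hz => (hC z hz).trans (le_max_left _ _)⟩

theorem memLp_clm_apply {a : ℝ → E →L[ℝ] F} (ha : ContinuousOn a (Icc 0 L)) {w : ℝ → E}
    (hw : MemLp w 2 (volume.restrict (Ioc 0 L))) :
    MemLp (fun z => a z (w z)) 2 (volume.restrict (Ioc 0 L)) := by
  obtain ⟨C, hC, hb⟩ := exists_bound_of_continuousOn ha
  refine MemLp.of_le_mul (c := C) hw ?_ ?_
  · exact (ContinuousLinearMap.id ℝ (E →L[ℝ] F)).aestronglyMeasurable_comp₂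
      ((ha.mono Ioc_subset_Icc_self).aestronglyMeasurable measurableSet_Ioc) hw.1
  · filter_upwards [ae_restrict_mem measurableSet_Ioc] with z hz
    exact (a z).le_of_opNorm_le (hb z (Ioc_subset_Icc_self hz)) _

theorem integrable_clm_apply {g : ℝ → E →L[ℝ] ℝ} {w : ℝ → E}
    (hg : MemLp g 2 (volume.restrict (Ioc 0 L))) (hw : MemLp w 2 (volume.restrict (Ioc 0 L))) :
    Integrable (fun z => g z (w z)) (volume.restrict (Ioc 0 L)) := by
  refine Integrable.mono' (hg.norm.integrable_mul hw.norm) ?_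
    (Eventually.of_forall fun z => (g z).le_opNorm _)
  exact (ContinuousLinearMap.id ℝ (E →L[ℝ] ℝ)).aestronglyMeasurable_comp₂ hg.1 hw.1

theorem IsSobolev.memLp_self [FiniteDimensional ℝ E] {u w : ℝ → E} (h : IsSobolev L u w)
    (hL : 0 ≤ L) :
    MemLp u 2 (volume.restrict (Ioc 0 L)) := by
  have : CompleteSpace E := FiniteDimensional.complete ℝ E
  have hc := h.primitive.continuousOn hL
  obtain ⟨C, -, hC⟩ := exists_bound_of_continuousOn hc
  refine MemLp.of_bound (h.primitive.aestronglyMeasurable hL) C ?_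
  filter_upwards [ae_restrict_mem measurableSet_Ioc] with z hz using hC z (Ioc_subset_Icc_self hz)

/-- Sequences bounded in `L²` have weak limits along an ultrafilter. -/
theorem exists_weak_limit_memLp [FiniteDimensional ℝ E] {ι : Type*} (𝒰 : Ultrafilter ι)
    {w : ι → ℝ → E}
    (hw : ∀ n, MemLp (w n) 2 (volume.restrict (Ioc 0 L)))
    (h1 : ∀ n, ∫ z in 0..L, ‖w n z‖ ^ 2 ≤ 1) (hL : 0 ≤ L) :
    ∃ w₁ : ℝ → E, MemLp w₁ 2 (volume.restrict (Ioc 0 L)) ∧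
      ∀ g : ℝ → E →L[ℝ] ℝ, MemLp g 2 (volume.restrict (Ioc 0 L)) →
        Tendsto (fun n => ∫ z in 0..L, g z (w n z)) 𝒰 (𝓝 (∫ z in 0..L, g z (w₁ z))) := by
  have : CompleteSpace E := FiniteDimensional.complete ℝ E
  have key : ∀ (g v : ℝ → E) (hg : MemLp g 2 (volume.restrict (Ioc 0 L)))
      (hv : MemLp v 2 (volume.restrict (Ioc 0 L))),
      ⟪hg.toLp g, hv.toLp v⟫ = ∫ z in 0..L, ⟪g z, v z⟫ := by
    intro g v hg hv
    rw [L2.inner_def, intervalIntegral.integral_of_le hL]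
    refine integral_congr_ae ?_
    filter_upwards [hg.coeFn_toLp, hv.coeFn_toLp] with z h1 h2
    rw [h1, h2]
  have hn : ∀ n, ‖(hw n).toLp (w n)‖ ≤ 1 := by
    intro n
    have := key _ _ (hw n) (hw n)
    rw [real_inner_self_eq_norm_sq] at this
    simp only [real_inner_self_eq_norm_sq] at this
    have h2 := h1 n
    rw [← this] at h2
    exact (sq_le_one_iff₀ (norm_nonneg _)).mp h2
  obtain ⟨T, -, hT⟩ := exists_weak_limit 𝒰
    (T := fun n => innerSL ℝ ((hw n).toLp (w n))) (fun n => by simpa using hn n)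
  let W := (InnerProductSpace.toDual ℝ (Lp E 2 (volume.restrict (Ioc 0 L)))).symm T
  refine ⟨W, Lp.memLp W, fun g hg => ?_⟩
  let G : ℝ → E := fun z => (InnerProductSpace.toDual ℝ E).symm (g z)
  have hG : MemLp G 2 (volume.restrict (Ioc 0 L)) :=
    ((InnerProductSpace.toDual ℝ E).symm.toContinuousLinearEquiv.toContinuousLinearMap).comp_memLp'
      hg
  have e : ∀ (v : ℝ → E) (hv : MemLp v 2 (volume.restrict (Ioc 0 L))),
      ∫ z in 0..L, g z (v z) = ⟪hv.toLp v, hG.toLp G⟫ := by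
    intro v hv
    rw [real_inner_comm, key]
    refine intervalIntegral.integral_congr fun z _ => ?_
    exact InnerProductSpace.toDual_symm_apply.symm
  have hW : (Lp.memLp W).toLp W = W := Lp.toLp_coeFn W _
  rw [e _ (Lp.memLp W), hW]
  have := hT (hG.toLp G)
  rw [← InnerProductSpace.toDual_symm_apply (𝕜 := ℝ) (y := T)] at this
  refine this.congr fun n => ?_
  rw [e _ (hw n)]; rfl

end

/-! ### Coercivity of quadratic functionals -/

section

variable {E : Type*} [NormedAddCommGroup E] [InnerProductSpace ℝ E] {L : ℝ}

theorem IsSobolev.intervalIntegrable_sq {u w : ℝ → E} (h : IsSobolev L u w) (hL : 0 ≤ L) :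
    IntervalIntegrable (fun z => ‖w z‖ ^ 2) volume 0 L := by
  rw [intervalIntegrable_iff_integrableOn_Ioc_of_le hL]
  exact h.memLp.integrable_norm_pow (by simp)

theorem IsSobolev.smul {u w : ℝ → E} (h : IsSobolev L u w) (c : ℝ) :
    IsSobolev L (fun z => c • u z) (fun z => c • w z) := by
  refine ⟨h.memLp.const_smul c, h.primitive.integrable.smul c, fun t ht => ?_⟩
  rw [h.primitive.eq t ht, smul_add, intervalIntegral.integral_smul]

/-- The Hölder estimate for functions in the unit ball of `H¹`, written without square roots. -/
theorem IsSobolev.norm_sub_le {u w : ℝ → E} (h : IsSobolev L u w) (hL : 0 ≤ L)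
    (h1 : ∫ z in 0..L, ‖w z‖ ^ 2 ≤ 1) {x y η : ℝ} (hx : x ∈ Icc 0 L) (hy : y ∈ Icc 0 L)
    (hη : 0 < η) : ‖u x - u y‖ ≤ |x - y| / (2 * η) + η / 2 := by
  wlog hxy : y ≤ x generalizing x y
  · rw [norm_sub_rev, abs_sub_comm]
    exact this hy hx (le_of_not_ge hxy)
  have hsq := h.intervalIntegrable_sq hL
  have hsub : uIcc y x ⊆ uIcc 0 L := by
    rw [uIcc_of_le hxy, uIcc_of_le hL]; exact Icc_subset_Icc hy.1 hx.2
  have hI := hsq.mono_set hsub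
  have e1 : ∫ s in y..x, ‖w s‖ ≤ ∫ s in y..x, (1 / (2 * η) + η / 2 * ‖w s‖ ^ 2) := by
    refine intervalIntegral.integral_mono_on hxy (h.primitive.integrable.norm.mono_set hsub)
      (intervalIntegrable_const.add (hI.const_mul _)) fun s _ => ?_
    have : 1 / (2 * η) + η / 2 * ‖w s‖ ^ 2 - ‖w s‖ = (η * ‖w s‖ - 1) ^ 2 / (2 * η) := by
      field_simp; ring
    have h2 : 0 ≤ (η * ‖w s‖ - 1) ^ 2 / (2 * η) := by positivity
    linarith
  rw [intervalIntegral.integral_add intervalIntegrable_const (hI.const_mul _),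
    intervalIntegral.integral_const, intervalIntegral.integral_const_mul, smul_eq_mul] at e1
  have e2 : ∫ s in y..x, ‖w s‖ ^ 2 ≤ 1 := by
    refine le_trans (intervalIntegral.integral_mono_interval hy.1 hxy hx.2
      (Eventually.of_forall fun s => by positivity) hsq) h1
  have e3 := h.primitive.norm_sub_le_abs hL hy hx
  rw [abs_of_nonneg (intervalIntegral.integral_nonneg hxy fun _ _ => norm_nonneg _)] at e3
  rw [abs_of_nonneg (by linarith)]
  have e4 : (x - y) * (1 / (2 * η)) = (x - y) / (2 * η) := by ring
  nlinarith

/-- The pointwise estimate behind the lower semicontinuity of `quadForm`. -/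
theorem quad_integrand_ge {a n m : E →L[ℝ] E →L[ℝ] ℝ} {κ C ε : ℝ} (ha : ∀ ξ, κ * ‖ξ‖ ^ 2 ≤ a ξ ξ)
    (hn : ‖n‖ ≤ C) (hm : ‖m‖ ≤ C) (hC : 0 ≤ C) {u v w x : E} (hu : ‖u‖ ≤ C) (hv : ‖v‖ ≤ C)
    (huv : ‖v - u‖ ≤ ε) :
    a w w + n u u + m u w + (a w + a.flip w + m u) (x - w) + κ * ‖x - w‖ ^ 2
      - ε * (2 * C ^ 2 + C * ‖x‖) ≤ a x x + n v v + m v x := by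
  have e1 : a x x = a w w + a w (x - w) + a (x - w) w + a (x - w) (x - w) := by
    simp only [map_sub, sub_apply]; ring
  have e2 : n v v = n u u + n (v - u) v + n u (v - u) := by
    simp only [map_sub, sub_apply]; ring
  have e3 : m v x = m u w + m (v - u) x + m u (x - w) := by
    simp only [map_sub, sub_apply]; ring
  have hε : 0 ≤ ε := (norm_nonneg _).trans huv
  have b1 : |n (v - u) v| ≤ C * ε * C := by
    refine (n.le_opNorm₂ _ _).trans ?_
    gcongr
  have b2 : |n u (v - u)| ≤ C * C * ε := by
    refine (n.le_opNorm₂ _ _).trans ?_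
    gcongr
  have b3 : |m (v - u) x| ≤ C * ε * ‖x‖ := by
    refine (m.le_opNorm₂ _ _).trans ?_
    gcongr
  rw [e1, e2, e3]
  simp only [add_apply, ContinuousLinearMap.flip_apply]
  have := ha (x - w)
  have c1 := (abs_le.mp b1).1
  have c2 := (abs_le.mp b2).1
  have c3 := (abs_le.mp b3).1
  nlinarith

theorem quadForm_smul (A N M : ℝ → E →L[ℝ] E →L[ℝ] ℝ) (u w : ℝ → E) (c : ℝ) :
    quadForm A N M L (fun z => c • u z) (fun z => c • w z) = c ^ 2 * quadForm A N M L u w := by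
  rw [quadForm, quadForm, ← intervalIntegral.integral_const_mul]
  refine intervalIntegral.integral_congr fun z _ => ?_
  simp only [map_smul, smul_apply, smul_eq_mul]
  ring

variable [FiniteDimensional ℝ E]

theorem intervalIntegrable_quad_integrand {A N M : ℝ → E →L[ℝ] E →L[ℝ] ℝ}
    (hA : ContinuousOn A (Icc 0 L)) (hN : ContinuousOn N (Icc 0 L))
    (hM : ContinuousOn M (Icc 0 L)) (hL : 0 ≤ L) {u w : ℝ → E} (h : IsSobolev L u w) :
    IntervalIntegrable (fun z => A z (w z) (w z) + N z (u z) (u z) + M z (u z) (w z))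
      volume 0 L := by
  rw [intervalIntegrable_iff_integrableOn_Ioc_of_le hL]
  have hu := h.memLp_self hL
  exact ((integrable_clm_apply (memLp_clm_apply hA h.memLp) h.memLp).add
    (integrable_clm_apply (memLp_clm_apply hN hu) hu)).add
    (integrable_clm_apply (memLp_clm_apply hM hu) h.memLp)

theorem IsSobolev.ae_eq_zero {u w : ℝ → E} (h : IsSobolev L u w) (hL : 0 ≤ L)
    (h0 : ∀ z ∈ Icc 0 L, u z = 0) : w =ᵐ[volume.restrict (Ioc 0 L)] 0 := by
  have : CompleteSpace E := FiniteDimensional.complete ℝ E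
  refine ae_restrict_Ioc_of_Ioo ?_
  filter_upwards [h.primitive.ae_hasDerivAt hL] with t ht htI
  have h1 : HasDerivAt u 0 t := (hasDerivAt_const t (0 : E)).congr_of_eventuallyEq (by
    filter_upwards [Icc_mem_nhds htI.1 htI.2] with y hy using h0 y hy)
  exact (ht htI).unique h1

theorem IsSobolev.quadForm_eq_zero {A N M : ℝ → E →L[ℝ] E →L[ℝ] ℝ} {u w : ℝ → E}
    (h : IsSobolev L u w) (hL : 0 ≤ L) (h0 : ∀ z ∈ Icc 0 L, u z = 0) :
    quadForm A N M L u w = 0 := by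
  rw [quadForm, intervalIntegral.integral_of_le hL]
  refine integral_eq_zero_of_ae ?_
  filter_upwards [h.ae_eq_zero hL h0, ae_restrict_mem measurableSet_Ioc] with z hz hzI
  simp [hz, h0 z (Ioc_subset_Icc_self hzI)]

/-- If `quadForm` is not bounded below by `c` times the square of the `H¹` norm, then it takes a
value at most `c` on the unit sphere of `H¹`. -/
theorem exists_normalized {A N M : ℝ → E →L[ℝ] E →L[ℝ] ℝ} (hL : 0 ≤ L)
    (hpos : ∀ u w : ℝ → E, IsSobolev L u w → (∃ z ∈ Icc 0 L, u z ≠ 0) →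
      0 < quadForm A N M L u w) {c : ℝ} {u w : ℝ → E} (h : IsSobolev L u w)
    (hlt : quadForm A N M L u w < c * (‖u 0‖ ^ 2 + ∫ z in 0..L, ‖w z‖ ^ 2)) :
    ∃ u w : ℝ → E, IsSobolev L u w ∧ ‖u 0‖ ^ 2 + ∫ z in 0..L, ‖w z‖ ^ 2 = 1 ∧
      quadForm A N M L u w ≤ c := by
  have hI0 : 0 ≤ ∫ z in 0..L, ‖w z‖ ^ 2 :=
    intervalIntegral.integral_nonneg hL fun _ _ => by positivity
  set S := ‖u 0‖ ^ 2 + ∫ z in 0..L, ‖w z‖ ^ 2 with hS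
  have hS0 : 0 ≤ S := by positivity
  have hSpos : 0 < S := by
    refine lt_of_le_of_ne hS0 fun hS0' => ?_
    rw [← hS0', mul_zero] at hlt
    by_cases hu : ∃ z ∈ Icc 0 L, u z ≠ 0
    · exact absurd (hpos u w h hu) (not_lt.mpr hlt.le)
    · push Not at hu
      exact absurd hlt (by simp [h.quadForm_eq_zero hL hu])
  refine ⟨_, _, h.smul (√S)⁻¹, ?_, ?_⟩
  · simp only [norm_smul, mul_pow, intervalIntegral.integral_const_mul]
    rw [← mul_add, ← hS, norm_inv, Real.norm_of_nonneg (Real.sqrt_nonneg _), inv_pow,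
      Real.sq_sqrt hS0, inv_mul_cancel₀ hSpos.ne']
  · rw [quadForm_smul, inv_pow, Real.sq_sqrt hS0, inv_mul_le_iff₀ hSpos]
    linarith

theorem integral_indicator_innerSL {v : ℝ → E} (hv : IntervalIntegrable v volume 0 L)
    {z : ℝ} (hz : z ∈ Icc 0 L) (e : E) :
    ∫ s in 0..L, ((Ioc 0 z).indicator (fun _ => innerSL ℝ e) s) (v s) = ⟪e, ∫ s in 0..z, v s⟫ := by
  have : CompleteSpace E := FiniteDimensional.complete ℝ E
  have hL : 0 ≤ L := hz.1.trans hz.2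
  have hsub : uIcc 0 z ⊆ uIcc 0 L := by
    rw [uIcc_of_le hz.1, uIcc_of_le hL]; exact Icc_subset_Icc le_rfl hz.2
  have e1 : ∀ s, ((Ioc 0 z).indicator (fun _ => innerSL ℝ e) s) (v s)
      = (Ioc 0 z).indicator (fun s => innerSL ℝ e (v s)) s := by
    intro s
    by_cases hs : s ∈ Ioc 0 z <;> simp [hs]
  simp only [e1]
  rw [intervalIntegral.integral_of_le hL, setIntegral_indicator measurableSet_Ioc,
    Ioc_inter_Ioc, max_self, min_eq_right hz.2, ← intervalIntegral.integral_of_le hz.1]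
  exact (innerSL ℝ e).intervalIntegral_comp_comm (hv.mono_set hsub)

theorem tendsto_integral_of_weak {ι : Type*} {l : Filter ι} {w : ι → ℝ → E}
    {w₁ : ℝ → E} (hw : ∀ n, IntervalIntegrable (w n) volume 0 L)
    (hw₁ : IntervalIntegrable w₁ volume 0 L)
    (hweak : ∀ g : ℝ → E →L[ℝ] ℝ, MemLp g 2 (volume.restrict (Ioc 0 L)) →
      Tendsto (fun n => ∫ z in 0..L, g z (w n z)) l (𝓝 (∫ z in 0..L, g z (w₁ z))))
    {z : ℝ} (hz : z ∈ Icc 0 L) :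
    Tendsto (fun n => ∫ s in 0..z, w n s) l (𝓝 (∫ s in 0..z, w₁ s)) := by
  have htest : ∀ e : E, Tendsto (fun n => ⟪e, ∫ s in 0..z, w n s⟫) l
      (𝓝 ⟪e, ∫ s in 0..z, w₁ s⟫) := by
    intro e
    have hg : MemLp ((Ioc 0 z).indicator fun _ : ℝ => innerSL ℝ e) 2
        (volume.restrict (Ioc 0 L)) := by
      refine MemLp.of_bound (stronglyMeasurable_const.indicator
        measurableSet_Ioc).aestronglyMeasurable ‖innerSL ℝ e‖ (Eventually.of_forall fun s => ?_)
      exact norm_indicator_le_norm_self _ _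
    have := hweak _ hg
    rw [integral_indicator_innerSL hw₁ hz] at this
    exact this.congr fun n => integral_indicator_innerSL (hw n) hz e
  have hsum := tendsto_finsetSum Finset.univ fun i (_ : i ∈ Finset.univ) =>
    (htest (stdOrthonormalBasis ℝ E i)).smul_const (stdOrthonormalBasis ℝ E i)
  rw [(stdOrthonormalBasis ℝ E).sum_repr' (∫ s in 0..z, w₁ s)] at hsum
  exact hsum.congr fun n => (stdOrthonormalBasis ℝ E).sum_repr' _

/-- Rellich compactness in dimension one: along an ultrafilter, a sequence in the unit ball of `H¹`
converges uniformly, while its derivatives converge weakly in `L²`. -/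
theorem exists_sobolev_limit {ι : Type*} (𝒰 : Ultrafilter ι) (hL : 0 < L) {u w : ι → ℝ → E}
    (hS : ∀ n, IsSobolev L (u n) (w n)) (hw1 : ∀ n, ∫ z in 0..L, ‖w n z‖ ^ 2 ≤ 1)
    (hu1 : ∀ n, ‖u n 0‖ ≤ 1) :
    ∃ u₁ w₁ : ℝ → E, IsSobolev L u₁ w₁ ∧
      (∀ g : ℝ → E →L[ℝ] ℝ, MemLp g 2 (volume.restrict (Ioc 0 L)) →
        Tendsto (fun n => ∫ z in 0..L, g z (w n z)) 𝒰 (𝓝 (∫ z in 0..L, g z (w₁ z)))) ∧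
      ∀ ε > 0, ∀ᶠ n in (𝒰 : Filter ι), ∀ x ∈ Icc 0 L, ‖u n x - u₁ x‖ ≤ ε := by
  have : CompleteSpace E := FiniteDimensional.complete ℝ E
  obtain ⟨w₁, hw₁, hweak⟩ := exists_weak_limit_memLp 𝒰 (fun n => (hS n).memLp) hw1 hL.le
  obtain ⟨u₀, -, hu₀⟩ := (isCompact_closedBall (0 : E) 1).ultrafilter_le_nhds
    (𝒰.map fun n => u n 0) (by
      rw [le_principal_iff]
      exact mem_map.mpr (Eventually.of_forall fun n => by simpa using hu1 n))
  have hu₀ : Tendsto (fun n => u n 0) 𝒰 (𝓝 u₀) := hu₀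
  have hw₁I : IntervalIntegrable w₁ volume 0 L := by
    rw [intervalIntegrable_iff_integrableOn_Ioc_of_le hL.le]
    exact hw₁.integrable (by norm_num)
  let u₁ : ℝ → E := fun z => u₀ + ∫ s in 0..z, w₁ s
  have hS₁ : IsSobolev L u₁ w₁ := ⟨hw₁, hw₁I, fun t _ => by simp [u₁]⟩
  have hpt : ∀ z ∈ Icc 0 L, Tendsto (fun n => u n z) 𝒰 (𝓝 (u₁ z)) := by
    intro z hz
    have hint := tendsto_integral_of_weak (fun n => (hS n).primitive.integrable) hw₁I hweak hz
    have := hu₀.add hint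
    exact this.congr fun n => ((hS n).primitive.eq z hz).symm
  refine ⟨u₁, w₁, hS₁, hweak, fun ε hε => ?_⟩
  refine eventually_uniform_of_pointwise (fun ε hε => ⟨ε ^ 2, by positivity,
    Eventually.of_forall fun n x hx y hy hxy => ?_⟩) (fun ε hε => ?_) hpt hε
  · refine ((hS n).norm_sub_le hL.le (hw1 n) hx hy hε).trans ?_
    have : |x - y| / (2 * ε) ≤ ε ^ 2 / (2 * ε) := by gcongr
    have h2 : ε ^ 2 / (2 * ε) = ε / 2 := by field_simp
    linarith
  · obtain ⟨δ, hδ, h⟩ := Metric.uniformContinuousOn_iff.mp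
      (isCompact_Icc.uniformContinuousOn_of_continuous (hS₁.primitive.continuousOn hL.le)) ε hε
    exact ⟨δ, hδ, fun x hx y hy hxy => by
      have := h x hx y hy (by rwa [Real.dist_eq]); rw [dist_eq_norm] at this; exact this.le⟩

/-- Expansion of the quadratic functional at `(u₁, w₁)`: up to a small error, the increment is
bounded below by a linear functional of `w - w₁`, plus a multiple of the square of its `L²` norm. -/
theorem quadForm_ge {A N M : ℝ → E →L[ℝ] E →L[ℝ] ℝ} (hL : 0 < L)
    (hA : ContinuousOn A (Icc 0 L)) (hN : ContinuousOn N (Icc 0 L))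
    (hM : ContinuousOn M (Icc 0 L)) {κ C ε : ℝ}
    (hAκ : ∀ z ∈ Icc 0 L, ∀ ξ, κ * ‖ξ‖ ^ 2 ≤ A z ξ ξ) (hC : 0 ≤ C)
    (hbN : ∀ z ∈ Icc 0 L, ‖N z‖ ≤ C) (hbM : ∀ z ∈ Icc 0 L, ‖M z‖ ≤ C) {u₁ w₁ u w : ℝ → E}
    (hS₁ : IsSobolev L u₁ w₁) (hS : IsSobolev L u w) (hw1 : ∫ z in 0..L, ‖w z‖ ^ 2 ≤ 1)
    (hu₁ : ∀ z ∈ Icc 0 L, ‖u₁ z‖ ≤ C) (hu : ∀ z ∈ Icc 0 L, ‖u z‖ ≤ C)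
    (hn : ∀ z ∈ Icc 0 L, ‖u z - u₁ z‖ ≤ ε) {g : ℝ → E →L[ℝ] ℝ}
    (hgdef : ∀ z, g z = A z (w₁ z) + (A z).flip (w₁ z) + M z (u₁ z))
    (hg : MemLp g 2 (volume.restrict (Ioc 0 L))) :
    quadForm A N M L u₁ w₁ + (∫ z in 0..L, g z (w z - w₁ z))
      + κ * (∫ z in 0..L, ‖w z - w₁ z‖ ^ 2) - ε * (2 * C ^ 2 * L + C * (L + 1))
      ≤ quadForm A N M L u w := by
  have hε : 0 ≤ ε := (norm_nonneg _).trans (hn 0 ⟨le_rfl, hL.le⟩)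
  have i1 := intervalIntegrable_quad_integrand hA hN hM hL.le hS₁
  have i2 : IntervalIntegrable (fun z => g z (w z - w₁ z)) volume 0 L := by
    rw [intervalIntegrable_iff_integrableOn_Ioc_of_le hL.le]
    exact integrable_clm_apply hg (hS.memLp.sub hS₁.memLp)
  have i3 : IntervalIntegrable (fun z => κ * ‖w z - w₁ z‖ ^ 2) volume 0 L := by
    rw [intervalIntegrable_iff_integrableOn_Ioc_of_le hL.le]
    exact ((hS.memLp.sub hS₁.memLp).integrable_norm_pow (by simp)).const_mul κ
  have i4 : IntervalIntegrable (fun z => ε * (2 * C ^ 2 + C * ‖w z‖)) volume 0 L :=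
    (intervalIntegrable_const.add (hS.primitive.integrable.norm.const_mul C)).const_mul ε
  have hmono : ∫ z in 0..L, ((A z (w₁ z) (w₁ z) + N z (u₁ z) (u₁ z) + M z (u₁ z) (w₁ z))
      + g z (w z - w₁ z) + κ * ‖w z - w₁ z‖ ^ 2 - ε * (2 * C ^ 2 + C * ‖w z‖))
      ≤ quadForm A N M L u w := by
    refine intervalIntegral.integral_mono_on hL.le (((i1.add i2).add i3).sub i4)
      (intervalIntegrable_quad_integrand hA hN hM hL.le hS) fun z hz => ?_
    rw [hgdef]
    exact quad_integrand_ge (hAκ z hz) (hbN z hz) (hbM z hz) hC (hu₁ z hz) (hu z hz) (hn z hz)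
  rw [intervalIntegral.integral_sub ((i1.add i2).add i3) i4,
    intervalIntegral.integral_add (i1.add i2) i3, intervalIntegral.integral_add i1 i2,
    intervalIntegral.integral_const_mul, intervalIntegral.integral_const_mul,
    intervalIntegral.integral_add intervalIntegrable_const
      (hS.primitive.integrable.norm.const_mul C), intervalIntegral.integral_const,
    intervalIntegral.integral_const_mul, sub_zero, smul_eq_mul] at hmono
  have hw' : ∫ z in 0..L, ‖w z‖ ≤ L + 1 := by
    have hsq := hS.intervalIntegrable_sq hL.le
    have : ∫ z in 0..L, ‖w z‖ ≤ ∫ z in 0..L, (1 + ‖w z‖ ^ 2) :=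
      intervalIntegral.integral_mono_on hL.le hS.primitive.integrable.norm
        (intervalIntegrable_const.add hsq) fun z _ => by nlinarith [sq_nonneg (‖w z‖ - 1 / 2)]
    rw [intervalIntegral.integral_add intervalIntegrable_const hsq,
      intervalIntegral.integral_const, smul_eq_mul] at this
    linarith
  have hfin : ε * (L * (2 * C ^ 2) + C * ∫ z in 0..L, ‖w z‖)
      ≤ ε * (2 * C ^ 2 * L + C * (L + 1)) := by
    refine mul_le_mul_of_nonneg_left ?_ hε
    nlinarith
  unfold quadForm at hmono ⊢
  linarith

/-- A quadratic functional with uniformly positive principal part which is positive on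
`H¹ ∖ {0}` is coercive on `H¹`. A normalized sequence along which it tends to zero has a weak limit
`u₁`, on which the functional is nonpositive, so that `u₁ = 0`; the lower order terms then tend to
zero, and the principal part forces strong convergence, which contradicts the normalization. -/
theorem exists_coercive {A N M : ℝ → E →L[ℝ] E →L[ℝ] ℝ} (hL : 0 < L)
    (hA : ContinuousOn A (Icc 0 L)) (hN : ContinuousOn N (Icc 0 L))
    (hM : ContinuousOn M (Icc 0 L)) {κ : ℝ} (hκ : 0 < κ)
    (hAκ : ∀ z ∈ Icc 0 L, ∀ ξ, κ * ‖ξ‖ ^ 2 ≤ A z ξ ξ)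
    (hpos : ∀ u w : ℝ → E, IsSobolev L u w → (∃ z ∈ Icc 0 L, u z ≠ 0) → 0 < quadForm A N M L u w) :
    ∃ c > 0, ∀ u w : ℝ → E, IsSobolev L u w →
      c * (‖u 0‖ ^ 2 + ∫ z in 0..L, ‖w z‖ ^ 2) ≤ quadForm A N M L u w := by
  have : CompleteSpace E := FiniteDimensional.complete ℝ E
  by_contra! hcon
  have hn : ∀ n : ℕ, ∃ u w : ℝ → E, IsSobolev L u w ∧ ‖u 0‖ ^ 2 + ∫ z in 0..L, ‖w z‖ ^ 2 = 1 ∧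
      quadForm A N M L u w ≤ 1 / (n + 1 : ℝ) := by
    intro n
    obtain ⟨u, w, h, hlt⟩ := hcon (1 / (n + 1 : ℝ)) (by positivity)
    exact exists_normalized hL.le hpos h hlt
  choose u w hS hnorm hQ using hn
  have hw1 : ∀ n, ∫ z in 0..L, ‖w n z‖ ^ 2 ≤ 1 := fun n => by
    have := hnorm n; nlinarith [sq_nonneg ‖u n 0‖]
  have hu1 : ∀ n, ‖u n 0‖ ≤ 1 := fun n => by
    have h0 : 0 ≤ ∫ z in 0..L, ‖w n z‖ ^ 2 :=
      intervalIntegral.integral_nonneg hL.le fun _ _ => by positivity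
    have := hnorm n
    exact (sq_le_one_iff₀ (norm_nonneg _)).mp (by linarith)
  let 𝒰 : Ultrafilter ℕ := hyperfilter ℕ
  obtain ⟨u₁, w₁, hS₁, hweak, hunif⟩ := exists_sobolev_limit 𝒰 hL hS hw1 hu1
  have hw₁ := hS₁.memLp
  obtain ⟨C₁, hC₁, hb₁⟩ := exists_bound_of_continuousOn (hS₁.primitive.continuousOn hL.le)
  obtain ⟨CN, hCN, hbN⟩ := exists_bound_of_continuousOn (F := E →L[ℝ] E →L[ℝ] ℝ) hN
  obtain ⟨CM, hCM, hbM⟩ := exists_bound_of_continuousOn (F := E →L[ℝ] E →L[ℝ] ℝ) hM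
  -- the linear functional of `w n - w₁` that appears in the expansion at `(u₁, w₁)`
  let g : ℝ → E →L[ℝ] ℝ := fun z => A z (w₁ z) + (A z).flip (w₁ z) + M z (u₁ z)
  have hAf : ContinuousOn (fun z => (A z).flip) (Icc 0 L) :=
    (ContinuousLinearMap.flipₗᵢ ℝ E E ℝ).continuous.comp_continuousOn hA
  have hg : MemLp g 2 (volume.restrict (Ioc 0 L)) :=
    ((memLp_clm_apply hA hw₁).add (memLp_clm_apply hAf hw₁)).add
      (memLp_clm_apply hM (hS₁.memLp_self hL.le))
  have hgd : Tendsto (fun n => ∫ z in 0..L, g z (w n z - w₁ z)) 𝒰 (𝓝 0) := by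
    have h1 := (hweak g hg).sub_const (∫ z in 0..L, g z (w₁ z))
    rw [sub_self] at h1
    refine h1.congr fun n => ?_
    rw [← intervalIntegral.integral_sub]
    · simp only [map_sub]
    · rw [intervalIntegrable_iff_integrableOn_Ioc_of_le hL.le]
      exact integrable_clm_apply hg (hS n).memLp
    · rw [intervalIntegrable_iff_integrableOn_Ioc_of_le hL.le]
      exact integrable_clm_apply hg hw₁
  set C := max (C₁ + 1) (max CN CM) with hCdef
  have hC : 0 ≤ C := le_trans (by positivity) (le_max_left (C₁ + 1) _)
  set D := 2 * C ^ 2 * L + C * (L + 1) with hD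
  have hD0 : 0 ≤ D := by positivity
  have hfund : ∀ ε > 0, ε ≤ 1 → ∀ᶠ n in (𝒰 : Filter ℕ),
      quadForm A N M L u₁ w₁ + (∫ z in 0..L, g z (w n z - w₁ z))
        + κ * (∫ z in 0..L, ‖w n z - w₁ z‖ ^ 2) - ε * D ≤ quadForm A N M L (u n) (w n) := by
    intro ε hε hε1
    filter_upwards [hunif ε hε] with n hn
    refine quadForm_ge hL hA hN hM hAκ hC
      (fun z hz => (hbN z hz).trans ((le_max_left _ _).trans (le_max_right _ _)))
      (fun z hz => (hbM z hz).trans ((le_max_right _ _).trans (le_max_right _ _)))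
      hS₁ (hS n) (hw1 n)
      (fun z hz => ((hb₁ z hz).trans (by linarith)).trans (le_max_left (C₁ + 1) _))
      (fun z hz => ?_) hn (fun _ => rfl) hg
    have h1 := norm_le_norm_add_norm_sub' (u n z) (u₁ z)
    have h2 := hb₁ z hz
    have h3 := hn z hz
    exact le_trans (by linarith) (le_max_left (C₁ + 1) _)
  have hlim : ∀ δ > 0, ∀ᶠ n in (𝒰 : Filter ℕ),
      quadForm A N M L u₁ w₁ + κ * (∫ z in 0..L, ‖w n z - w₁ z‖ ^ 2) ≤ δ := by
    intro δ hδ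
    have hε : 0 < min 1 (δ / 3 / (D + 1)) := by positivity
    have hnn : Tendsto (fun n : ℕ => 1 / ((n : ℝ) + 1)) 𝒰 (𝓝 0) :=
      tendsto_one_div_add_atTop_nhds_zero_nat.mono_left Nat.hyperfilter_le_atTop
    filter_upwards [hfund _ hε (min_le_left _ _), (Metric.tendsto_nhds.mp hgd) (δ / 3)
      (by positivity), (Metric.tendsto_nhds.mp hnn) (δ / 3) (by positivity)] with n h1 h2 h3
    rw [Real.dist_eq, sub_zero] at h2 h3
    have h2 := (abs_lt.mp h2).1
    have h3 := (abs_lt.mp h3).2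
    have h4 := hQ n
    have h5 : min 1 (δ / 3 / (D + 1)) * D ≤ δ / 3 := by
      calc min 1 (δ / 3 / (D + 1)) * D ≤ δ / 3 / (D + 1) * (D + 1) := by
            gcongr
            · exact min_le_right _ _
            · linarith
        _ = δ / 3 := div_mul_cancel₀ _ (by positivity)
    linarith
  have hdn : ∀ n, 0 ≤ ∫ z in 0..L, ‖w n z - w₁ z‖ ^ 2 := fun n =>
    intervalIntegral.integral_nonneg hL.le fun _ _ => by positivity
  by_cases hu : ∃ z ∈ Icc 0 L, u₁ z ≠ 0
  · have hq := hpos u₁ w₁ hS₁ hu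
    obtain ⟨n, hn⟩ := (hlim (quadForm A N M L u₁ w₁ / 2) (by positivity)).exists
    have := mul_nonneg hκ.le (hdn n)
    linarith
  · push Not at hu
    have hw0 := hS₁.ae_eq_zero hL.le hu
    have hq0 : quadForm A N M L u₁ w₁ = 0 := hS₁.quadForm_eq_zero hL.le hu
    have hev : ∀ᶠ n in (𝒰 : Filter ℕ), ‖u n 0‖ < 1 / 2 := by
      filter_upwards [hunif (1 / 4) (by norm_num)] with n hn
      have h1 := hn 0 ⟨le_rfl, hL.le⟩
      rw [hu 0 ⟨le_rfl, hL.le⟩, sub_zero] at h1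
      linarith
    obtain ⟨n, h1, h2⟩ := ((hlim (κ / 2) (by positivity)).and hev).exists
    have h3 : ∫ z in 0..L, ‖w n z - w₁ z‖ ^ 2 = ∫ z in 0..L, ‖w n z‖ ^ 2 := by
      rw [intervalIntegral.integral_of_le hL.le, intervalIntegral.integral_of_le hL.le]
      refine integral_congr_ae ?_
      filter_upwards [hw0] with z hz
      simp [hz]
    rw [hq0, h3, zero_add] at h1
    have h4 : ∫ z in 0..L, ‖w n z‖ ^ 2 ≤ 1 / 2 := by
      by_contra! h
      nlinarith
    have h5 := hnorm n
    have h6 : ‖u n 0‖ ^ 2 < 1 / 2 := by nlinarith [norm_nonneg (u n 0)]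
    linarith

end

/-! ### Uniform Taylor expansions -/

section

section Taylor

variable {V W : Type*} [NormedAddCommGroup V] [NormedSpace ℝ V] [NormedAddCommGroup W]
  [NormedSpace ℝ W] {K : Set V} {f : V → W} {f' : V → V →L[ℝ] W} {f'' : V → V →L[ℝ] V →L[ℝ] W}

/-- First order Taylor expansion, uniform on a convex compact set. -/
theorem exists_taylor_one (hK : IsCompact K) (hconv : Convex ℝ K)
    (hf : ∀ x ∈ K, HasFDerivWithinAt f (f' x) K x) (hc : ContinuousOn f' K) {ε : ℝ} (hε : 0 < ε) :
    ∃ η > 0, ∀ p ∈ K, ∀ q ∈ K, ‖p - q‖ < η → ‖f p - f q - f' q (p - q)‖ ≤ ε * ‖p - q‖ := by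
  obtain ⟨η, hη, h⟩ := Metric.uniformContinuousOn_iff.mp
    (hK.uniformContinuousOn_of_continuous hc) ε hε
  refine ⟨η, hη, fun p hp q hq hpq => ?_⟩
  refine (hconv.inter (convex_ball q η)).norm_image_sub_le_of_norm_hasFDerivWithin_le'
    (f' := f') (fun x hx => (hf x hx.1).mono inter_subset_left) (fun x hx => ?_)
    ⟨hq, Metric.mem_ball_self hη⟩ ⟨hp, by rwa [Metric.mem_ball, dist_eq_norm]⟩
  have := h x hx.1 q hq hx.2
  rw [dist_eq_norm] at this
  exact this.le

/-- Second order Taylor expansion, uniform on a convex compact set. -/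
theorem exists_taylor_two (hK : IsCompact K) (hconv : Convex ℝ K)
    (hf : ∀ x ∈ K, HasFDerivWithinAt f (f' x) K x)
    (hf' : ∀ x ∈ K, HasFDerivWithinAt f' (f'' x) K x) (hc : ContinuousOn f'' K) {ε : ℝ}
    (hε : 0 < ε) :
    ∃ η > 0, ∀ p ∈ K, ∀ q ∈ K, ‖p - q‖ < η →
      ‖f p - f q - f' q (p - q) - (1 / 2 : ℝ) • f'' q (p - q) (p - q)‖ ≤ ε * ‖p - q‖ ^ 2 := by
  obtain ⟨η, hη, h⟩ := exists_taylor_one hK hconv hf' hc hε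
  refine ⟨η, hη, fun p hp q hq hpq => ?_⟩
  set k := p - q with hk
  have hseg : ∀ τ ∈ Icc (0 : ℝ) 1, q + τ • k ∈ K := fun τ hτ => by
    have := hconv.add_smul_sub_mem hq hp hτ
    simpa using this
  let g : ℝ → W := fun τ => f (q + τ • k) - τ • f' q k - (τ ^ 2 / 2) • f'' q k k
  have hg : ∀ τ ∈ Icc (0 : ℝ) 1, HasDerivWithinAt g
      (f' (q + τ • k) k - f' q k - τ • f'' q k k) (Icc 0 1) τ := by
    intro τ hτ
    have h1 : HasDerivWithinAt (fun τ : ℝ => q + τ • k) k (Icc 0 1) τ := by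
      simpa using ((hasDerivAt_id τ).smul_const k).const_add q |>.hasDerivWithinAt
    have h2 := (hf _ (hseg τ hτ)).comp_hasDerivWithinAt τ h1 hseg
    have h3 : HasDerivWithinAt (fun τ : ℝ => τ • f' q k) (f' q k) (Icc 0 1) τ := by
      simpa using ((hasDerivAt_id τ).smul_const (f' q k)).hasDerivWithinAt
    have h4 : HasDerivWithinAt (fun τ : ℝ => (τ ^ 2 / 2) • f'' q k k) (τ • f'' q k k)
        (Icc 0 1) τ := by
      have := (((hasDerivAt_pow 2 τ).div_const 2).smul_const (f'' q k k)).hasDerivWithinAt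
        (s := Icc 0 1)
      simpa using this
    exact (h2.sub h3).sub h4
  have hbd : ∀ τ ∈ Ico (0 : ℝ) 1,
      ‖f' (q + τ • k) k - f' q k - τ • f'' q k k‖ ≤ ε * ‖k‖ ^ 2 := by
    intro τ hτ
    have hτ' : τ ∈ Icc (0 : ℝ) 1 := Ico_subset_Icc_self hτ
    have hn : ‖τ • k‖ ≤ ‖k‖ := by
      rw [norm_smul, Real.norm_of_nonneg hτ.1]
      exact mul_le_of_le_one_left (norm_nonneg _) hτ.2.le
    have h1 := h (q + τ • k) (hseg τ hτ') q hq (by simpa using lt_of_le_of_lt hn hpq)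
    rw [add_sub_cancel_left] at h1
    have h2 := (f' (q + τ • k) - f' q - f'' q (τ • k)).le_of_opNorm_le h1 k
    have e : (f' (q + τ • k) - f' q - f'' q (τ • k)) k
        = f' (q + τ • k) k - f' q k - τ • f'' q k k := by simp
    rw [e] at h2
    calc _ ≤ ε * ‖τ • k‖ * ‖k‖ := h2
      _ ≤ ε * ‖k‖ * ‖k‖ := by gcongr
      _ = _ := by ring
  have := norm_image_sub_le_of_norm_deriv_le_segment_01' hg hbd
  have e : g 1 - g 0 = f p - f q - f' q k - (1 / 2 : ℝ) • f'' q k k := by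
    simp only [g, one_smul, zero_smul, add_zero, one_pow, hk]
    rw [add_sub_cancel]
    simp
    abel
  rwa [e] at this

end Taylor

/-! ### The cylinder -/

theorem isCompact_cylinder (δ L : ℝ) : IsCompact (cylinder δ L) :=
  (isCompact_closedBall 0 δ).prod isCompact_Icc

theorem convex_cylinder (δ L : ℝ) : Convex ℝ (cylinder δ L) :=
  (convex_closedBall 0 δ).prod (convex_Icc 0 L)

theorem uniqueDiffOn_cylinder {δ L : ℝ} (hδ : 0 < δ) (hL : 0 < L) :
    UniqueDiffOn ℝ (cylinder δ L) := by
  refine UniqueDiffOn.prod ?_ (uniqueDiffOn_Icc hL)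
  refine uniqueDiffOn_convex (convex_closedBall 0 δ) ?_
  rw [interior_closedBall _ hδ.ne']
  exact ⟨0, Metric.mem_ball_self hδ⟩

theorem mem_cylinder {δ L : ℝ} {v : E2} {z : ℝ} :
    (v, z) ∈ cylinder δ L ↔ ‖v‖ ≤ δ ∧ z ∈ Icc 0 L := by
  simp [cylinder]

theorem axis_mem_cylinder {δ L : ℝ} (hδ : 0 ≤ δ) {z : ℝ} (hz : z ∈ Icc 0 L) :
    ((0 : E2), z) ∈ cylinder δ L := mem_cylinder.mpr ⟨by simpa using hδ, hz⟩

theorem continuousOn_axis {δ L : ℝ} (hδ : 0 ≤ δ) {X : Type*} [TopologicalSpace X]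
    {f : E2 × ℝ → X} (hf : ContinuousOn f (cylinder δ L)) :
    ContinuousOn (fun z : ℝ => f (0, z)) (Icc 0 L) :=
  hf.comp (by fun_prop) fun _ hz => axis_mem_cylinder hδ hz

/-- A continuous function on an interval has a primitive of class `C¹` on the whole line. -/
theorem exists_primitive_Icc {c : ℝ → ℝ} {L : ℝ} (hL : 0 ≤ L) (hc : ContinuousOn c (Icc 0 L)) :
    ∃ s : ℝ → ℝ, ContDiff ℝ 1 s ∧ (∀ z ∈ Icc 0 L, HasDerivAt s (c z) z) ∧
      s 0 = 0 ∧ s L = ∫ z in 0..L, c z := by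
  have hcont : Continuous (IccExtend hL ((Icc 0 L).domRestrict c)) :=
    (continuousOn_iff_continuous_domRestrict.mp hc).Icc_extend'
  have heq : ∀ z ∈ Icc 0 L, IccExtend hL ((Icc 0 L).domRestrict c) z = c z := fun z hz => by
    simp [IccExtend_of_mem hL _ hz, Set.domRestrict]
  have hd : ∀ z, HasDerivAt (fun z => ∫ s in 0..z, IccExtend hL ((Icc 0 L).domRestrict c) s)
      (IccExtend hL ((Icc 0 L).domRestrict c) z) z :=
    fun z => (hcont.integral_hasStrictDerivAt 0 z).hasDerivAt
  refine ⟨_, contDiff_one_iff_deriv.mpr ⟨fun z => (hd z).differentiableAt, ?_⟩,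
    fun z hz => heq z hz ▸ hd z, by simp, ?_⟩
  · rw [show deriv _ = _ from funext fun z => (hd z).deriv]
    exact hcont
  · refine intervalIntegral.integral_congr fun z hz => heq z ?_
    rwa [uIcc_of_le hL] at hz

end

/-! ### Forms on the cylinder -/

section

/-- The vector field `∂_z` on the cylinder. -/
abbrev vert : E2 × ℝ := (0, 1)

/-- The inclusion of the horizontal directions. -/
abbrev horiz : E2 →L[ℝ] E2 × ℝ := ContinuousLinearMap.inl ℝ E2 ℝ

theorem pair_eq (w : E2) (ζ : ℝ) : ((w, ζ) : E2 × ℝ) = horiz w + ζ • vert := by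
  simp

section Form

variable {δ L : ℝ} (θ : E2 × ℝ → E2 × ℝ →L[ℝ] ℝ)

/-- The first derivative, in the cylinder, of a `1`-form. -/
noncomputable def formD (δ L : ℝ) : E2 × ℝ → E2 × ℝ →L[ℝ] E2 × ℝ →L[ℝ] ℝ :=
  fderivWithin ℝ θ (cylinder δ L)

/-- The second derivative, in the cylinder, of a `1`-form. -/
noncomputable def formDD (δ L : ℝ) : E2 × ℝ → E2 × ℝ →L[ℝ] E2 × ℝ →L[ℝ] E2 × ℝ →L[ℝ] ℝ :=
  fderivWithin ℝ (formD θ δ L) (cylinder δ L)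

/-- The covector `v ↦ dθ(v, ∂_z)` on the axis, for horizontal `v`. -/
noncomputable def axisLin (δ L z : ℝ) : E2 →L[ℝ] ℝ :=
  ((formD θ δ L (0, z)).flip vert - formD θ δ L (0, z) vert).comp horiz

/-- The bilinear form `(v, w) ↦ dθ(v, w)` on the axis, for horizontal `v` and `w`. -/
noncomputable def axisCurl (δ L z : ℝ) : E2 →L[ℝ] E2 →L[ℝ] ℝ :=
  (formD θ δ L (0, z) - (formD θ δ L (0, z)).flip).bilinearComp horiz horiz

/-- The derivative `(v, v') ↦ ∂_v (dθ(v', ∂_z))` on the axis, for horizontal `v` and `v'`. -/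
noncomputable def axisHess (δ L z : ℝ) : E2 →L[ℝ] E2 →L[ℝ] ℝ :=
  ((ContinuousLinearMap.compL ℝ (E2 × ℝ) (E2 × ℝ →L[ℝ] ℝ) ℝ
      (ContinuousLinearMap.apply ℝ ℝ vert)).comp (formDD θ δ L (0, z))
    - formDD θ δ L (0, z) vert).bilinearComp horiz horiz

theorem axisLin_apply (z : ℝ) (v : E2) : axisLin θ δ L z v =
    formD θ δ L (0, z) (horiz v) vert - formD θ δ L (0, z) vert (horiz v) := rfl

theorem axisCurl_apply (z : ℝ) (v w : E2) : axisCurl θ δ L z v w =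
    formD θ δ L (0, z) (horiz v) (horiz w) - formD θ δ L (0, z) (horiz w) (horiz v) := rfl

theorem axisHess_apply (z : ℝ) (v w : E2) : axisHess θ δ L z v w =
    formDD θ δ L (0, z) (horiz v) (horiz w) vert
      - formDD θ δ L (0, z) vert (horiz v) (horiz w) := rfl

variable {θ}

theorem contDiffOn_formD (hδ : 0 < δ) (hL : 0 < L) (hθ : ContDiffOn ℝ 2 θ (cylinder δ L)) :
    ContDiffOn ℝ 1 (formD θ δ L) (cylinder δ L) :=
  hθ.fderivWithin (uniqueDiffOn_cylinder hδ hL) (by norm_num)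

theorem hasFDerivWithinAt_form (hθ : ContDiffOn ℝ 2 θ (cylinder δ L)) {p : E2 × ℝ}
    (hp : p ∈ cylinder δ L) : HasFDerivWithinAt θ (formD θ δ L p) (cylinder δ L) p :=
  ((hθ.differentiableOn (by norm_num)) p hp).hasFDerivWithinAt

theorem hasFDerivWithinAt_formD (hδ : 0 < δ) (hL : 0 < L)
    (hθ : ContDiffOn ℝ 2 θ (cylinder δ L)) {p : E2 × ℝ} (hp : p ∈ cylinder δ L) :
    HasFDerivWithinAt (formD θ δ L) (formDD θ δ L p) (cylinder δ L) p :=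
  (((contDiffOn_formD hδ hL hθ).differentiableOn (by norm_num)) p hp).hasFDerivWithinAt

theorem continuousOn_formDD (hδ : 0 < δ) (hL : 0 < L) (hθ : ContDiffOn ℝ 2 θ (cylinder δ L)) :
    ContinuousOn (formDD θ δ L) (cylinder δ L) :=
  (contDiffOn_formD hδ hL hθ).continuousOn_fderivWithin (uniqueDiffOn_cylinder hδ hL) (by norm_num)

theorem continuousOn_axisLin (hδ : 0 < δ) (hL : 0 < L) (hθ : ContDiffOn ℝ 2 θ (cylinder δ L)) :
    ContinuousOn (axisLin θ δ L) (Icc 0 L) := by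
  have h1 := continuousOn_axis hδ.le (contDiffOn_formD hδ hL hθ).continuousOn
  refine continuousOn_clm_apply.mpr fun v => ?_
  simp only [axisLin_apply]
  exact ((h1.clm_apply continuousOn_const).clm_apply continuousOn_const).sub
    ((h1.clm_apply continuousOn_const).clm_apply continuousOn_const)

theorem continuousOn_axisCurl (hδ : 0 < δ) (hL : 0 < L) (hθ : ContDiffOn ℝ 2 θ (cylinder δ L)) :
    ContinuousOn (axisCurl θ δ L) (Icc 0 L) := by
  have h1 := continuousOn_axis hδ.le (contDiffOn_formD hδ hL hθ).continuousOn
  refine continuousOn_clm_apply.mpr fun v => continuousOn_clm_apply.mpr fun w => ?_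
  simp only [axisCurl_apply]
  exact ((h1.clm_apply continuousOn_const).clm_apply continuousOn_const).sub
    ((h1.clm_apply continuousOn_const).clm_apply continuousOn_const)

theorem continuousOn_axisHess (hδ : 0 < δ) (hL : 0 < L) (hθ : ContDiffOn ℝ 2 θ (cylinder δ L)) :
    ContinuousOn (axisHess θ δ L) (Icc 0 L) := by
  have h1 := continuousOn_axis hδ.le (continuousOn_formDD hδ hL hθ)
  refine continuousOn_clm_apply.mpr fun v => continuousOn_clm_apply.mpr fun w => ?_
  simp only [axisHess_apply]
  exact (((h1.clm_apply continuousOn_const).clm_apply continuousOn_const).clm_apply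
    continuousOn_const).sub (((h1.clm_apply continuousOn_const).clm_apply
    continuousOn_const).clm_apply continuousOn_const)

/-- A function on the cylinder whose differential agrees with `θ` to second order, up to terms
which only involve `dθ`; here `s` is a primitive of `z ↦ θ (0, z) ∂_z`. It is the homotopy primitive
of `θ` along the radii `τ ↦ (τ v, z)`, truncated at second order in `v`. -/
noncomputable def gauge (θ : E2 × ℝ → E2 × ℝ →L[ℝ] ℝ) (δ L : ℝ) (s : ℝ → ℝ) (p : E2 × ℝ) : ℝ :=
  s p.2 + θ (0, p.2) (horiz p.1) + 1 / 2 * formD θ δ L (0, p.2) (horiz p.1) (horiz p.1)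

theorem mapsTo_axis_proj (hδ : 0 ≤ δ) :
    MapsTo (fun p : E2 × ℝ => ((0 : E2), p.2)) (cylinder δ L) (cylinder δ L) :=
  fun _ hp => axis_mem_cylinder hδ hp.2

theorem exists_lipschitz_gauge (hδ : 0 < δ) (hL : 0 < L) (hθ : ContDiffOn ℝ 2 θ (cylinder δ L))
    {s : ℝ → ℝ} (hs : ContDiff ℝ 1 s) :
    ∃ C : ℝ≥0, LipschitzOnWith C (gauge θ δ L s) (cylinder δ L) := by
  have hπ : ContDiff ℝ 1 (fun p : E2 × ℝ => ((0 : E2), p.2)) := by fun_prop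
  have hh : ContDiff ℝ 1 (fun p : E2 × ℝ => horiz p.1) := by fun_prop
  have h1 : ContDiffOn ℝ 1 (fun p : E2 × ℝ => θ (0, p.2)) (cylinder δ L) :=
    (hθ.of_le (by norm_num)).comp hπ.contDiffOn (mapsTo_axis_proj hδ.le)
  have h2 : ContDiffOn ℝ 1 (fun p : E2 × ℝ => formD θ δ L (0, p.2)) (cylinder δ L) :=
    (contDiffOn_formD hδ hL hθ).comp hπ.contDiffOn (mapsTo_axis_proj hδ.le)
  have h3 : ContDiffOn ℝ 1 (gauge θ δ L s) (cylinder δ L) :=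
    ((hs.comp contDiff_snd).contDiffOn.add (h1.clm_apply hh.contDiffOn)).add
      (contDiffOn_const.mul ((h2.clm_apply hh.contDiffOn).clm_apply hh.contDiffOn))
  exact h3.exists_lipschitzOnWith (by norm_num) (convex_cylinder δ L) (isCompact_cylinder δ L)

/-- The differential of the gauge function. -/
theorem exists_hasFDerivWithinAt_gauge (hδ : 0 < δ) (hL : 0 < L)
    (hθ : ContDiffOn ℝ 2 θ (cylinder δ L)) {s : ℝ → ℝ} {v : E2} {z c : ℝ}
    (hs : HasDerivAt s c z) (hp : (v, z) ∈ cylinder δ L) :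
    ∃ S' : E2 × ℝ →L[ℝ] ℝ, HasFDerivWithinAt (gauge θ δ L s) S' (cylinder δ L) (v, z) ∧
      ∀ (w : E2) (ζ : ℝ), S' (w, ζ) = ζ * c + (θ (0, z) (horiz w)
        + ζ * formD θ δ L (0, z) vert (horiz v))
        + 1 / 2 * (ζ * formDD θ δ L (0, z) vert (horiz v) (horiz v)
          + formD θ δ L (0, z) (horiz w) (horiz v) + formD θ δ L (0, z) (horiz v) (horiz w)) := by
  let π : E2 × ℝ →L[ℝ] E2 × ℝ :=
    (ContinuousLinearMap.inr ℝ E2 ℝ).comp (ContinuousLinearMap.snd ℝ E2 ℝ)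
  let J : E2 × ℝ →L[ℝ] E2 × ℝ := horiz.comp (ContinuousLinearMap.fst ℝ E2 ℝ)
  have hπ : HasFDerivWithinAt (fun p : E2 × ℝ => ((0 : E2), p.2)) π (cylinder δ L) (v, z) :=
    π.hasFDerivWithinAt
  have hJ : HasFDerivWithinAt (fun p : E2 × ℝ => horiz p.1) J (cylinder δ L) (v, z) :=
    J.hasFDerivWithinAt
  have h0 := axis_mem_cylinder hδ.le (mem_cylinder.mp hp).2
  have h1 : HasFDerivWithinAt (fun p : E2 × ℝ => θ (0, p.2)) ((formD θ δ L (0, z)).comp π)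
      (cylinder δ L) (v, z) :=
    (hasFDerivWithinAt_form hθ h0).comp (v, z) hπ (mapsTo_axis_proj hδ.le)
  have h2 : HasFDerivWithinAt (fun p : E2 × ℝ => formD θ δ L (0, p.2))
      ((formDD θ δ L (0, z)).comp π) (cylinder δ L) (v, z) :=
    (hasFDerivWithinAt_formD hδ hL hθ h0).comp (v, z) hπ (mapsTo_axis_proj hδ.le)
  have h3 : HasFDerivWithinAt (fun p : E2 × ℝ => s p.2) (c • ContinuousLinearMap.snd ℝ E2 ℝ)
      (cylinder δ L) (v, z) :=
    (HasDerivAt.comp_hasFDerivWithinAt (v, z) hs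
      (ContinuousLinearMap.snd ℝ E2 ℝ).hasFDerivWithinAt)
  have h4 := (h3.add (h1.clm_apply hJ)).add (((h2.clm_apply hJ).clm_apply hJ).const_mul (1 / 2))
  refine ⟨_, h4, fun w ζ => ?_⟩
  have e : π (w, ζ) = ζ • vert := by simp [π]
  have eJ : J (w, ζ) = horiz w := rfl
  simp only [add_apply, smul_apply, ContinuousLinearMap.comp_apply,
    ContinuousLinearMap.flip_apply, e, eJ, map_smul, smul_eq_mul, ContinuousLinearMap.coe_snd']
  ring

/-- The difference of `θ` and of the differential of the gauge function, to second order in the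
distance to the axis. -/
theorem exists_form_expansion (hδ : 0 < δ) (hL : 0 < L)
    (hθ : ContDiffOn ℝ 2 θ (cylinder δ L)) {ε : ℝ} (hε : 0 < ε) :
    ∃ η > 0, ∀ v z, (v, z) ∈ cylinder δ L → ‖v‖ < η → ∀ (w : E2) (ζ : ℝ),
      |θ (v, z) (w, ζ) - (ζ * θ (0, z) vert + (θ (0, z) (horiz w)
        + ζ * formD θ δ L (0, z) vert (horiz v))
        + 1 / 2 * (ζ * formDD θ δ L (0, z) vert (horiz v) (horiz v)
          + formD θ δ L (0, z) (horiz w) (horiz v) + formD θ δ L (0, z) (horiz v) (horiz w)))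
        - (ζ * axisLin θ δ L z v
          + 1 / 2 * (axisCurl θ δ L z v w + ζ * axisHess θ δ L z v v))|
      ≤ ε * (‖v‖ * ‖w‖ + ‖v‖ ^ 2 * |ζ|) := by
  obtain ⟨η₁, hη₁, H₁⟩ := exists_taylor_one (isCompact_cylinder δ L) (convex_cylinder δ L)
    (fun x hx => hasFDerivWithinAt_form hθ hx) (contDiffOn_formD hδ hL hθ).continuousOn hε
  obtain ⟨η₂, hη₂, H₂⟩ := exists_taylor_two (isCompact_cylinder δ L) (convex_cylinder δ L)
    (fun x hx => hasFDerivWithinAt_form hθ hx)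
    (fun x hx => hasFDerivWithinAt_formD hδ hL hθ hx) (continuousOn_formDD hδ hL hθ) hε
  refine ⟨min η₁ η₂, lt_min hη₁ hη₂, fun v z hp hv w ζ => ?_⟩
  have h0 := axis_mem_cylinder hδ.le (mem_cylinder.mp hp).2
  have e : ((v, z) : E2 × ℝ) - (0, z) = horiz v := by simp
  have hn : ‖horiz v‖ = ‖v‖ := by simp [Prod.norm_def]
  have hv1 : ‖v‖ < η₁ := hv.trans_le (min_le_left _ _)
  have hv2 : ‖v‖ < η₂ := hv.trans_le (min_le_right _ _)
  have a1 := H₁ (v, z) hp (0, z) h0 (by rw [e, hn]; exact hv1)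
  have a2 := H₂ (v, z) hp (0, z) h0 (by rw [e, hn]; exact hv2)
  rw [e, hn] at a1 a2
  have b1 := ContinuousLinearMap.le_of_opNorm_le _ a1 (horiz w)
  have b2 := ContinuousLinearMap.le_of_opNorm_le _ a2 vert
  have hw : ‖horiz w‖ = ‖w‖ := by simp [Prod.norm_def]
  have hvert : ‖vert‖ = 1 := by simp [vert, Prod.norm_def]
  rw [hw, Real.norm_eq_abs] at b1
  rw [hvert, mul_one, Real.norm_eq_abs] at b2
  simp only [sub_apply, smul_apply, smul_eq_mul] at b1 b2
  rw [axisLin_apply, axisCurl_apply, axisHess_apply, pair_eq w ζ, map_add, map_smul, smul_eq_mul]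
  have split : ∀ x y : ℝ, x = (θ (v, z) (horiz w) - θ (0, z) (horiz w)
      - formD θ δ L (0, z) (horiz v) (horiz w)) + ζ * y → |x| ≤ ε * ‖v‖ * ‖w‖ + |ζ| * |y| := by
    intro x y hx
    rw [hx]
    refine (abs_add_le _ _).trans ?_
    rw [abs_mul]
    linarith
  -- the first order expansion suffices for the horizontal component, where an error `ε |v| |w|` is
  -- allowed; the vertical component needs the second order one
  refine (split _ (θ (v, z) vert - θ (0, z) vert - formD θ δ L (0, z) (horiz v) vert
    - 1 / 2 * formDD θ δ L (0, z) (horiz v) (horiz v) vert) ?_).trans ?_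
  · ring
  · have := mul_le_mul_of_nonneg_left b2 (abs_nonneg ζ)
    nlinarith

end Form

end

/-! ### Integrals of forms along curves in the cylinder -/

section

theorem intervalIntegrable_clm_apply {V W : Type*} [NormedAddCommGroup V] [NormedSpace ℝ V]
    [NormedAddCommGroup W] [NormedSpace ℝ W] {L : ℝ} (hL : 0 ≤ L) {a : ℝ → V →L[ℝ] W}
    (ha : ContinuousOn a (Icc 0 L)) {w : ℝ → V} (hw : IntervalIntegrable w volume 0 L) :
    IntervalIntegrable (fun t => a t (w t)) volume 0 L := by
  obtain ⟨C, hC, hb⟩ := exists_bound_of_continuousOn ha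
  rw [intervalIntegrable_iff_integrableOn_Ioc_of_le hL] at hw ⊢
  refine Integrable.mono' (hw.norm.const_mul C) ?_ ?_
  · exact (ContinuousLinearMap.id ℝ (V →L[ℝ] W)).aestronglyMeasurable_comp₂
      ((ha.mono Ioc_subset_Icc_self).aestronglyMeasurable measurableSet_Ioc) hw.1
  · filter_upwards [ae_restrict_mem measurableSet_Ioc] with z hz
    exact (a z).le_of_opNorm_le (hb z (Ioc_subset_Icc_self hz)) _

theorem intervalIntegrable_mul_of_continuousOn {L : ℝ} (hL : 0 ≤ L) {a ζ : ℝ → ℝ}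
    (ha : ContinuousOn a (Icc 0 L)) (hζ : IntervalIntegrable ζ volume 0 L) :
    IntervalIntegrable (fun t => a t * ζ t) volume 0 L :=
  hζ.continuousOn_mul (by rwa [uIcc_of_le hL])

/-- The curve `t ↦ (v t, z t)` in the cylinder, with velocity `(w, ζ)`, joins the two bases. -/
structure IsTubeCurve (δ L : ℝ) (v w : ℝ → E2) (z ζ : ℝ → ℝ) : Prop where
  sobolev : IsSobolev L v w
  vertical : IsPrimitiveOn z ζ 0 L
  mem : ∀ t ∈ Icc 0 L, (v t, z t) ∈ cylinder δ L
  left : z 0 = 0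
  right : z L = L

namespace IsTubeCurve

variable {δ L : ℝ} {v w : ℝ → E2} {z ζ : ℝ → ℝ}

theorem primitive (h : IsTubeCurve δ L v w z ζ) (hL : 0 ≤ L) :
    IsPrimitiveOn (fun t => (v t, z t)) (fun t => (w t, ζ t)) 0 L := by
  have h1 := (intervalIntegrable_iff_integrableOn_Ioc_of_le hL).mp h.sobolev.primitive.integrable
  have h2 := (intervalIntegrable_iff_integrableOn_Ioc_of_le hL).mp h.vertical.integrable
  refine ⟨(intervalIntegrable_iff_integrableOn_Ioc_of_le hL).mpr (h1.prodMk h2), fun t ht => ?_⟩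
  have hs : Ioc 0 t ⊆ Ioc 0 L := Ioc_subset_Ioc_right ht.2
  rw [intervalIntegral.integral_of_le ht.1, integral_pair (h1.mono_set hs) (h2.mono_set hs),
    ← intervalIntegral.integral_of_le ht.1, ← intervalIntegral.integral_of_le ht.1,
    Prod.mk_add_mk, ← h.sobolev.primitive.eq t ht, ← h.vertical.eq t ht]

theorem continuousOn (h : IsTubeCurve δ L v w z ζ) (hL : 0 ≤ L) :
    ContinuousOn (fun t => (v t, z t)) (Icc 0 L) := (h.primitive hL).continuousOn hL

theorem continuousOn_left (h : IsTubeCurve δ L v w z ζ) (hL : 0 ≤ L) :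
    ContinuousOn v (Icc 0 L) := h.sobolev.primitive.continuousOn hL

theorem continuousOn_right (h : IsTubeCurve δ L v w z ζ) (hL : 0 ≤ L) :
    ContinuousOn z (Icc 0 L) := h.vertical.continuousOn hL

theorem mapsTo_right (h : IsTubeCurve δ L v w z ζ) : MapsTo z (Icc 0 L) (Icc 0 L) :=
  fun t ht => (mem_cylinder.mp (h.mem t ht)).2

theorem intervalIntegrable_form (h : IsTubeCurve δ L v w z ζ) (hL : 0 ≤ L)
    {θ : E2 × ℝ → E2 × ℝ →L[ℝ] ℝ} (hθ : ContinuousOn θ (cylinder δ L)) :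
    IntervalIntegrable (fun t => θ (v t, z t) (w t, ζ t)) volume 0 L :=
  intervalIntegrable_clm_apply hL (hθ.comp (h.continuousOn hL) h.mem) (h.primitive hL).integrable

theorem intervalIntegrable_error (h : IsTubeCurve δ L v w z ζ) (hL : 0 ≤ L) :
    IntervalIntegrable (fun t => ‖v t‖ * ‖w t‖ + ‖v t‖ ^ 2 * |ζ t|) volume 0 L :=
  (intervalIntegrable_mul_of_continuousOn hL (h.continuousOn_left hL).norm
    h.sobolev.primitive.integrable.norm).add
    (intervalIntegrable_mul_of_continuousOn hL ((h.continuousOn_left hL).norm.pow 2)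
      h.vertical.integrable.norm)

theorem intervalIntegrable_lin (h : IsTubeCurve δ L v w z ζ) (hL : 0 ≤ L)
    {ℓ : ℝ → E2 →L[ℝ] ℝ} (hℓ : ContinuousOn ℓ (Icc 0 L)) :
    IntervalIntegrable (fun t => ζ t * ℓ (z t) (v t)) volume 0 L := by
  have := intervalIntegrable_mul_of_continuousOn hL
    ((hℓ.comp (h.continuousOn_right hL) h.mapsTo_right).clm_apply (h.continuousOn_left hL))
    h.vertical.integrable
  simpa only [mul_comm, Function.comp_apply] using this

theorem intervalIntegrable_curl (h : IsTubeCurve δ L v w z ζ) (hL : 0 ≤ L)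
    {M : ℝ → E2 →L[ℝ] E2 →L[ℝ] ℝ} (hM : ContinuousOn M (Icc 0 L)) :
    IntervalIntegrable (fun t => M (z t) (v t) (w t)) volume 0 L :=
  intervalIntegrable_clm_apply hL
    ((hM.comp (h.continuousOn_right hL) h.mapsTo_right).clm_apply (h.continuousOn_left hL))
    h.sobolev.primitive.integrable

theorem intervalIntegrable_hess (h : IsTubeCurve δ L v w z ζ) (hL : 0 ≤ L)
    {N : ℝ → E2 →L[ℝ] E2 →L[ℝ] ℝ} (hN : ContinuousOn N (Icc 0 L)) :
    IntervalIntegrable (fun t => ζ t * N (z t) (v t) (v t)) volume 0 L := by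
  have := intervalIntegrable_mul_of_continuousOn hL
    (((hN.comp (h.continuousOn_right hL) h.mapsTo_right).clm_apply
      (h.continuousOn_left hL)).clm_apply (h.continuousOn_left hL)) h.vertical.integrable
  simpa only [mul_comm, Function.comp_apply] using this

end IsTubeCurve

variable {δ L : ℝ} {θ : E2 × ℝ → E2 × ℝ →L[ℝ] ℝ}

/-- If the horizontal part of `θ` vanishes on a horizontal disc, so do its horizontal
derivatives. -/
theorem formD_horiz_eq_zero (hδ : 0 < δ) (hθ : ContDiffOn ℝ 2 θ (cylinder δ L)) {z : ℝ}
    (hz : z ∈ Icc 0 L) (h0 : ∀ v : E2, ‖v‖ ≤ δ → ∀ w, θ (v, z) (horiz w) = 0) (v w : E2) :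
    formD θ δ L (0, z) (horiz v) (horiz w) = 0 := by
  have h1 : HasDerivAt (fun τ : ℝ => ((τ • v, z) : E2 × ℝ)) (horiz v) 0 := by
    have := ((hasDerivAt_id (0 : ℝ)).smul_const v).prodMk (hasDerivAt_const (0 : ℝ) z)
    simpa using this
  have hev : ∀ᶠ τ : ℝ in 𝓝 0, ‖τ • v‖ ≤ δ := by
    have hc : Continuous fun τ : ℝ => ‖τ • v‖ := by fun_prop
    have := hc.tendsto 0
    simp only [zero_smul, norm_zero] at this
    exact this.eventually (eventually_le_nhds hδ)
  have h2 : HasFDerivWithinAt θ (formD θ δ L (0, z)) (cylinder δ L) ((0 : ℝ) • v, z) := by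
    rw [zero_smul]; exact hasFDerivWithinAt_form hθ (axis_mem_cylinder hδ.le hz)
  have h3 : HasDerivAt (fun τ : ℝ => θ (τ • v, z)) (formD θ δ L (0, z) (horiz v)) 0 :=
    h2.comp_hasDerivAt 0 h1 (hev.mono fun τ h => mem_cylinder.mpr ⟨h, hz⟩)
  have h4 : HasDerivAt (fun τ : ℝ => θ (τ • v, z) (horiz w))
      (formD θ δ L (0, z) (horiz v) (horiz w)) 0 :=
    (ContinuousLinearMap.apply ℝ ℝ (horiz w)).hasFDerivAt.comp_hasDerivAt 0 h3
  have h5 : HasDerivAt (fun _ : ℝ => (0 : ℝ)) (formD θ δ L (0, z) (horiz v) (horiz w)) 0 :=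
    h4.congr_of_eventuallyEq (hev.mono fun τ h => (h0 _ h w).symm)
  exact h5.unique (hasDerivAt_const _ _)

/-- Along curves joining the two bases and close to the axis, a `1`-form which vanishes on the
bases and has zero integral on the axis is given to second order by its exterior derivative. -/
theorem exists_integral_form_expansion (hδ : 0 < δ) (hL : 0 < L)
    (hθ : ContDiffOn ℝ 2 θ (cylinder δ L))
    (hbot : ∀ v : E2, ‖v‖ ≤ δ → ∀ w, θ (v, 0) (horiz w) = 0)
    (htop : ∀ v : E2, ‖v‖ ≤ δ → ∀ w, θ (v, L) (horiz w) = 0)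
    (hint : ∫ z in 0..L, θ (0, z) vert = 0) {ε : ℝ} (hε : 0 < ε) :
    ∃ η > 0, ∀ v w z ζ, IsTubeCurve δ L v w z ζ → (∀ t ∈ Icc 0 L, ‖v t‖ < η) →
      |(∫ t in 0..L, θ (v t, z t) (w t, ζ t))
        - ∫ t in 0..L, (ζ t * axisLin θ δ L (z t) (v t) + 1 / 2 * (axisCurl θ δ L (z t) (v t) (w t)
          + ζ t * axisHess θ δ L (z t) (v t) (v t)))|
      ≤ ε * ∫ t in 0..L, (‖v t‖ * ‖w t‖ + ‖v t‖ ^ 2 * |ζ t|) := by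
  obtain ⟨η, hη, H⟩ := exists_form_expansion hδ hL hθ hε
  obtain ⟨s, hs1, hs, hs0, hsL⟩ := exists_primitive_Icc hL.le
    ((continuousOn_axis hδ.le hθ.continuousOn).clm_apply (continuousOn_const (c := vert)))
  rw [hint] at hsL
  obtain ⟨C, hC⟩ := exists_lipschitz_gauge hδ hL hθ hs1
  have hg : ∀ p, ∃ S' : E2 × ℝ →L[ℝ] ℝ, p ∈ cylinder δ L →
      HasFDerivWithinAt (gauge θ δ L s) S' (cylinder δ L) p ∧
      ∀ (w : E2) (ζ : ℝ), S' (w, ζ) = ζ * θ (0, p.2) vert + (θ (0, p.2) (horiz w)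
        + ζ * formD θ δ L (0, p.2) vert (horiz p.1))
        + 1 / 2 * (ζ * formDD θ δ L (0, p.2) vert (horiz p.1) (horiz p.1)
          + formD θ δ L (0, p.2) (horiz w) (horiz p.1)
          + formD θ δ L (0, p.2) (horiz p.1) (horiz w)) := by
    rintro ⟨v, z⟩
    by_cases hp : (v, z) ∈ cylinder δ L
    · obtain ⟨S', h⟩ := exists_hasFDerivWithinAt_gauge hδ hL hθ
        (hs z (mem_cylinder.mp hp).2) hp
      exact ⟨S', fun _ => h⟩
    · exact ⟨0, fun h => absurd h hp⟩
  choose S' hS' using hg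
  refine ⟨η, hη, fun v w z ζ h hv => ?_⟩
  have hp := (h.primitive hL.le).comp hL.le (fun x hx => (hS' x hx).1) hC h.mem
  -- the gauge function vanishes at both ends of the curve
  have hzero : ∫ t in 0..L, S' (v t, z t) (w t, ζ t) = 0 := by
    rw [hp.sub_left_eq_integral hL.le]
    have m0 := (mem_cylinder.mp (h.mem 0 ⟨le_rfl, hL.le⟩)).1
    have mL := (mem_cylinder.mp (h.mem L ⟨hL.le, le_rfl⟩)).1
    simp only [gauge, h.left, h.right, hs0, hsL]
    rw [formD_horiz_eq_zero hδ hθ ⟨le_rfl, hL.le⟩ hbot, formD_horiz_eq_zero hδ hθ ⟨hL.le, le_rfl⟩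
      htop, hbot 0 (by simpa using hδ.le), htop 0 (by simpa using hδ.le)]
    simp
  have i1 := h.intervalIntegrable_form hL.le hθ.continuousOn
  have i2 := ((h.intervalIntegrable_curl hL.le (continuousOn_axisCurl hδ hL hθ)).add
    (h.intervalIntegrable_hess hL.le (continuousOn_axisHess hδ hL hθ))).const_mul (1 / 2)
  have i3 := (h.intervalIntegrable_lin hL.le (continuousOn_axisLin hδ hL hθ)).add i2
  have e : (∫ t in 0..L, θ (v t, z t) (w t, ζ t)) - ∫ t in 0..L, (ζ t * axisLin θ δ L (z t) (v t)
      + 1 / 2 * (axisCurl θ δ L (z t) (v t) (w t) + ζ t * axisHess θ δ L (z t) (v t) (v t)))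
      = ∫ t in 0..L, (θ (v t, z t) (w t, ζ t) - S' (v t, z t) (w t, ζ t)
        - (ζ t * axisLin θ δ L (z t) (v t) + 1 / 2 * (axisCurl θ δ L (z t) (v t) (w t)
          + ζ t * axisHess θ δ L (z t) (v t) (v t)))) := by
    rw [intervalIntegral.integral_sub (i1.sub hp.integrable) i3,
      intervalIntegral.integral_sub i1 hp.integrable, hzero, sub_zero]
  rw [e, ← intervalIntegral.integral_const_mul, ← Real.norm_eq_abs]
  refine intervalIntegral.norm_integral_le_of_norm_le hL.le (Eventually.of_forall fun t ht => ?_)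
    ((h.intervalIntegrable_error hL.le).const_mul ε)
  have ht' := Ioc_subset_Icc_self ht
  rw [Real.norm_eq_abs, (hS' _ (h.mem t ht')).2]
  exact H _ _ (h.mem t ht') (hv t ht') _ _

end

/-! ### Local geometry of the boundary -/

section

section Boundary

variable {Ω : SmoothDomain} {x : E3} {ρ : E3 → ℝ}

theorem IsDefiningFunction.eventually_nonpos (h : IsDefiningFunction Ω.carrier x ρ) :
    ∀ᶠ y in 𝓝 x, y ∈ closure Ω.carrier → ρ y ≤ 0 := by
  filter_upwards [h.2.2.eventually_nhds] with y hy hyc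
  by_contra! hlt
  have h1 : ∀ᶠ u in 𝓝 y, u ∉ Ω.carrier := by
    filter_upwards [hy, (h.1.continuous.tendsto y).eventually (lt_mem_nhds hlt)] with u h1 h2 hu
    exact absurd (h1.mp hu) (not_lt.mpr (le_of_lt h2))
  obtain ⟨u, hu1, hu2⟩ := (mem_closure_iff_frequently.mp hyc).and_eventually h1 |>.exists
  exact hu2 hu1

theorem IsDefiningFunction.eventually_eq_zero (h : IsDefiningFunction Ω.carrier x ρ) :
    ∀ᶠ y in 𝓝 x, y ∈ frontier Ω.carrier → ρ y = 0 := by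
  filter_upwards [h.eventually_nonpos, h.2.2] with y h1 h2 hy
  refine le_antisymm (h1 (frontier_subset_closure hy)) (not_lt.mp fun hlt => ?_)
  exact frontier_disjoint_carrier hy (h2.mpr hlt)

theorem inner_gradient (φ : E3 → ℝ) (x ξ : E3) : ⟪gradient φ x, ξ⟫ = fderiv ℝ φ x ξ :=
  InnerProductSpace.toDual_symm_apply

/-- A smooth domain is the interior of its closure: otherwise a defining function would have a local
maximum at a boundary point. -/
theorem notMem_nhds_of_mem_frontier (hx : x ∈ frontier Ω.carrier) :
    closure Ω.carrier ∉ 𝓝 x := by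
  intro hn
  obtain ⟨ρ, hρ⟩ := Ω.smooth_boundary x hx
  have h0 : ρ x = 0 := hρ.eventually_eq_zero.self_of_nhds hx
  have hmax : IsLocalMax ρ x := by
    filter_upwards [hρ.eventually_nonpos, hn] with y h1 h2
    rw [h0]; exact h1 h2
  refine hρ.2.1 ?_
  rw [gradient, hmax.fderiv_eq_zero, map_zero]

theorem inner_eq_zero_of_cross {B n ξ : E3} (hn : n ≠ 0)
    (hc : crossProduct (WithLp.ofLp B) (WithLp.ofLp n) = 0) (h : ⟪n, ξ⟫ = 0) : ⟪B, ξ⟫ = 0 := by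
  rw [cross_apply] at hc
  have c0 := congrFun hc 0
  have c1 := congrFun hc 1
  have c2 := congrFun hc 2
  simp at c0 c1 c2
  have hnn : n 0 ^ 2 + n 1 ^ 2 + n 2 ^ 2 ≠ 0 := by
    have := EuclideanSpace.real_norm_sq_eq n
    rw [Fin.sum_univ_three] at this
    rw [← this]
    exact pow_ne_zero 2 (norm_ne_zero_iff.mpr hn)
  simp only [PiLp.inner_apply, Fin.sum_univ_three, RCLike.inner_apply, conj_trivial] at h ⊢
  refine (mul_eq_zero.mp ?_).resolve_left hnn
  linear_combination (B 0 * n 0 + B 1 * n 1 + B 2 * n 2) * h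
    + (ξ 1 * n 2 - ξ 2 * n 1) * c0 + (ξ 2 * n 0 - ξ 0 * n 2) * c1 + (ξ 0 * n 1 - ξ 1 * n 0) * c2

/-- At a boundary point, a field normal to the boundary is orthogonal to every `ξ` which is
annihilated by the differential of a defining function. -/
theorem inner_eq_zero_of_tangent {B : C(Ω.Closure, E3)} (hB : IsNormalOnBoundary Ω B)
    (hx : x ∈ frontier Ω.carrier) (hρ : IsDefiningFunction Ω.carrier x ρ) {ξ : E3}
    (hξ : fderiv ℝ ρ x ξ = 0) : ⟪toFun Ω B x, ξ⟫ = 0 := by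
  have hg := norm_pos_iff.mpr hρ.2.1
  rw [toFun_of_mem B (frontier_subset_closure hx)]
  refine inner_eq_zero_of_cross (n := ‖gradient ρ x‖⁻¹ • gradient ρ x)
    (smul_ne_zero (inv_pos.mpr hg).ne' hρ.2.1)
    (hB ⟨x, frontier_subset_closure hx⟩ _ ⟨hx, ρ, hρ, rfl⟩) ?_
  rw [real_inner_smul_left, inner_gradient, hξ, mul_zero]

end Boundary

/-! ### Tube coordinates -/

/-- The differential of the tube coordinates. -/
noncomputable def tubeD (Φ : E2 × ℝ → E3) (δ L : ℝ) (p : E2 × ℝ) : E2 × ℝ →L[ℝ] E3 :=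
  fderivWithin ℝ Φ (cylinder δ L) p

namespace IsTubeCoordinates

variable {Ω : SmoothDomain} {γ : ℝ → E3} {L δ : ℝ} {Φ : E2 × ℝ → E3}

theorem hasFDerivWithinAt (h : IsTubeCoordinates Ω γ L δ Φ) {p : E2 × ℝ}
    (hp : p ∈ cylinder δ L) : HasFDerivWithinAt Φ (tubeD Φ δ L p) (cylinder δ L) p :=
  ((h.smooth.differentiableOn (by simp)) p hp).hasFDerivWithinAt

theorem contDiffOn_tubeD (h : IsTubeCoordinates Ω γ L δ Φ) (hL : 0 < L) :
    ContDiffOn ℝ 2 (tubeD Φ δ L) (cylinder δ L) :=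
  (contDiffOn_infty.mp h.smooth 3).fderivWithin
    (uniqueDiffOn_cylinder h.radius_pos hL) (by norm_num)

theorem exists_lipschitz (h : IsTubeCoordinates Ω γ L δ Φ) :
    ∃ C : ℝ≥0, LipschitzOnWith C Φ (cylinder δ L) :=
  h.smooth.exists_lipschitzOnWith (by simp) (convex_cylinder δ L) (isCompact_cylinder δ L)

/-- By compactness, the differential of the tube coordinates is uniformly injective. -/
theorem exists_tubeD_lower_bound (h : IsTubeCoordinates Ω γ L δ Φ) (hL : 0 < L) :
    ∃ κ > 0, ∀ p ∈ cylinder δ L, ∀ ξ, κ * ‖ξ‖ ≤ ‖tubeD Φ δ L p ξ‖ := by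
  have hK : IsCompact (cylinder δ L ×ˢ Metric.sphere (0 : E2 × ℝ) 1) :=
    (isCompact_cylinder δ L).prod (isCompact_sphere 0 1)
  have hne : (cylinder δ L ×ˢ Metric.sphere (0 : E2 × ℝ) 1).Nonempty :=
    ⟨((0, 0), vert), axis_mem_cylinder h.radius_pos.le ⟨le_rfl, hL.le⟩, by simp [Prod.norm_def]⟩
  have hc : ContinuousOn (fun q : (E2 × ℝ) × (E2 × ℝ) => ‖tubeD Φ δ L q.1 q.2‖)
      (cylinder δ L ×ˢ Metric.sphere (0 : E2 × ℝ) 1) :=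
    (((h.contDiffOn_tubeD hL).continuousOn.comp continuousOn_fst fun q hq => hq.1).clm_apply
      continuousOn_snd).norm
  obtain ⟨q, hq, hmin⟩ := hK.exists_isMinOn hne hc
  refine ⟨‖tubeD Φ δ L q.1 q.2‖, norm_pos_iff.mpr fun h0 => ?_, fun p hp ξ => ?_⟩
  · have h1 := h.immersion q.1 hq.1 (h0.trans (map_zero (tubeD Φ δ L q.1)).symm)
    have h2 := hq.2
    rw [h1] at h2
    simp at h2
  · rcases eq_or_ne ξ 0 with rfl | hξ
    · simp
    · have hpos := norm_pos_iff.mpr hξ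
      have h1 := hmin (a := (p, ‖ξ‖⁻¹ • ξ)) ⟨hp, by simp [norm_smul, hpos.ne']⟩
      simp only [mem_ofPred_eq, map_smul, norm_smul, norm_inv, norm_norm] at h1
      rwa [← div_eq_inv_mul, le_div_iff₀ hpos] at h1

/-- The inverse of tube coordinates is Lipschitz: nearby points are separated by the differential,
and distant ones by injectivity and compactness. -/
theorem exists_expansion (h : IsTubeCoordinates Ω γ L δ Φ) (hL : 0 < L) :
    ∃ κ > 0, ∀ p ∈ cylinder δ L, ∀ q ∈ cylinder δ L, κ * ‖p - q‖ ≤ ‖Φ p - Φ q‖ := by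
  obtain ⟨κ, hκ, hlow⟩ := h.exists_tubeD_lower_bound hL
  obtain ⟨η, hη, H⟩ := exists_taylor_one (isCompact_cylinder δ L) (convex_cylinder δ L)
    (fun x hx => h.hasFDerivWithinAt hx) (h.contDiffOn_tubeD hL).continuousOn (half_pos hκ)
  let S : Set ((E2 × ℝ) × (E2 × ℝ)) :=
    (cylinder δ L ×ˢ cylinder δ L) ∩ {q | η ≤ ‖q.1 - q.2‖}
  have hS : IsCompact S := ((isCompact_cylinder δ L).prod (isCompact_cylinder δ L)).inter_right
    (isClosed_le continuous_const (by fun_prop))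
  have hc : ContinuousOn (fun q : (E2 × ℝ) × (E2 × ℝ) => ‖Φ q.1 - Φ q.2‖ / ‖q.1 - q.2‖) S := by
    refine ContinuousOn.div ?_ (by fun_prop) fun q hq => (hη.trans_le hq.2).ne'
    exact ((h.smooth.continuousOn.comp continuousOn_fst fun q hq => hq.1.1).sub
      (h.smooth.continuousOn.comp continuousOn_snd fun q hq => hq.1.2)).norm
  have hnear : ∀ p ∈ cylinder δ L, ∀ q ∈ cylinder δ L, ‖p - q‖ < η →
      κ / 2 * ‖p - q‖ ≤ ‖Φ p - Φ q‖ := by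
    intro p hp q hq hpq
    have h1 := H p hp q hq hpq
    have h2 := hlow q hq (p - q)
    have h3 := norm_sub_norm_le (tubeD Φ δ L q (p - q)) (Φ p - Φ q)
    rw [norm_sub_rev (tubeD Φ δ L q (p - q)) (Φ p - Φ q)] at h3
    linarith
  rcases S.eq_empty_or_nonempty with hem | hne
  · refine ⟨κ / 2, half_pos hκ, fun p hp q hq => hnear p hp q hq ?_⟩
    by_contra! hle
    have : (p, q) ∈ S := ⟨⟨hp, hq⟩, hle⟩
    rw [hem] at this
    exact this
  · obtain ⟨m, hm, hmin⟩ := hS.exists_isMinOn hne hc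
    have hmpos : 0 < ‖Φ m.1 - Φ m.2‖ / ‖m.1 - m.2‖ := by
      have h1 : 0 < ‖m.1 - m.2‖ := hη.trans_le hm.2
      refine div_pos (norm_pos_iff.mpr (sub_ne_zero.mpr fun he => ?_)) h1
      rw [h.injOn hm.1.1 hm.1.2 he] at h1
      simp at h1
    refine ⟨min (κ / 2) (‖Φ m.1 - Φ m.2‖ / ‖m.1 - m.2‖), lt_min (half_pos hκ) hmpos,
      fun p hp q hq => ?_⟩
    rcases lt_or_ge ‖p - q‖ η with hlt | hge
    · refine le_trans ?_ (hnear p hp q hq hlt)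
      gcongr
      exact min_le_left _ _
    · have h1 : ‖Φ m.1 - Φ m.2‖ / ‖m.1 - m.2‖ ≤ ‖Φ p - Φ q‖ / ‖p - q‖ :=
        hmin (a := (p, q)) ⟨⟨hp, hq⟩, hge⟩
      rw [le_div_iff₀ (hη.trans_le hge)] at h1
      refine le_trans ?_ h1
      gcongr
      exact min_le_right _ _

/-- The axis is parametrized by arclength. -/
theorem norm_tubeD_axis (h : IsTubeCoordinates Ω γ L δ Φ) (hγ : IsSmoothSimpleArc Ω γ L) {z : ℝ}
    (hz : z ∈ Icc 0 L) : ‖tubeD Φ δ L (0, z) vert‖ = 1 := by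
  have h1 : HasDerivWithinAt (fun z : ℝ => ((0 : E2), z)) vert (Icc 0 L) z :=
    ((hasDerivAt_const z (0 : E2)).prodMk (hasDerivAt_id z)).hasDerivWithinAt
  have h2 := (h.hasFDerivWithinAt (axis_mem_cylinder h.radius_pos.le hz)).comp_hasDerivWithinAt z
    h1 (fun z hz => axis_mem_cylinder h.radius_pos.le hz)
  have h3 : HasDerivWithinAt γ (tubeD Φ δ L (0, z) vert) (Icc 0 L) z :=
    h2.congr (fun y hy => (h.axis y hy).symm) (h.axis z hz).symm
  rw [← h3.derivWithin (uniqueDiffOn_Icc hγ.length_pos z hz)]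
  exact hγ.arclength z hz

/-- Pythagoras' theorem, as the vertical direction is orthogonal to the horizontal ones. -/
theorem norm_tubeD_sq (h : IsTubeCoordinates Ω γ L δ Φ) {p : E2 × ℝ} (hp : p ∈ cylinder δ L)
    (w : E2) (ζ : ℝ) : ‖tubeD Φ δ L p (w, ζ)‖ ^ 2
      = ‖tubeD Φ δ L p (horiz w)‖ ^ 2 + (‖tubeD Φ δ L p vert‖ * ζ) ^ 2 := by
  have h0 : ⟪tubeD Φ δ L p (horiz w), tubeD Φ δ L p vert⟫ = 0 := h.orthogonal p hp w
  rw [pair_eq, map_add, map_smul, norm_add_sq_real, real_inner_smul_right, h0, norm_smul,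
    Real.norm_eq_abs, mul_pow, sq_abs]
  ring

/-- A field normal to `∂Ω` has no horizontal component on a basis of the tube. -/
theorem inner_tubeD_horiz (h : IsTubeCoordinates Ω γ L δ Φ) {B : C(Ω.Closure, E3)}
    (hB : IsNormalOnBoundary Ω B) {z : ℝ} (hz : z ∈ Icc 0 L)
    (hbase : ∀ v ∈ Metric.closedBall (0 : E2) δ, Φ (v, z) ∈ frontier Ω.carrier) {v : E2}
    (hv : ‖v‖ < δ) (w : E2) : ⟪toFun Ω B (Φ (v, z)), tubeD Φ δ L (v, z) (horiz w)⟫ = 0 := by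
  have hx := hbase v (by simpa using hv.le)
  obtain ⟨ρ, hρ⟩ := Ω.smooth_boundary _ hx
  refine inner_eq_zero_of_tangent hB hx hρ ?_
  have h1 : HasDerivAt (fun τ : ℝ => ((v + τ • w, z) : E2 × ℝ)) (horiz w) 0 := by
    have := (((hasDerivAt_id (0 : ℝ)).smul_const w).const_add v).prodMk (hasDerivAt_const (0 : ℝ) z)
    simpa using this
  have hev : ∀ᶠ τ : ℝ in 𝓝 0, ‖v + τ • w‖ ≤ δ := by
    have hc : Continuous fun τ : ℝ => ‖v + τ • w‖ := by fun_prop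
    have := hc.tendsto 0
    simp only [zero_smul, add_zero] at this
    exact this.eventually (eventually_le_nhds hv)
  have h2 : HasFDerivWithinAt Φ (tubeD Φ δ L (v, z)) (cylinder δ L) (v + (0 : ℝ) • w, z) := by
    rw [zero_smul, add_zero]; exact h.hasFDerivWithinAt (mem_cylinder.mpr ⟨hv.le, hz⟩)
  have h3 : HasDerivAt (fun τ : ℝ => Φ (v + τ • w, z)) (tubeD Φ δ L (v, z) (horiz w)) 0 :=
    h2.comp_hasDerivAt 0 h1 (hev.mono fun τ h => mem_cylinder.mpr ⟨h, hz⟩)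
  have h4 : HasFDerivAt ρ (fderiv ℝ ρ (Φ (v, z))) (Φ (v + (0 : ℝ) • w, z)) := by
    rw [zero_smul, add_zero]; exact ((hρ.1.differentiable (by simp)) _).hasFDerivAt
  have h5 : HasDerivAt (fun τ : ℝ => ρ (Φ (v + τ • w, z)))
      (fderiv ℝ ρ (Φ (v, z)) (tubeD Φ δ L (v, z) (horiz w))) 0 := h4.comp_hasDerivAt 0 h3
  have h6 : HasDerivAt (fun _ : ℝ => (0 : ℝ))
      (fderiv ℝ ρ (Φ (v, z)) (tubeD Φ δ L (v, z) (horiz w))) 0 := by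
    refine h5.congr_of_eventuallyEq ?_
    have hc := h3.continuousAt.tendsto
    simp only [zero_smul, add_zero] at hc
    filter_upwards [hev, hc.eventually hρ.eventually_eq_zero] with τ h1 h2
    exact (h2 (hbase _ (by simpa using h1))).symm
  exact h6.unique (hasDerivAt_const _ _)

/-- Inside the tube, the boundary of `Ω` is reduced to the two bases: the image of an interior point
of the cylinder is interior to `Ω̄`, by the inverse function theorem. -/
theorem eq_zero_or_eq_of_mem_frontier (h : IsTubeCoordinates Ω γ L δ Φ) {v : E2} {z : ℝ}
    (hv : ‖v‖ < δ) (hz : z ∈ Icc 0 L) (hx : Φ (v, z) ∈ frontier Ω.carrier) : z = 0 ∨ z = L := by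
  by_contra! hne
  have hzI : z ∈ Ioo 0 L := ⟨lt_of_le_of_ne hz.1 (Ne.symm hne.1), lt_of_le_of_ne hz.2 hne.2⟩
  have hnhds : cylinder δ L ∈ 𝓝 ((v, z) : E2 × ℝ) := by
    refine prod_mem_nhds ?_ (Icc_mem_nhds hzI.1 hzI.2)
    exact Filter.mem_of_superset (Metric.isOpen_ball.mem_nhds (by simpa using hv))
      Metric.ball_subset_closedBall
  have hcd : ContDiffAt ℝ ∞ Φ (v, z) := h.smooth.contDiffAt hnhds
  have hstrict := hcd.hasStrictFDerivAt (by simp)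
  have hinj : Function.Injective (fderiv ℝ Φ (v, z)) := by
    rw [← fderivWithin_of_mem_nhds hnhds]
    exact h.immersion _ (mem_cylinder.mpr ⟨hv.le, hz⟩)
  have hfr : Module.finrank ℝ (E2 × ℝ) = Module.finrank ℝ E3 := by simp
  have hsurj : Function.Surjective (fderiv ℝ Φ (v, z)) :=
    (LinearMap.injective_iff_surjective_of_finrank_eq_finrank
      (f := (fderiv ℝ Φ (v, z)).toLinearMap) hfr).mp hinj
  have hmap := hstrict.map_nhds_eq_of_surj (LinearMap.range_eq_top.mpr hsurj)
  refine notMem_nhds_of_mem_frontier hx ?_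
  rw [← hmap]
  exact Filter.mem_of_superset (image_mem_map hnhds) (image_subset_iff.mpr h.mapsTo)

end IsTubeCoordinates

end

/-! ### Curves in a tube -/

section

section

variable {Ω : SmoothDomain} {γ : ℝ → E3} {L δ : ℝ} {Φ : E2 × ℝ → E3}

theorem IsPrimitiveOn.congr_left {E : Type*} [NormedAddCommGroup E] [NormedSpace ℝ E]
    {p q p' : ℝ → E} {a b : ℝ} (h : IsPrimitiveOn p p' a b) (hab : a ≤ b)
    (he : EqOn q p (Icc a b)) : IsPrimitiveOn q p' a b :=
  ⟨h.integrable, fun t ht => by rw [he ht, he (left_mem_Icc.mpr hab)]; exact h.eq t ht⟩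

theorem cylinder_mono {δ' : ℝ} (h : δ' ≤ δ) : cylinder δ' L ⊆ cylinder δ L :=
  prod_mono (Metric.closedBall_subset_closedBall h) le_rfl

theorem IsTubeCurve.mono {δ' : ℝ} {v w : ℝ → E2} {z ζ : ℝ → ℝ} (h : IsTubeCurve δ' L v w z ζ)
    (hδ : δ' ≤ δ) : IsTubeCurve δ L v w z ζ :=
  ⟨h.sobolev, h.vertical, fun t ht => cylinder_mono hδ (h.mem t ht), h.left, h.right⟩

theorem isPrimitiveOn_id (L : ℝ) : IsPrimitiveOn (fun t : ℝ => t) (fun _ => (1 : ℝ)) 0 L :=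
  ⟨intervalIntegrable_const, fun t _ => by simp⟩

/-- Graphs over the axis are tube curves. -/
theorem isTubeCurve_graph {u w : ℝ → E2} (h : IsSobolev L u w) (hu : ∀ t ∈ Icc 0 L, ‖u t‖ ≤ δ) :
    IsTubeCurve δ L u w (fun t => t) (fun _ => 1) :=
  ⟨h, isPrimitiveOn_id L, fun t ht => mem_cylinder.mpr ⟨hu t ht, ht⟩, rfl, rfl⟩

namespace IsTubeCoordinates

theorem curve (h : IsTubeCoordinates Ω γ L δ Φ) (hL : 0 ≤ L) {v w : ℝ → E2} {z ζ : ℝ → ℝ}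
    (hc : IsTubeCurve δ L v w z ζ) :
    IsPrimitiveOn (fun t => Φ (v t, z t)) (fun t => tubeD Φ δ L (v t, z t) (w t, ζ t)) 0 L := by
  obtain ⟨C, hC⟩ := h.exists_lipschitz
  exact (hc.primitive hL).comp hL (fun x hx => h.hasFDerivWithinAt hx) hC hc.mem

theorem mapsTo_curve (h : IsTubeCoordinates Ω γ L δ Φ) {v w : ℝ → E2} {z ζ : ℝ → ℝ}
    (hc : IsTubeCurve δ L v w z ζ) :
    MapsTo (fun t => Φ (v t, z t)) (Icc 0 L) (closure Ω.carrier) :=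
  fun t ht => h.mapsTo (hc.mem t ht)

theorem curve_mem_normalCurrents (h : IsTubeCoordinates Ω γ L δ Φ) (hL : 0 ≤ L) {v w : ℝ → E2}
    {z ζ : ℝ → ℝ} (hc : IsTubeCurve δ L v w z ζ) :
    curveCurrent Ω (fun t => Φ (v t, z t)) 0 L ∈ normalCurrents Ω := by
  refine curveCurrent_mem_normalCurrents (h.curve hL hc) hL (h.mapsTo_curve hc) (Or.inl ⟨?_, ?_⟩)
  · have h0 := (mem_cylinder.mp (hc.mem 0 ⟨le_rfl, hL⟩)).1
    change Φ (v 0, z 0) ∈ _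
    rw [hc.left]
    exact h.bottom _ (by simpa using h0)
  · have h0 := (mem_cylinder.mp (hc.mem L ⟨hL, le_rfl⟩)).1
    change Φ (v L, z L) ∈ _
    rw [hc.right]
    exact h.top _ (by simpa using h0)

/-- The axis, with its velocity. -/
theorem axis_primitive (h : IsTubeCoordinates Ω γ L δ Φ) (hL : 0 ≤ L) :
    IsPrimitiveOn γ (fun z => tubeD Φ δ L (0, z) vert) 0 L := by
  have hs : IsSobolev L (fun _ => (0 : E2)) (fun _ => 0) :=
    ⟨MemLp.zero', ⟨intervalIntegrable_const, fun t _ => by simp⟩⟩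
  exact (h.curve hL (isTubeCurve_graph hs fun t _ => by simpa using h.radius_pos.le)).congr_left hL
    fun z hz => (h.axis z hz).symm

theorem norm_axis_current (h : IsTubeCoordinates Ω γ L δ Φ) (hγ : IsSmoothSimpleArc Ω γ L) :
    ‖curveCurrent Ω γ 0 L‖ = L := by
  have hL := hγ.length_pos.le
  rw [norm_curveCurrent_of_injOn (h.axis_primitive hL) hL hγ.mapsTo hγ.simple,
    intervalIntegral.integral_congr (g := fun _ => (1 : ℝ)) fun z hz => ?_]
  · simp
  · rw [uIcc_of_le hL] at hz
    exact h.norm_tubeD_axis hγ hz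

/-- A tube around the axis lies in a given neighborhood. -/
theorem exists_radius (h : IsTubeCoordinates Ω γ L δ Φ) {U : Set E3} (hU : IsOpen U)
    (hγU : γ '' Icc 0 L ⊆ U) :
    ∃ δ' > 0, δ' < δ ∧ MapsTo Φ (cylinder δ' L) U := by
  obtain ⟨C, hC⟩ := h.exists_lipschitz
  have hK : IsCompact (γ '' Icc 0 L) := by
    have : γ '' Icc 0 L = (fun z => Φ (0, z)) '' Icc 0 L :=
      image_congr fun z hz => (h.axis z hz).symm
    rw [this]
    exact isCompact_Icc.image_of_continuousOn
      (continuousOn_axis h.radius_pos.le h.smooth.continuousOn)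
  obtain ⟨ε, hε, hthick⟩ := hK.exists_thickening_subset_open hU hγU
  have hC1 : (0 : ℝ) < C + 1 := add_pos_of_nonneg_of_pos C.coe_nonneg one_pos
  refine ⟨min (δ / 2) (ε / (2 * (C + 1))), lt_min (half_pos h.radius_pos) (by positivity),
    (min_le_left _ _).trans_lt (half_lt_self h.radius_pos), fun p hp => hthick ?_⟩
  obtain ⟨v, z⟩ := p
  obtain ⟨hv, hz⟩ := mem_cylinder.mp hp
  rw [Metric.mem_thickening_iff]
  refine ⟨γ z, mem_image_of_mem γ hz, ?_⟩
  rw [← h.axis z hz]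
  have hvδ : ‖v‖ ≤ δ := hv.trans ((min_le_left _ _).trans (half_le_self h.radius_pos.le))
  have h1 := hC.dist_le_mul (v, z) (mem_cylinder.mpr ⟨hvδ, hz⟩) (0, z)
    (axis_mem_cylinder h.radius_pos.le hz)
  have h2 : dist ((v, z) : E2 × ℝ) (0, z) = ‖v‖ := by
    rw [dist_eq_norm, Prod.mk_sub_mk, sub_self, sub_zero]; simp [Prod.norm_def]
  rw [h2] at h1
  have h3 : (C : ℝ) * ‖v‖ ≤ (C + 1) * (ε / (2 * (C + 1))) :=
    mul_le_mul (by linarith) (hv.trans (min_le_right _ _)) (norm_nonneg _) hC1.le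
  have h4 : ((C : ℝ) + 1) * (ε / (2 * (C + 1))) = ε / 2 := by field_simp
  linarith

end IsTubeCoordinates

/-! ### The form measuring the deficit of a curve -/

/-- The pull-back of the field `B` to the tube, a `1`-form. -/
noncomputable def fieldForm (Ω : SmoothDomain) (B : C(Ω.Closure, E3)) (Φ : E2 × ℝ → E3) (δ L : ℝ)
    (p : E2 × ℝ) : E2 × ℝ →L[ℝ] ℝ :=
  (innerSL ℝ (toFun Ω B (Φ p))).comp (tubeD Φ δ L p)

theorem fieldForm_apply (B : C(Ω.Closure, E3)) (p ξ : E2 × ℝ) :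
    fieldForm Ω B Φ δ L p ξ = ⟪toFun Ω B (Φ p), tubeD Φ δ L p ξ⟫ := rfl

/-- The form `m |∂_z Φ| dz - B`, where `B` is pulled back to the tube: its integral over a curve is
the deficit `m |Γ| - ⟨B, Γ⟩`, except that the length of `Γ` is replaced by that of its vertical
component. -/
noncomputable def deficitForm (Ω : SmoothDomain) (B : C(Ω.Closure, E3)) (Φ : E2 × ℝ → E3)
    (δ L m : ℝ) (p : E2 × ℝ) : E2 × ℝ →L[ℝ] ℝ :=
  (m * ‖tubeD Φ δ L p vert‖) • ContinuousLinearMap.snd ℝ E2 ℝ - fieldForm Ω B Φ δ L p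

theorem deficitForm_apply (B : C(Ω.Closure, E3)) (m : ℝ) (p : E2 × ℝ) (w : E2) (ζ : ℝ) :
    deficitForm Ω B Φ δ L m p (w, ζ)
      = m * ‖tubeD Φ δ L p vert‖ * ζ - ⟪toFun Ω B (Φ p), tubeD Φ δ L p (w, ζ)⟫ := rfl

theorem IsTubeCoordinates.curveCurrent_apply (h : IsTubeCoordinates Ω γ L δ Φ) (hL : 0 ≤ L)
    {v w : ℝ → E2} {z ζ : ℝ → ℝ} (hc : IsTubeCurve δ L v w z ζ) (B : C(Ω.Closure, E3)) :
    curveCurrent Ω (fun t => Φ (v t, z t)) 0 L B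
      = ∫ t in 0..L, fieldForm Ω B Φ δ L (v t, z t) (w t, ζ t) :=
  Isoflux.curveCurrent_apply (h.curve hL hc) hL (h.mapsTo_curve hc) B

/-- A tube around an arc `γ` of length `L` such that `⟨B, γ⟩ = m L`, together with a smaller radius
`δ'` for which the form `deficitForm` is of class `C²`. -/
structure IsDeficitTube (Ω : SmoothDomain) (B : C(Ω.Closure, E3)) (γ : ℝ → E3) (L δ δ' m : ℝ)
    (Φ : E2 × ℝ → E3) : Prop where
  arc : IsSmoothSimpleArc Ω γ L
  coords : IsTubeCoordinates Ω γ L δ Φ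
  normal : IsNormalOnBoundary Ω B
  radius_pos : 0 < δ'
  radius_lt : δ' < δ
  value : curveCurrent Ω γ 0 L B = m * L
  contDiffOn : ContDiffOn ℝ 2 (deficitForm Ω B Φ δ L m) (cylinder δ' L)

theorem IsTubeCoordinates.exists_isDeficitTube (h : IsTubeCoordinates Ω γ L δ Φ)
    (hγ : IsSmoothSimpleArc Ω γ L) {B : C(Ω.Closure, E3)} (hB : IsNormalOnBoundary Ω B)
    (hreg : IsC2Near Ω B γ L) {m : ℝ} (hm : curveCurrent Ω γ 0 L B = m * L) :
    ∃ δ', IsDeficitTube Ω B γ L δ δ' m Φ := by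
  obtain ⟨U, hU, hγU, hBU⟩ := hreg
  obtain ⟨δ', hδ', hlt, hmaps⟩ := h.exists_radius hU hγU
  have hsub : cylinder δ' L ⊆ cylinder δ L := cylinder_mono hlt.le
  have hD : ContDiffOn ℝ 2 (tubeD Φ δ L) (cylinder δ' L) :=
    (h.contDiffOn_tubeD hγ.length_pos).mono hsub
  obtain ⟨κ, hκ, hlow⟩ := h.exists_tubeD_lower_bound hγ.length_pos
  have hDv : ContDiffOn ℝ 2 (fun p => ‖tubeD Φ δ L p vert‖) (cylinder δ' L) := by
    refine ContDiffOn.norm ℝ (hD.clm_apply contDiffOn_const) fun p hp => ?_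
    have h1 := hlow p (hsub hp) vert
    have h2 : ‖vert‖ = 1 := by simp [Prod.norm_def]
    rw [h2, mul_one] at h1
    exact norm_pos_iff.mp (hκ.trans_le h1)
  have hBΦ : ContDiffOn ℝ 2 (fun p => toFun Ω B (Φ p)) (cylinder δ' L) :=
    hBU.comp ((contDiffOn_infty.mp h.smooth 2).mono hsub)
      fun p hp => ⟨hmaps hp, h.mapsTo (hsub hp)⟩
  exact ⟨δ', hγ, h, hB, hδ', hlt, hm, ((contDiffOn_const.mul hDv).smul contDiffOn_const).sub
    (((innerSL ℝ).contDiff.comp_contDiffOn hBΦ).clm_comp hD)⟩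

namespace IsDeficitTube

variable {B : C(Ω.Closure, E3)} {δ' m : ℝ}

theorem horiz_bottom (h : IsDeficitTube Ω B γ L δ δ' m Φ) (v : E2) (hv : ‖v‖ ≤ δ') (w : E2) :
    deficitForm Ω B Φ δ L m (v, 0) (horiz w) = 0 := by
  have := h.coords.inner_tubeD_horiz h.normal ⟨le_rfl, h.arc.length_pos.le⟩ h.coords.bottom
    (hv.trans_lt h.radius_lt) w
  change m * ‖tubeD Φ δ L (v, 0) vert‖ * 0
    - ⟪toFun Ω B (Φ (v, 0)), tubeD Φ δ L (v, 0) (horiz w)⟫ = 0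
  rw [this]; ring

theorem horiz_top (h : IsDeficitTube Ω B γ L δ δ' m Φ) (v : E2) (hv : ‖v‖ ≤ δ') (w : E2) :
    deficitForm Ω B Φ δ L m (v, L) (horiz w) = 0 := by
  have := h.coords.inner_tubeD_horiz h.normal ⟨h.arc.length_pos.le, le_rfl⟩ h.coords.top
    (hv.trans_lt h.radius_lt) w
  change m * ‖tubeD Φ δ L (v, L) vert‖ * 0
    - ⟪toFun Ω B (Φ (v, L)), tubeD Φ δ L (v, L) (horiz w)⟫ = 0
  rw [this]; ring

theorem integral_axis (h : IsDeficitTube Ω B γ L δ δ' m Φ) :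
    ∫ z in 0..L, deficitForm Ω B Φ δ L m (0, z) vert = 0 := by
  have hL := h.arc.length_pos.le
  have hp := h.coords.axis_primitive hL
  have h1 : EqOn (fun z => deficitForm Ω B Φ δ L m (0, z) vert)
      (fun z => m - ⟪toFun Ω B (γ z), tubeD Φ δ L (0, z) vert⟫) (uIcc 0 L) := fun z hz => by
    rw [uIcc_of_le hL] at hz
    change m * ‖tubeD Φ δ L (0, z) vert‖ * 1
      - ⟪toFun Ω B (Φ (0, z)), tubeD Φ δ L (0, z) vert⟫ = _
    rw [h.coords.norm_tubeD_axis h.arc hz, h.coords.axis z hz]; ring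
  rw [intervalIntegral.integral_congr h1, intervalIntegral.integral_sub intervalIntegrable_const
    (hp.intervalIntegrable_inner hL h.arc.mapsTo B), ← Isoflux.curveCurrent_apply hp hL
    h.arc.mapsTo B, h.value]
  simp [mul_comm]

theorem exists_expansion (h : IsDeficitTube Ω B γ L δ δ' m Φ) {ε : ℝ} (hε : 0 < ε) :
    ∃ η > 0, ∀ v w z ζ, IsTubeCurve δ' L v w z ζ → (∀ t ∈ Icc 0 L, ‖v t‖ < η) →
      |(∫ t in 0..L, deficitForm Ω B Φ δ L m (v t, z t) (w t, ζ t))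
        - ∫ t in 0..L, (ζ t * axisLin (deficitForm Ω B Φ δ L m) δ' L (z t) (v t)
          + 1 / 2 * (axisCurl (deficitForm Ω B Φ δ L m) δ' L (z t) (v t) (w t)
          + ζ t * axisHess (deficitForm Ω B Φ δ L m) δ' L (z t) (v t) (v t)))|
      ≤ ε * ∫ t in 0..L, (‖v t‖ * ‖w t‖ + ‖v t‖ ^ 2 * |ζ t|) :=
  exists_integral_form_expansion h.radius_pos h.arc.length_pos h.contDiffOn h.horiz_bottom
    h.horiz_top h.integral_axis hε

/-- The deficit of a tube curve, in terms of `deficitForm`. -/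
theorem deficit_eq (h : IsDeficitTube Ω B γ L δ δ' m Φ) {v w : ℝ → E2} {z ζ : ℝ → ℝ}
    (hc : IsTubeCurve δ' L v w z ζ) :
    m * (∫ t in 0..L, ‖tubeD Φ δ L (v t, z t) (w t, ζ t)‖)
      - curveCurrent Ω (fun t => Φ (v t, z t)) 0 L B
    = m * (∫ t in 0..L, (‖tubeD Φ δ L (v t, z t) (w t, ζ t)‖
        - ‖tubeD Φ δ L (v t, z t) vert‖ * ζ t))
      + ∫ t in 0..L, deficitForm Ω B Φ δ L m (v t, z t) (w t, ζ t) := by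
  have hL := h.arc.length_pos.le
  have hc' := hc.mono h.radius_lt.le
  have hp := h.coords.curve hL hc'
  have hi1 : IntervalIntegrable (fun t => ‖tubeD Φ δ L (v t, z t) vert‖ * ζ t) volume 0 L :=
    intervalIntegrable_mul_of_continuousOn hL
      ((((h.coords.contDiffOn_tubeD h.arc.length_pos).continuousOn.comp (hc'.continuousOn hL)
        hc'.mem).clm_apply continuousOn_const).norm) hc.vertical.integrable
  rw [h.coords.curveCurrent_apply hL hc' B, intervalIntegral.integral_sub hp.integrable.norm hi1]
  have h2 : (fun t => deficitForm Ω B Φ δ L m (v t, z t) (w t, ζ t)) = fun t =>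
      m * (‖tubeD Φ δ L (v t, z t) vert‖ * ζ t) - fieldForm Ω B Φ δ L (v t, z t) (w t, ζ t) := by
    funext t
    rw [deficitForm_apply, fieldForm_apply]; ring
  have hi2 : IntervalIntegrable (fun t => fieldForm Ω B Φ δ L (v t, z t) (w t, ζ t)) volume 0 L :=
    hp.intervalIntegrable_inner hL (h.coords.mapsTo_curve hc') B
  rw [h2, intervalIntegral.integral_sub (hi1.const_mul m) hi2, intervalIntegral.integral_const_mul]
  ring

end IsDeficitTube

end

end

/-! ### The second variation -/

section

section

variable {Ω : SmoothDomain} {γ : ℝ → E3} {L δ : ℝ} {Φ : E2 × ℝ → E3}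

/-- The quadratic form `w ↦ |D_w Φ|² / |∂_z Φ|` on horizontal vectors: half of it is the second
order increase of the length of a curve when the vector `w` is added to its velocity `∂_z`. -/
noncomputable def transForm (Φ : E2 × ℝ → E3) (δ L : ℝ) (p : E2 × ℝ) : E2 →L[ℝ] E2 →L[ℝ] ℝ :=
  ‖tubeD Φ δ L p vert‖⁻¹ • (((innerSL ℝ : E3 →L[ℝ] E3 →L[ℝ] ℝ).comp
    ((tubeD Φ δ L p).comp horiz)).flip.comp ((tubeD Φ δ L p).comp horiz)).flip

theorem transForm_apply (p : E2 × ℝ) (w : E2) :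
    transForm Φ δ L p w w = ‖tubeD Φ δ L p (horiz w)‖ ^ 2 / ‖tubeD Φ δ L p vert‖ := by
  rw [div_eq_inv_mul, ← real_inner_self_eq_norm_sq]; rfl

theorem exists_uniform_axis (hδ : 0 ≤ δ) {F : Type*} [NormedAddCommGroup F] {f : E2 × ℝ → F}
    (hf : ContinuousOn f (cylinder δ L)) {ε : ℝ} (hε : 0 < ε) :
    ∃ η > 0, ∀ v z, (v, z) ∈ cylinder δ L → ‖v‖ < η → ‖f (v, z) - f (0, z)‖ ≤ ε := by
  obtain ⟨η, hη, h⟩ := Metric.uniformContinuousOn_iff.mp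
    ((isCompact_cylinder δ L).uniformContinuousOn_of_continuous hf) ε hε
  refine ⟨η, hη, fun v z hp hv => ?_⟩
  rw [← dist_eq_norm]
  refine (h _ hp _ (axis_mem_cylinder hδ (mem_cylinder.mp hp).2) ?_).le
  rw [dist_eq_norm, Prod.mk_sub_mk, sub_self, sub_zero]
  simpa [Prod.norm_def] using hv

namespace IsTubeCoordinates

theorem tubeD_vert_pos (h : IsTubeCoordinates Ω γ L δ Φ) {p : E2 × ℝ}
    (hp : p ∈ cylinder δ L) : 0 < ‖tubeD Φ δ L p vert‖ := by
  refine norm_pos_iff.mpr fun h0 => ?_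
  have := h.immersion p hp (h0.trans (map_zero (tubeD Φ δ L p)).symm)
  simp at this

theorem continuousOn_tubeD_vert (h : IsTubeCoordinates Ω γ L δ Φ) (hL : 0 < L) :
    ContinuousOn (fun p => ‖tubeD Φ δ L p vert‖) (cylinder δ L) :=
  ((h.contDiffOn_tubeD hL).continuousOn.clm_apply continuousOn_const).norm

theorem continuousOn_transForm (h : IsTubeCoordinates Ω γ L δ Φ) (hL : 0 < L) :
    ContinuousOn (transForm Φ δ L) (cylinder δ L) := by
  have h1 : ContinuousOn (fun p => (tubeD Φ δ L p).comp horiz) (cylinder δ L) :=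
    (h.contDiffOn_tubeD hL).continuousOn.clm_comp continuousOn_const
  refine ((h.continuousOn_tubeD_vert hL).inv₀ fun p hp => (h.tubeD_vert_pos hp).ne').smul ?_
  exact (ContinuousLinearMap.flipₗᵢ ℝ E2 E2 ℝ).continuous.comp_continuousOn
    (((ContinuousLinearMap.flipₗᵢ ℝ E2 E3 ℝ).continuous.comp_continuousOn
      (continuousOn_const.clm_comp h1)).clm_comp h1)

theorem exists_transForm_ge (h : IsTubeCoordinates Ω γ L δ Φ) (hγ : IsSmoothSimpleArc Ω γ L) :
    ∃ κ > 0, ∀ z ∈ Icc 0 L, ∀ w, κ * ‖w‖ ^ 2 ≤ transForm Φ δ L (0, z) w w := by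
  obtain ⟨κ, hκ, hlow⟩ := h.exists_tubeD_lower_bound hγ.length_pos
  refine ⟨κ ^ 2, by positivity, fun z hz w => ?_⟩
  have h1 := hlow _ (axis_mem_cylinder h.radius_pos.le hz) (horiz w)
  have h2 : ‖horiz w‖ = ‖w‖ := by simp [Prod.norm_def]
  rw [h2] at h1
  rw [transForm_apply, h.norm_tubeD_axis hγ hz, div_one, ← mul_pow]
  gcongr

/-- The velocity of a curve exceeds its vertical component by a quadratic quantity. -/
theorem norm_tubeD_le (h : IsTubeCoordinates Ω γ L δ Φ) {p : E2 × ℝ} (hp : p ∈ cylinder δ L)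
    (w : E2) :
    ‖tubeD Φ δ L p (w, 1)‖ - ‖tubeD Φ δ L p vert‖ * 1 ≤ transForm Φ δ L p w w / 2 := by
  have hσ := h.tubeD_vert_pos hp
  have h1 := h.norm_tubeD_sq hp w 1
  rw [mul_one] at h1 ⊢
  rw [transForm_apply, div_div, le_div_iff₀ (by positivity)]
  nlinarith [sq_nonneg (‖tubeD Φ δ L p (w, 1)‖ - ‖tubeD Φ δ L p vert‖)]

end IsTubeCoordinates

/-- The principal part of the second variation. -/
noncomputable def axisEnergy (Φ : E2 × ℝ → E3) (δ L m z : ℝ) : E2 →L[ℝ] E2 →L[ℝ] ℝ :=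
  m • transForm Φ δ L (0, z)

namespace IsDeficitTube

variable {B : C(Ω.Closure, E3)} {δ' m : ℝ}

theorem continuousOn_axisEnergy (h : IsDeficitTube Ω B γ L δ δ' m Φ) :
    ContinuousOn (axisEnergy Φ δ L m) (Icc 0 L) :=
  (continuousOn_axis h.coords.radius_pos.le
    (h.coords.continuousOn_transForm h.arc.length_pos)).const_smul m

/-- An upper bound for the deficit of the graph of `t u`, to second order in `t`. -/
theorem exists_deficit_graph_le (h : IsDeficitTube Ω B γ L δ δ' m Φ) (hm : 0 ≤ m)
    {u w : ℝ → E2} (hu : IsSobolev L u w) :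
    ∃ K : ℝ, ∀ ε > 0, ∀ᶠ t : ℝ in 𝓝 0, IsTubeCurve δ' L (fun z => t • u z) (fun z => t • w z)
        (fun z => z) (fun _ => 1) ∧
      m * (∫ z in 0..L, ‖tubeD Φ δ L (t • u z, z) (t • w z, 1)‖)
        - curveCurrent Ω (fun z => Φ (t • u z, z)) 0 L B
      ≤ t * (∫ z in 0..L, axisLin (deficitForm Ω B Φ δ L m) δ' L z (u z))
        + t ^ 2 * (quadForm (axisEnergy Φ δ L m) (axisHess (deficitForm Ω B Φ δ L m) δ' L)
          (axisCurl (deficitForm Ω B Φ δ L m) δ' L) L u w / 2 + ε * K) := by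
  set θ := deficitForm Ω B Φ δ L m with hθ
  have hL0 := h.arc.length_pos
  have hL := hL0.le
  have huc := hu.primitive.continuousOn hL
  obtain ⟨C, hC, hCu⟩ := exists_bound_of_continuousOn huc
  refine ⟨m * (∫ z in 0..L, ‖w z‖ ^ 2) + ∫ z in 0..L, (‖u z‖ * ‖w z‖ + ‖u z‖ ^ 2 * |(1 : ℝ)|),
    fun ε hε => ?_⟩
  obtain ⟨η₁, hη₁, H₁⟩ := h.exists_expansion hε
  obtain ⟨η₂, hη₂, H₂⟩ := exists_uniform_axis h.coords.radius_pos.le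
    (h.coords.continuousOn_transForm hL0) hε
  have hsmall : ∀ᶠ t : ℝ in 𝓝 0, |t| * (C + 1) < min δ' (min η₁ η₂) := by
    have hc : Continuous fun t : ℝ => |t| * (C + 1) := by fun_prop
    have := hc.tendsto 0
    simp only [abs_zero, zero_mul] at this
    exact this.eventually (gt_mem_nhds (lt_min h.radius_pos (lt_min hη₁ hη₂)))
  filter_upwards [hsmall] with t ht
  have hb : ∀ z ∈ Icc 0 L, ‖t • u z‖ < min δ' (min η₁ η₂) := fun z hz => by
    refine lt_of_le_of_lt ?_ ht
    rw [norm_smul, Real.norm_eq_abs]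
    have := hCu z hz
    gcongr
    linarith
  have hc : IsTubeCurve δ' L (fun z => t • u z) (fun z => t • w z) (fun z => z) (fun _ => 1) :=
    isTubeCurve_graph (hu.smul t) fun z hz => ((hb z hz).trans_le (min_le_left _ _)).le
  refine ⟨hc, ?_⟩
  have hc' := hc.mono h.radius_lt.le
  rw [h.deficit_eq hc]
  have hI := H₁ _ _ _ _ hc fun z hz =>
    (hb z hz).trans_le ((min_le_right _ _).trans (min_le_left _ _))
  have e1 : (fun z => (1 : ℝ) * axisLin θ δ' L z (t • u z)
      + 1 / 2 * (axisCurl θ δ' L z (t • u z) (t • w z)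
        + 1 * axisHess θ δ' L z (t • u z) (t • u z)))
      = fun z => t * (1 * axisLin θ δ' L z (u z))
        + t ^ 2 / 2 * (axisCurl θ δ' L z (u z) (w z) + 1 * axisHess θ δ' L z (u z) (u z)) := by
    funext z
    simp only [map_smul, smul_apply, smul_eq_mul]
    ring
  have e2 : (fun z => ‖t • u z‖ * ‖t • w z‖ + ‖t • u z‖ ^ 2 * |(1 : ℝ)|)
      = fun z => t ^ 2 * (‖u z‖ * ‖w z‖ + ‖u z‖ ^ 2 * |(1 : ℝ)|) := by
    funext z
    simp only [norm_smul, Real.norm_eq_abs]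
    linear_combination (‖u z‖ * ‖w z‖ + ‖u z‖ ^ 2 * |(1 : ℝ)|) * abs_mul_abs_self t
  have hcθ := h.contDiffOn
  have hu1 : IsTubeCurve (max δ' C) L u w (fun z => z) (fun _ => 1) :=
    isTubeCurve_graph hu fun z hz => (hCu z hz).trans (le_max_right _ _)
  have i1 : IntervalIntegrable (fun z => 1 * axisLin θ δ' L z (u z)) volume 0 L :=
    hu1.intervalIntegrable_lin hL (continuousOn_axisLin h.radius_pos hL0 hcθ)
  have i2 : IntervalIntegrable (fun z => axisCurl θ δ' L z (u z) (w z)) volume 0 L :=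
    hu1.intervalIntegrable_curl hL (continuousOn_axisCurl h.radius_pos hL0 hcθ)
  have i3 : IntervalIntegrable (fun z => 1 * axisHess θ δ' L z (u z) (u z)) volume 0 L :=
    hu1.intervalIntegrable_hess hL (continuousOn_axisHess h.radius_pos hL0 hcθ)
  have i4 : IntervalIntegrable (fun z => axisEnergy Φ δ L m z (w z) (w z)) volume 0 L := by
    have := intervalIntegrable_quad_integrand (N := fun _ => 0) (M := fun _ => 0)
      h.continuousOn_axisEnergy continuousOn_const continuousOn_const hL hu
    simpa using this
  have i5 := hu.intervalIntegrable_sq hL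
  rw [e1, e2, intervalIntegral.integral_add (i1.const_mul t) ((i2.add i3).const_mul _),
    intervalIntegral.integral_const_mul t, intervalIntegral.integral_const_mul (t ^ 2 / 2),
    intervalIntegral.integral_const_mul (t ^ 2), intervalIntegral.integral_add i2 i3] at hI
  have hq : quadForm (axisEnergy Φ δ L m) (axisHess θ δ' L) (axisCurl θ δ' L) L u w
      = (∫ z in 0..L, axisEnergy Φ δ L m z (w z) (w z))
        + ((∫ z in 0..L, axisCurl θ δ' L z (u z) (w z))
          + ∫ z in 0..L, 1 * axisHess θ δ' L z (u z) (u z)) := by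
    rw [← intervalIntegral.integral_add i2 i3, ← intervalIntegral.integral_add i4 (i2.add i3)]
    exact intervalIntegral.integral_congr fun z _ => by ring
  have hlen : m * (∫ z in 0..L, (‖tubeD Φ δ L (t • u z, z) (t • w z, 1)‖
        - ‖tubeD Φ δ L (t • u z, z) vert‖ * 1))
      ≤ t ^ 2 / 2 * ((∫ z in 0..L, axisEnergy Φ δ L m z (w z) (w z))
        + m * ε * ∫ z in 0..L, ‖w z‖ ^ 2) := by
    rw [← intervalIntegral.integral_const_mul, ← intervalIntegral.integral_const_mul,
      ← intervalIntegral.integral_add i4 (i5.const_mul _), ← intervalIntegral.integral_const_mul]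
    refine intervalIntegral.integral_mono_on hL ?_ ((i4.add (i5.const_mul _)).const_mul _)
      fun z hz => ?_
    · exact ((h.coords.curve hL hc').integrable.norm.sub
        (intervalIntegrable_mul_of_continuousOn hL (((h.coords.continuousOn_tubeD_vert hL0).comp
          (hc'.continuousOn hL) hc'.mem)) hc.vertical.integrable)).const_mul m
    · have h1 := h.coords.norm_tubeD_le (hc'.mem z hz) (t • w z)
      have h2 := H₂ _ _ (hc'.mem z hz)
        ((hb z hz).trans_le ((min_le_right _ _).trans (min_le_right _ _)))
      have h3 := (Real.le_norm_self _).trans ((transForm Φ δ L (t • u z, z)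
        - transForm Φ δ L (0, z)).le_opNorm₂ (w z) (w z))
      simp only [sub_apply] at h3
      have h4 : transForm Φ δ L (t • u z, z) (w z) (w z)
          ≤ transForm Φ δ L (0, z) (w z) (w z) + ε * ‖w z‖ ^ 2 := by
        have : ‖transForm Φ δ L (t • u z, z) - transForm Φ δ L (0, z)‖ * ‖w z‖ * ‖w z‖
            ≤ ε * ‖w z‖ * ‖w z‖ := by gcongr
        nlinarith
      simp only [map_smul, smul_apply, smul_eq_mul] at h1
      have h5 : axisEnergy Φ δ L m z (w z) (w z) = m * transForm Φ δ L (0, z) (w z) (w z) := rfl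
      rw [h5]
      calc _ ≤ m * (t * (t * transForm Φ δ L (t • u z, z) (w z) (w z)) / 2) := by gcongr
        _ = t ^ 2 / 2 * (m * transForm Φ δ L (t • u z, z) (w z) (w z)) := by ring
        _ ≤ t ^ 2 / 2 * (m * (transForm Φ δ L (0, z) (w z) (w z) + ε * ‖w z‖ ^ 2)) := by gcongr
        _ = _ := by ring
  have hw0 : 0 ≤ ∫ z in 0..L, ‖w z‖ ^ 2 :=
    intervalIntegral.integral_nonneg hL fun z _ => by positivity
  have hI' := (abs_le.mp hI).2
  have e3 : (∫ z in 0..L, 1 * axisLin θ δ' L z (u z)) = ∫ z in 0..L, axisLin θ δ' L z (u z) := by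
    simp
  rw [e3] at hI'
  rw [hq]
  have hn : 0 ≤ t ^ 2 / 2 * (m * ε * ∫ z in 0..L, ‖w z‖ ^ 2) := by positivity
  nlinarith

end IsDeficitTube

end

end

/-! ### Consequences of maximality -/

section

/-- A function with a negative second derivative at `0`, and quadratically close to its value
at `0`, decreases quadratically. The second derivative being nonzero, it is a genuine one, and `f`
is differentiable near `0`. -/
theorem exists_le_of_iteratedDeriv_two_neg {f : ℝ → ℝ} {C : ℝ}
    (hC : ∀ᶠ t in 𝓝 0, |f t - f 0| ≤ C * t ^ 2) (h : iteratedDeriv 2 f 0 < 0) :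
    ∃ c > 0, ∀ᶠ t in 𝓝[>] 0, f t ≤ f 0 - c * t ^ 2 := by
  rw [iteratedDeriv_succ, iteratedDeriv_one] at h
  set d := deriv (deriv f) 0 with hd
  -- the hypothesis `hC` alone gives differentiability at `0`
  have h0 : HasDerivAt f 0 0 := by
    rw [hasDerivAt_iff_isLittleO]
    have h1 : (fun t => f t - f 0 - (t - 0) • (0 : ℝ)) =O[𝓝 0] fun t => t ^ 2 := by
      refine Asymptotics.IsBigO.of_bound C ?_
      filter_upwards [hC] with t ht
      simpa using ht
    refine h1.trans_isLittleO ?_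
    simpa using Asymptotics.isLittleO_pow_id (𝕜 := ℝ) one_lt_two
  -- `deriv f` is differentiable at `0`, for otherwise its derivative there would be zero
  have h2 : HasDerivAt (deriv f) d 0 := (differentiableAt_of_deriv_ne_zero h.ne).hasDerivAt
  have h3 := (hasDerivAt_iff_isLittleO.mp h2).def (c := -d / 2) (by linarith)
  obtain ⟨τ, hτ, H⟩ := Metric.eventually_nhds_iff.mp h3
  have key : ∀ s, 0 < s → s < τ → deriv f s ≤ d / 2 * s := by
    intro s hs hsτ
    have h4 := H (y := s) (by rw [Real.dist_eq, sub_zero, abs_of_pos hs]; exact hsτ)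
    rw [h0.deriv, sub_zero, sub_zero, smul_eq_mul, Real.norm_eq_abs, Real.norm_eq_abs,
      abs_of_pos hs] at h4
    have := (abs_le.mp h4).2
    linarith
  have hdiff : ∀ s, 0 ≤ s → s < τ → DifferentiableAt ℝ f s := by
    intro s hs hsτ
    rcases hs.eq_or_lt with rfl | hs
    · exact h0.differentiableAt
    · refine differentiableAt_of_deriv_ne_zero (lt_of_le_of_lt (key s hs hsτ) ?_).ne
      nlinarith
  refine ⟨-d / 4, by linarith, ?_⟩
  filter_upwards [Ioo_mem_nhdsGT hτ] with t ht
  have hg : ∀ s ∈ Icc 0 t, HasDerivAt (fun s => f s - d / 4 * s ^ 2)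
      (deriv f s - d / 2 * s) s := fun s hs => by
    have := (hdiff s hs.1 (hs.2.trans_lt ht.2)).hasDerivAt.sub (((hasDerivAt_id s).pow 2).const_mul
      (d / 4))
    refine this.congr_deriv ?_
    simp; ring
  have hanti : AntitoneOn (fun s => f s - d / 4 * s ^ 2) (Icc 0 t) := by
    refine antitoneOn_of_deriv_nonpos (convex_Icc 0 t)
      (fun s hs => (hg s hs).continuousAt.continuousWithinAt)
      (fun s hs => (hg s (interior_subset hs)).differentiableAt.differentiableWithinAt)
      fun s hs => ?_
    rw [interior_Icc] at hs
    rw [(hg s (Ioo_subset_Icc_self hs)).deriv]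
    have := key s hs.1 (hs.2.trans ht.2)
    linarith
  have := hanti (left_mem_Icc.mpr ht.1.le) (right_mem_Icc.mpr ht.1.le) ht.1.le
  simp only at this
  linarith

theorem eq_zero_of_eventually_nonneg {a C : ℝ} (h : ∀ᶠ t : ℝ in 𝓝 0, 0 ≤ t * a + t ^ 2 * C) :
    a = 0 := by
  have h1 : IsLocalMin (fun t : ℝ => t * a + t ^ 2 * C) 0 := by
    filter_upwards [h] with t ht
    simpa using ht
  have h2 : HasDerivAt (fun t : ℝ => t * a + t ^ 2 * C) a 0 := by
    have := ((hasDerivAt_id (0 : ℝ)).mul_const a).add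
      (((hasDerivAt_id (0 : ℝ)).pow 2).mul_const C)
    refine this.congr_deriv ?_
    simp
  exact h1.hasDerivAt_eq_zero h2

theorem isSobolev_of_contDiff {L : ℝ} {u : ℝ → E2} (hu : ContDiff ℝ 1 u) :
    IsSobolev L u (deriv u) := by
  have hc : Continuous (deriv u) := hu.continuous_deriv le_rfl
  obtain ⟨C, -, hC⟩ := exists_bound_of_continuousOn (L := L) hc.continuousOn
  refine ⟨MemLp.of_bound hc.aestronglyMeasurable C ?_, hc.intervalIntegrable _ _, fun t ht => ?_⟩
  · exact (ae_restrict_iff' measurableSet_Ioc).mpr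
      (Eventually.of_forall fun z hz => hC z (Ioc_subset_Icc_self hz))
  · rw [intervalIntegral.integral_eq_sub_of_hasDerivAt
      (fun x _ => (hu.differentiable one_ne_zero x).hasDerivAt) (hc.intervalIntegrable _ _)]
    abel

theorem IsSobolev.isH1 {L : ℝ} {u w : ℝ → E2} (h : IsSobolev L u w) : IsH1 L u :=
  ⟨w, h.memLp, h.primitive.eq⟩

theorem gradField_neg (Ω : SmoothDomain) {φ : E3 → ℝ} (hφ : ContDiff ℝ ∞ φ) :
    gradField Ω (fun x => -φ x) hφ.neg = -gradField Ω φ hφ := by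
  ext1 x
  change gradient (fun x => -φ x) x = -gradient φ x
  rw [gradient, gradient, fderiv_fun_neg, map_neg]

theorem neg_mem_normalCurrents {Ω : SmoothDomain} {T : FiniteMassCurrent Ω}
    (hT : T ∈ normalCurrents Ω) : -T ∈ normalCurrents Ω := by
  obtain ⟨⟨C, hC⟩, hdiv⟩ := hT
  refine ⟨⟨C, fun φ hφ hc h1 => ?_⟩, fun φ hφ hc hs => ?_⟩
  · have := hC (fun x => -φ x) hφ.neg hc.neg fun x => by rw [abs_neg]; exact h1 x
    rwa [gradField_neg, map_neg] at this
  · rw [neg_apply, hdiv φ hφ hc hs, neg_zero]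

section

variable {Ω : SmoothDomain} {B : C(Ω.Closure, E3)} {T₀ : FiniteMassCurrent Ω}

theorem MaximizesRatio.apply_le (h : MaximizesRatio Ω B T₀) {T : FiniteMassCurrent Ω}
    (hT : T ∈ normalCurrents Ω) : T B ≤ ratio Ω B T₀ * ‖T‖ := by
  rcases eq_or_ne T 0 with rfl | h0
  · simp
  · exact (div_le_iff₀ (norm_pos_iff.mpr h0)).mp (h.2.2 T hT h0)

/-- Both `T₀` and `-T₀` are competitors. -/
theorem MaximizesRatio.ratio_nonneg (h : MaximizesRatio Ω B T₀) : 0 ≤ ratio Ω B T₀ := by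
  have h1 := h.2.2 (-T₀) (neg_mem_normalCurrents h.1) (neg_ne_zero.mpr h.2.1)
  unfold ratio at h1 ⊢
  rw [neg_apply, norm_neg, neg_div] at h1
  linarith

theorem MaximizesRatio.ratio_eq_zero (h : MaximizesRatio Ω B T₀) (h0 : ratio Ω B T₀ = 0)
    {T : FiniteMassCurrent Ω} (hT : T ∈ normalCurrents Ω) : ratio Ω B T = 0 := by
  have h1 := h.apply_le hT
  have h2 := h.apply_le (neg_mem_normalCurrents hT)
  rw [h0, zero_mul] at h1 h2
  rw [neg_apply] at h2
  rw [ratio, le_antisymm h1 (by linarith), zero_div]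

/-- If the maximum of the ratio is zero, then the ratio vanishes identically, and its second
variation is zero. -/
theorem MaximizesRatio.ratio_pos (h : MaximizesRatio Ω B T₀) {γ : ℝ → E3} {L δ : ℝ}
    {Φ : E2 × ℝ → E3} (hΦ : IsTubeCoordinates Ω γ L δ Φ) (hL : 0 ≤ L)
    (hQ : ∀ u : ℝ → E2, IsH1 L u → (∃ z ∈ Icc 0 L, u z ≠ 0) → 0 < Q Ω B Φ L u) :
    0 < ratio Ω B T₀ := by
  refine lt_of_le_of_ne h.ratio_nonneg fun h0 => ?_
  obtain ⟨e, he⟩ : ∃ e : E2, e ≠ 0 := exists_ne 0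
  have hS : IsSobolev L (fun _ => e) (deriv fun _ => e) := isSobolev_of_contDiff contDiff_const
  have hpos := hQ _ hS.isH1 ⟨0, ⟨le_rfl, hL⟩, he⟩
  have hev : (fun t : ℝ => ratio Ω B (curveCurrent Ω (fun z => Φ (t • e, z)) 0 L))
      =ᶠ[𝓝 0] fun _ => 0 := by
    have hc : Continuous fun t : ℝ => ‖t • e‖ := by fun_prop
    have := hc.tendsto 0
    simp only [zero_smul, norm_zero] at this
    filter_upwards [this.eventually (eventually_le_nhds hΦ.radius_pos)] with t ht
    exact h.ratio_eq_zero h0.symm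
      (hΦ.curve_mem_normalCurrents hL (isTubeCurve_graph (hS.smul t) fun _ _ => ht))
  rw [Q, hev.iteratedDeriv_eq 2] at hpos
  simp at hpos

end

namespace IsDeficitTube

variable {Ω : SmoothDomain} {γ : ℝ → E3} {L δ : ℝ} {Φ : E2 × ℝ → E3} {B : C(Ω.Closure, E3)}
  {δ' m : ℝ}

theorem deficit_nonneg (h : IsDeficitTube Ω B γ L δ δ' m Φ) (hm : 0 ≤ m)
    (hsup : ∀ T ∈ normalCurrents Ω, T B ≤ m * ‖T‖) {v w : ℝ → E2} {z ζ : ℝ → ℝ}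
    (hc : IsTubeCurve δ' L v w z ζ) :
    0 ≤ m * (∫ t in 0..L, ‖tubeD Φ δ L (v t, z t) (w t, ζ t)‖)
      - curveCurrent Ω (fun t => Φ (v t, z t)) 0 L B := by
  have hL := h.arc.length_pos.le
  have hc' := hc.mono h.radius_lt.le
  have h1 := hsup _ (h.coords.curve_mem_normalCurrents hL hc')
  have h2 := norm_curveCurrent_le (h.coords.curve hL hc') hL (h.coords.mapsTo_curve hc')
  have h3 := mul_le_mul_of_nonneg_left h2 hm
  linarith

/-- The first variation of the deficit, which is minimal on the axis. -/
theorem integral_axisLin_eq_zero (h : IsDeficitTube Ω B γ L δ δ' m Φ) (hm : 0 ≤ m)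
    (hsup : ∀ T ∈ normalCurrents Ω, T B ≤ m * ‖T‖) {u w : ℝ → E2} (hu : IsSobolev L u w) :
    ∫ z in 0..L, axisLin (deficitForm Ω B Φ δ L m) δ' L z (u z) = 0 := by
  obtain ⟨K, hK⟩ := h.exists_deficit_graph_le hm hu
  refine eq_zero_of_eventually_nonneg
    (C := quadForm (axisEnergy Φ δ L m) (axisHess (deficitForm Ω B Φ δ L m) δ' L)
      (axisCurl (deficitForm Ω B Φ δ L m) δ' L) L u w / 2 + 1 * K) ?_
  filter_upwards [hK 1 one_pos] with t ht
  exact (h.deficit_nonneg hm hsup ht.1).trans ht.2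

/-- The Euler-Lagrange equation for the axis. -/
theorem axisLin_eq_zero (h : IsDeficitTube Ω B γ L δ δ' m Φ) (hm : 0 ≤ m)
    (hsup : ∀ T ∈ normalCurrents Ω, T B ≤ m * ‖T‖) {z : ℝ} (hz : z ∈ Icc 0 L) :
    axisLin (deficitForm Ω B Φ δ L m) δ' L z = 0 := by
  have hL0 := h.arc.length_pos
  ext1 e
  have hc : ContinuousOn (fun z => axisLin (deficitForm Ω B Φ δ L m) δ' L z e) (Icc 0 L) :=
    (continuousOn_axisLin h.radius_pos hL0 h.contDiffOn).clm_apply continuousOn_const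
  have hae := isOpen_Ioo.ae_eq_zero_of_integral_contDiff_smul_eq_zero (μ := volume)
    ((hc.mono Ioo_subset_Icc_self).locallyIntegrableOn measurableSet_Ioo) fun g hg hgc hgs => by
      have hS := isSobolev_of_contDiff (L := L) (u := fun z => g z • e)
        ((hg.of_le (by exact_mod_cast le_top)).smul contDiff_const)
      have h1 := h.integral_axisLin_eq_zero hm hsup hS
      rw [intervalIntegral.integral_of_le hL0.le] at h1
      simp only [map_smul] at h1
      rw [← setIntegral_eq_integral_of_forall_compl_eq_zero (s := Ioc 0 L)]
      · exact h1
      · intro x hx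
        have : x ∉ tsupport g := fun hx' => hx (Ioo_subset_Ioc_self (hgs hx'))
        rw [image_eq_zero_of_notMem_tsupport this, zero_smul]
  refine Measure.eqOn_Icc_of_ae_eq volume hL0.ne ?_ hc (g := fun _ => 0) continuousOn_const hz
  rw [← Measure.restrict_congr_set Ioo_ae_eq_Icc]
  exact (ae_restrict_iff' measurableSet_Ioo).mpr hae

theorem norm_graph (h : IsDeficitTube Ω B γ L δ δ' m Φ) {u w : ℝ → E2}
    (hc : IsTubeCurve δ' L u w (fun z => z) (fun _ => 1)) :
    ‖curveCurrent Ω (fun z => Φ (u z, z)) 0 L‖ = ∫ z in 0..L, ‖tubeD Φ δ L (u z, z) (w z, 1)‖ := by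
  have hL := h.arc.length_pos.le
  have hc' := hc.mono h.radius_lt.le
  refine norm_curveCurrent_of_injOn (h.coords.curve hL hc') hL (h.coords.mapsTo_curve hc')
    fun x hx y hy hxy => ?_
  exact congrArg Prod.snd (h.coords.injOn (hc'.mem x hx) (hc'.mem y hy) hxy)

theorem exists_norm_graph_ge (h : IsDeficitTube Ω B γ L δ δ' m Φ) :
    ∃ l > 0, ∀ u w : ℝ → E2, IsTubeCurve δ' L u w (fun z => z) (fun _ => 1) →
      l ≤ ‖curveCurrent Ω (fun z => Φ (u z, z)) 0 L‖ := by
  have hL0 := h.arc.length_pos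
  obtain ⟨κ, hκ, hlow⟩ := h.coords.exists_tubeD_lower_bound hL0
  refine ⟨κ * L, by positivity, fun u w hc => ?_⟩
  have hc' := hc.mono h.radius_lt.le
  rw [h.norm_graph hc]
  have h1 : ∫ z in 0..L, κ = κ * L := by simp [mul_comm]
  rw [← h1]
  refine intervalIntegral.integral_mono_on hL0.le intervalIntegrable_const
    (h.coords.curve hL0.le hc').integrable.norm fun z hz => ?_
  refine le_trans ?_ (hlow _ (hc'.mem z hz) (w z, 1))
  have h2 : (1 : ℝ) ≤ ‖((w z, 1) : E2 × ℝ)‖ := by simp [Prod.norm_def]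
  nlinarith

/-- Positivity of the second variation of the ratio gives positivity of the quadratic form which
dominates the deficit to second order. The ratio decreases quadratically along the graphs of `t u`,
which is converted into a lower bound for the deficit. -/
theorem quadForm_pos (h : IsDeficitTube Ω B γ L δ δ' m Φ) (hm : 0 < m)
    (hsup : ∀ T ∈ normalCurrents Ω, T B ≤ m * ‖T‖) {u w : ℝ → E2} (hu : IsSobolev L u w)
    (hQ : 0 < Q Ω B Φ L u) :
    0 < quadForm (axisEnergy Φ δ L m) (axisHess (deficitForm Ω B Φ δ L m) δ' L)
      (axisCurl (deficitForm Ω B Φ δ L m) δ' L) L u w := by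
  set q := quadForm (axisEnergy Φ δ L m) (axisHess (deficitForm Ω B Φ δ L m) δ' L)
      (axisCurl (deficitForm Ω B Φ δ L m) δ' L) L u w with hq
  obtain ⟨K, hK⟩ := h.exists_deficit_graph_le hm.le hu
  obtain ⟨l, hl, hlow⟩ := h.exists_norm_graph_ge
  rw [h.integral_axisLin_eq_zero hm.le hsup hu] at hK
  set f : ℝ → ℝ := fun t => ratio Ω B (curveCurrent Ω (fun z => Φ (t • u z, z)) 0 L) with hf
  have hfd : ∀ t : ℝ, IsTubeCurve δ' L (fun z => t • u z) (fun z => t • w z) (fun z => z)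
      (fun _ => 1) → l ≤ ‖curveCurrent Ω (fun z => Φ (t • u z, z)) 0 L‖ ∧
      m * (∫ z in 0..L, ‖tubeD Φ δ L (t • u z, z) (t • w z, 1)‖)
        - curveCurrent Ω (fun z => Φ (t • u z, z)) 0 L B
      = (m - f t) * ‖curveCurrent Ω (fun z => Φ (t • u z, z)) 0 L‖ := by
    intro t ht
    have h1 := hlow _ _ ht
    refine ⟨h1, ?_⟩
    rw [← h.norm_graph ht, hf]
    simp only [ratio]
    rw [sub_mul, div_mul_cancel₀ _ (hl.trans_le h1).ne']
  have hC : ∀ᶠ t in 𝓝 0, |f t - m| ≤ |q / 2 + 1 * K| / l * t ^ 2 := by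
    filter_upwards [hK 1 one_pos] with t ⟨ht, hle⟩
    obtain ⟨h1, h2⟩ := hfd t ht
    have h3 := h.deficit_nonneg hm.le hsup ht
    rw [h2] at h3 hle
    have h4 : 0 ≤ m - f t := nonneg_of_mul_nonneg_left h3 (hl.trans_le h1)
    rw [abs_sub_comm, abs_of_nonneg h4, div_mul_eq_mul_div, le_div_iff₀ hl]
    calc (m - f t) * l ≤ (m - f t) * ‖curveCurrent Ω (fun z => Φ (t • u z, z)) 0 L‖ := by gcongr
      _ ≤ t ^ 2 * (q / 2 + 1 * K) := by linarith
      _ ≤ t ^ 2 * |q / 2 + 1 * K| := by gcongr; exact le_abs_self _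
      _ = _ := by ring
  have hf0 : f 0 = m := by
    have := hC.self_of_nhds
    rw [zero_pow two_ne_zero, mul_zero] at this
    exact sub_eq_zero.mp (abs_nonpos_iff.mp this)
  rw [← hf0] at hC
  obtain ⟨c, hc, hdec⟩ := exists_le_of_iteratedDeriv_two_neg hC (by
    have : 0 < - iteratedDeriv 2 f 0 := hQ
    linarith)
  have hε : 0 < c * l / (2 * (|K| + 1)) := by positivity
  have hmem : ∀ᶠ t : ℝ in 𝓝[>] 0, 0 < t := self_mem_nhdsWithin
  obtain ⟨t, ht1, ⟨ht2, hle⟩, ht3⟩ :=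
    (hmem.and (((hK _ hε).filter_mono nhdsWithin_le_nhds).and hdec)).exists
  obtain ⟨h1, h2⟩ := hfd t ht2
  rw [h2] at hle
  rw [hf0] at ht3
  have h3 : t ^ 2 * (c * l) ≤ t ^ 2 * (q / 2 + c * l / (2 * (|K| + 1)) * K) := by
    calc t ^ 2 * (c * l) = (c * t ^ 2) * l := by ring
      _ ≤ (m - f t) * ‖curveCurrent Ω (fun z => Φ (t • u z, z)) 0 L‖ :=
        mul_le_mul (by linarith) h1 hl.le (by nlinarith [sq_nonneg t])
      _ ≤ _ := by linarith
  have h4 := le_of_mul_le_mul_left h3 (by positivity)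
  have h5 : c * l / (2 * (|K| + 1)) * K ≤ c * l / 2 := by
    rw [div_mul_eq_mul_div, div_le_iff₀ (by positivity)]
    have := le_abs_self K
    have hcl : 0 < c * l := by positivity
    nlinarith
  have h6 : 0 < c * l := by positivity
  linarith

theorem exists_coercive_quadForm (h : IsDeficitTube Ω B γ L δ δ' m Φ) (hm : 0 < m)
    (hsup : ∀ T ∈ normalCurrents Ω, T B ≤ m * ‖T‖)
    (hQ : ∀ u : ℝ → E2, IsH1 L u → (∃ z ∈ Icc 0 L, u z ≠ 0) → 0 < Q Ω B Φ L u) :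
    ∃ c > 0, ∀ u w : ℝ → E2, IsSobolev L u w → c * (‖u 0‖ ^ 2 + ∫ z in 0..L, ‖w z‖ ^ 2)
      ≤ quadForm (axisEnergy Φ δ L m) (axisHess (deficitForm Ω B Φ δ L m) δ' L)
        (axisCurl (deficitForm Ω B Φ δ L m) δ' L) L u w := by
  obtain ⟨κ, hκ, hlow⟩ := h.coords.exists_transForm_ge h.arc
  refine exists_coercive (κ := m * κ) h.arc.length_pos h.continuousOn_axisEnergy
    (continuousOn_axisHess h.radius_pos h.arc.length_pos h.contDiffOn)
    (continuousOn_axisCurl h.radius_pos h.arc.length_pos h.contDiffOn) (by positivity)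
    (fun z hz w => ?_) fun u w hS hne => h.quadForm_pos hm hsup hS (hQ u hS.isH1 hne)
  rw [mul_assoc]
  exact mul_le_mul_of_nonneg_left (hlow z hz w) hm.le

end IsDeficitTube

end

/-! ### Lower bound for the deficit near the axis -/

section

/-- The Cauchy-Schwarz inequality. -/
theorem sq_integral_le {L : ℝ} (hL : 0 < L) {f : ℝ → ℝ} (hf : IntervalIntegrable f volume 0 L)
    (hf2 : IntervalIntegrable (fun z => f z ^ 2) volume 0 L) :
    (∫ z in 0..L, f z) ^ 2 ≤ L * ∫ z in 0..L, f z ^ 2 := by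
  set a := ∫ z in 0..L, f z with ha
  have h1 : 0 ≤ ∫ z in 0..L, (f z ^ 2 - 2 * (a / L) * f z + (a / L) ^ 2) :=
    intervalIntegral.integral_nonneg hL.le fun z _ => by nlinarith [sq_nonneg (f z - a / L)]
  rw [intervalIntegral.integral_add (hf2.sub (hf.const_mul _)) intervalIntegrable_const,
    intervalIntegral.integral_sub hf2 (hf.const_mul _), intervalIntegral.integral_const_mul, ← ha,
    intervalIntegral.integral_const, sub_zero, smul_eq_mul] at h1
  have h2 : L * (2 * (a / L) * a) = 2 * a ^ 2 := by field_simp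
  have h3 : L * (L * (a / L) ^ 2) = a ^ 2 := by field_simp
  have h4 := mul_nonneg hL.le h1
  nlinarith

/-- Sobolev's inequality. -/
theorem IsSobolev.norm_sq_le {L : ℝ} (hL : 0 < L) {u w : ℝ → E2} (h : IsSobolev L u w) {z : ℝ}
    (hz : z ∈ Icc 0 L) :
    ‖u z‖ ^ 2 ≤ (2 + 2 * L) * (‖u 0‖ ^ 2 + ∫ z in 0..L, ‖w z‖ ^ 2) := by
  have h1 := h.primitive.norm_sub_le_abs hL.le (left_mem_Icc.mpr hL.le) hz
  rw [abs_of_nonneg (intervalIntegral.integral_nonneg hz.1 fun _ _ => norm_nonneg _)] at h1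
  have h2 : ∫ s in 0..z, ‖w s‖ ≤ ∫ s in 0..L, ‖w s‖ :=
    intervalIntegral.integral_mono_interval le_rfl hz.1 hz.2
      (Eventually.of_forall fun _ => norm_nonneg _) h.primitive.integrable.norm
  have h3 := sq_integral_le hL h.primitive.integrable.norm (h.intervalIntegrable_sq hL.le)
  have h4 : ‖u z‖ ≤ ‖u 0‖ + ∫ s in 0..L, ‖w s‖ := by
    have := norm_le_norm_add_norm_sub' (u z) (u 0)
    linarith
  have h5 : 0 ≤ ∫ s in 0..L, ‖w s‖ :=
    intervalIntegral.integral_nonneg hL.le fun _ _ => norm_nonneg _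
  have h6 : 0 ≤ ∫ s in 0..L, ‖w s‖ ^ 2 :=
    intervalIntegral.integral_nonneg hL.le fun _ _ => by positivity
  have h7 : ‖u z‖ ^ 2 ≤ (‖u 0‖ + ∫ s in 0..L, ‖w s‖) ^ 2 := by gcongr
  nlinarith [sq_nonneg (‖u 0‖ - ∫ s in 0..L, ‖w s‖), mul_nonneg hL.le (sq_nonneg ‖u 0‖)]

section

variable {Ω : SmoothDomain} {γ : ℝ → E3} {L δ : ℝ} {Φ : E2 × ℝ → E3}

theorem exists_uniform_near_axis (hδ : 0 ≤ δ) {F : Type*} [NormedAddCommGroup F] {f : E2 × ℝ → F}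
    (hf : ContinuousOn f (cylinder δ L)) {ε : ℝ} (hε : 0 < ε) :
    ∃ η > 0, ∀ v z t, (v, z) ∈ cylinder δ L → t ∈ Icc 0 L → ‖v‖ < η → |z - t| < η →
      ‖f (v, z) - f (0, t)‖ ≤ ε := by
  obtain ⟨η, hη, h⟩ := Metric.uniformContinuousOn_iff.mp
    ((isCompact_cylinder δ L).uniformContinuousOn_of_continuous hf) ε hε
  refine ⟨η, hη, fun v z t hp ht hv hz => ?_⟩
  rw [← dist_eq_norm]
  refine (h _ hp _ (axis_mem_cylinder hδ ht) ?_).le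
  rw [dist_eq_norm, Prod.mk_sub_mk, sub_zero, Prod.norm_def]
  exact max_lt hv hz

theorem exists_uniform_Icc {F : Type*} [NormedAddCommGroup F] {f : ℝ → F}
    (hf : ContinuousOn f (Icc 0 L)) {ε : ℝ} (hε : 0 < ε) :
    ∃ η > 0, ∀ z ∈ Icc 0 L, ∀ t ∈ Icc 0 L, |z - t| < η → ‖f z - f t‖ ≤ ε := by
  obtain ⟨η, hη, h⟩ := Metric.uniformContinuousOn_iff.mp
    (isCompact_Icc.uniformContinuousOn_of_continuous hf) ε hε
  exact ⟨η, hη, fun z hz t ht hzt => by rw [← dist_eq_norm]; exact (h z hz t ht hzt).le⟩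

/-- A curve in a tube with speed at most `s`, which is `η`-close to the axis. -/
structure IsNearAxis (Φ : E2 × ℝ → E3) (δ L η s : ℝ) (v w : ℝ → E2) (z ζ : ℝ → ℝ) : Prop where
  horizontal : ∀ t ∈ Icc 0 L, ‖v t‖ < η
  vertical : ∀ t ∈ Icc 0 L, |z t - t| < η
  speed : |s - 1| < η
  bound : ∀ᵐ t ∂volume.restrict (Ioc 0 L), ‖tubeD Φ δ L (v t, z t) (w t, ζ t)‖ ≤ s

theorem IsNearAxis.mono {η η' s : ℝ} {v w : ℝ → E2} {z ζ : ℝ → ℝ}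
    (h : IsNearAxis Φ δ L η s v w z ζ) (hη : η ≤ η') : IsNearAxis Φ δ L η' s v w z ζ :=
  ⟨fun t ht => (h.horizontal t ht).trans_le hη, fun t ht => (h.vertical t ht).trans_le hη,
    h.speed.trans_le hη, h.bound⟩

/-- If the speed of a curve is bounded by `s`, its vertical velocity is at most `s / |∂_z Φ|`, with
a quadratic loss if the horizontal velocity does not vanish. -/
theorem IsTubeCoordinates.loss_ge (h : IsTubeCoordinates Ω γ L δ Φ) {p : E2 × ℝ}
    (hp : p ∈ cylinder δ L) {w : E2} {ζ s ε C : ℝ} (hε : 0 < ε) (hε2 : ε ≤ 1 / 2)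
    (hσ : 1 - ε ≤ ‖tubeD Φ δ L p vert‖) (hs : s ≤ 1 + ε) (hle : ‖tubeD Φ δ L p (w, ζ)‖ ≤ s)
    (hC : transForm Φ δ L p w w ≤ C * ‖w‖ ^ 2) :
    transForm Φ δ L p w w / 2 - ε * (C * ‖w‖ ^ 2) ≤ s - ‖tubeD Φ δ L p vert‖ * ζ
      ∧ |ζ - 1| ≤ 1 + 8 * ε - ζ := by
  have hs0 : 0 ≤ s := (norm_nonneg _).trans hle
  have hσ0 := h.tubeD_vert_pos hp
  have h1 := h.norm_tubeD_sq hp w ζ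
  have h2 : ‖tubeD Φ δ L p (w, ζ)‖ ^ 2 ≤ s ^ 2 := by gcongr
  have hg : ‖tubeD Φ δ L p (horiz w)‖ ^ 2 = transForm Φ δ L p w w * ‖tubeD Φ δ L p vert‖ := by
    rw [transForm_apply, div_mul_cancel₀ _ hσ0.ne']
  have hS0 : 0 ≤ transForm Φ δ L p w w := by rw [transForm_apply]; positivity
  rw [hg] at h1
  set σ := ‖tubeD Φ δ L p vert‖
  set S := transForm Φ δ L p w w
  have h3 : S * σ ≤ (s - σ * ζ) * (s + σ * ζ) := by nlinarith
  have h4 : σ * ζ ≤ s := by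
    refine le_of_sq_le_sq ?_ hs0
    have : 0 ≤ S * σ := by positivity
    nlinarith
  have h5 : S * σ ≤ 2 * s * (s - σ * ζ) := by nlinarith
  constructor
  · have h6 : S * (1 - ε) ≤ 2 * (1 + ε) * (s - σ * ζ) := by
      calc S * (1 - ε) ≤ S * σ := by gcongr
        _ ≤ 2 * s * (s - σ * ζ) := h5
        _ ≤ 2 * (1 + ε) * (s - σ * ζ) := by
          have : 0 ≤ s - σ * ζ := by linarith
          gcongr
    -- `(1 - ε) / (1 + ε) ≥ 1 - 2 ε`
    have h7 : (S / 2 - ε * S) * (2 * (1 + ε)) ≤ 2 * (1 + ε) * (s - σ * ζ) := by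
      refine le_trans ?_ h6
      nlinarith [mul_nonneg hS0 (sq_nonneg ε)]
    rw [mul_comm] at h7
    have h8 := le_of_mul_le_mul_left h7 (by linarith)
    have h9 : ε * S ≤ ε * (C * ‖w‖ ^ 2) := by gcongr
    linarith
  · rw [abs_le]
    refine ⟨by linarith, ?_⟩
    rcases le_or_gt ζ 0 with hζ | hζ
    · linarith
    · have h6 : (1 - ε) * ζ ≤ 1 + ε := by
        have : (1 - ε) * ζ ≤ σ * ζ := by gcongr
        linarith
      have h7 : (1 - ε) * ζ ≤ (1 - ε) * (1 + 4 * ε) := by nlinarith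
      have h8 := le_of_mul_le_mul_left h7 (by linarith)
      linarith

/-- The pointwise estimate behind `exists_deficit_ge`: the coefficients `a₁`, `n₁`, `m₁` at a point
of the curve are `ε`-close to those at the nearby point of the axis. -/
theorem deficit_integrand_ge {a₀ a₁ n₀ n₁ m₀ m₁ : E2 →L[ℝ] E2 →L[ℝ] ℝ} {m ε V CS CH ζ l : ℝ}
    {v w : E2} (hm : 0 ≤ m) (hε : 0 < ε) (hCH : 0 ≤ CH) (ha : ‖a₁ - a₀‖ ≤ ε) (hn : ‖n₁ - n₀‖ ≤ ε)
    (hm₁ : ‖m₁ - m₀‖ ≤ ε) (hb : ‖n₁‖ ≤ CH) (hv : ‖v‖ ^ 2 ≤ V)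
    (hl : a₁ w w / 2 - ε * (CS * ‖w‖ ^ 2) ≤ l) :
    (m * a₀ w w + n₀ v v + m₀ v w) / 2
      - (ε * (m * (CS + 1) + 1 / 2) * ‖w‖ ^ 2 + ε * V + CH * V / 2 * |ζ - 1|)
      ≤ m * l + 1 / 2 * (m₁ v w + ζ * n₁ v v) := by
  have key : ∀ {b₀ b₁ : E2 →L[ℝ] E2 →L[ℝ] ℝ} (x y : E2), ‖b₁ - b₀‖ ≤ ε →
      b₀ x y - b₁ x y ≤ ε * (‖x‖ * ‖y‖) := by
    intro b₀ b₁ x y hb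
    rw [norm_sub_rev] at hb
    have h1 := (Real.le_norm_self _).trans ((b₀ - b₁).le_opNorm₂ x y)
    simp only [sub_apply] at h1
    refine h1.trans ?_
    rw [mul_assoc]
    gcongr
  have c2 := key w w ha
  have c4 := key v w hm₁
  have c5 := key v v hn
  rw [← sq] at c2 c5
  have c4' : ε * (‖v‖ * ‖w‖) ≤ ε * (V + ‖w‖ ^ 2) := by
    refine mul_le_mul_of_nonneg_left ?_ hε.le
    nlinarith [sq_nonneg (‖v‖ - ‖w‖), sq_nonneg ‖w‖, sq_nonneg ‖v‖]
  have c5' : ε * ‖v‖ ^ 2 ≤ ε * V := by gcongr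
  have c7 : |(1 - ζ) * n₁ v v| ≤ |ζ - 1| * (CH * V) := by
    rw [abs_mul, abs_sub_comm]
    refine mul_le_mul_of_nonneg_left ?_ (abs_nonneg _)
    refine (n₁.le_opNorm₂ v v).trans ?_
    rw [mul_assoc, ← sq]
    exact mul_le_mul hb hv (sq_nonneg _) hCH
  have c7' := (abs_le.mp c7).2
  have hl' : a₀ w w / 2 - ε * (CS + 1) * ‖w‖ ^ 2 ≤ l := by
    have : 0 ≤ ε * ‖w‖ ^ 2 := by positivity
    linarith
  have hmul := mul_le_mul_of_nonneg_left hl' hm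
  linarith

theorem IsTubeCurve.integral_abs_sub_one_le {v w : ℝ → E2} {z ζ : ℝ → ℝ} {ε : ℝ}
    (hc : IsTubeCurve δ L v w z ζ) (hL : 0 ≤ L)
    (h : ∀ᵐ t ∂volume.restrict (Ioc 0 L), |ζ t - 1| ≤ 1 + 8 * ε - ζ t) :
    ∫ t in 0..L, |ζ t - 1| ≤ 8 * ε * L := by
  have iζ := hc.vertical.integrable
  calc ∫ t in 0..L, |ζ t - 1| ≤ ∫ t in 0..L, (1 + 8 * ε - ζ t) :=
        intervalIntegral.integral_mono_ae_restrict hL (iζ.sub intervalIntegrable_const).norm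
          (intervalIntegrable_const.sub iζ) (by rwa [← restrict_Ioc_eq_restrict_Icc])
    _ = 8 * ε * L := by
      rw [intervalIntegral.integral_sub intervalIntegrable_const iζ,
        hc.vertical.sub_left_eq_integral hL, hc.left, hc.right]
      simp; ring

theorem IsTubeCurve.integral_error_le {v w : ℝ → E2} {z ζ : ℝ → ℝ} {V a : ℝ}
    (hc : IsTubeCurve δ L v w z ζ) (hL : 0 ≤ L) (hV : ∀ t ∈ Icc 0 L, ‖v t‖ ^ 2 ≤ V)
    (ha : ∫ t in 0..L, |ζ t - 1| ≤ a) :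
    ∫ t in 0..L, (‖v t‖ * ‖w t‖ + ‖v t‖ ^ 2 * |ζ t|)
      ≤ 2 * V * L + (∫ t in 0..L, ‖w t‖ ^ 2) + V * a := by
  have iw := hc.sobolev.intervalIntegrable_sq hL
  have iabs : IntervalIntegrable (fun t => |ζ t - 1|) volume 0 L :=
    (hc.vertical.integrable.sub intervalIntegrable_const).norm
  have hV0 : 0 ≤ V := (sq_nonneg _).trans (hV 0 ⟨le_rfl, hL⟩)
  have : ∫ t in 0..L, (‖v t‖ * ‖w t‖ + ‖v t‖ ^ 2 * |ζ t|)
      ≤ ∫ t in 0..L, (2 * V + ‖w t‖ ^ 2 + V * |ζ t - 1|) := by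
    refine intervalIntegral.integral_mono_on hL (hc.intervalIntegrable_error hL)
      ((intervalIntegrable_const.add iw).add (iabs.const_mul _)) fun t ht => ?_
    have hVt := hV t ht
    have e1 : |ζ t| ≤ 1 + |ζ t - 1| := by
      have := abs_add_le (1 : ℝ) (ζ t - 1)
      rw [add_sub_cancel, abs_one] at this
      exact this
    have e2 : ‖v t‖ ^ 2 * |ζ t| ≤ V * (1 + |ζ t - 1|) := by gcongr
    nlinarith [sq_nonneg (‖v t‖ - ‖w t‖), sq_nonneg ‖w t‖]
  rw [intervalIntegral.integral_add (intervalIntegrable_const.add iw) (iabs.const_mul _),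
    intervalIntegral.integral_add intervalIntegrable_const iw,
    intervalIntegral.integral_const_mul V, intervalIntegral.integral_const] at this
  have e3 := mul_le_mul_of_nonneg_left ha hV0
  rw [sub_zero, smul_eq_mul] at this
  linarith

namespace IsDeficitTube

variable {B : C(Ω.Closure, E3)} {δ' m : ℝ}

/-- A lower bound for the deficit of a curve close to the axis, with its length replaced by
the bound `s * L`. The bound on the speed excludes back and forth vertical motion: it gives
`ζ ≤ 1 + O(ε)`, while `∫ ζ = L`, so that `∫ |ζ - 1|` is small. -/
theorem exists_deficit_ge (h : IsDeficitTube Ω B γ L δ δ' m Φ) (hm : 0 ≤ m)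
    (hlin : ∀ z ∈ Icc 0 L, axisLin (deficitForm Ω B Φ δ L m) δ' L z = 0) :
    ∃ K : ℝ, ∀ ε > 0, ε ≤ 1 / 2 → ∃ η > 0, ∀ s v w z ζ, IsTubeCurve δ' L v w z ζ →
      IsNearAxis Φ δ L η s v w z ζ →
      quadForm (axisEnergy Φ δ L m) (axisHess (deficitForm Ω B Φ δ L m) δ' L)
        (axisCurl (deficitForm Ω B Φ δ L m) δ' L) L v w / 2
        - ε * (K * (‖v 0‖ ^ 2 + ∫ t in 0..L, ‖w t‖ ^ 2))
      ≤ m * (s * L) - curveCurrent Ω (fun t => Φ (v t, z t)) 0 L B := by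
  set θ := deficitForm Ω B Φ δ L m with hθ
  have hL0 := h.arc.length_pos
  have hL := hL0.le
  have hcurl := continuousOn_axisCurl h.radius_pos hL0 h.contDiffOn
  have hhess := continuousOn_axisHess h.radius_pos hL0 h.contDiffOn
  have hS := h.coords.continuousOn_transForm hL0
  have hσ := h.coords.continuousOn_tubeD_vert hL0
  obtain ⟨CH, hCH, hbH⟩ := exists_bound_of_continuousOn hhess
  obtain ⟨CS, hbS⟩ := (isCompact_cylinder δ L).exists_bound_of_continuousOn hS
  set K₀ := 2 + 2 * L with hK₀
  refine ⟨m * (CS + 1) + (K₀ * L + 1) / 2 + K₀ * L / 2 + 4 * CH * K₀ * L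
    + (K₀ * L + 1 + 5 * K₀ * L), fun ε hε hε2 => ?_⟩
  obtain ⟨η₁, hη₁, H₁⟩ := h.exists_expansion hε
  obtain ⟨η₂, hη₂, H₂⟩ := exists_uniform_near_axis h.coords.radius_pos.le hS hε
  obtain ⟨η₃, hη₃, H₃⟩ := exists_uniform_near_axis h.coords.radius_pos.le hσ hε
  obtain ⟨η₄, hη₄, H₄⟩ := exists_uniform_Icc hcurl hε
  obtain ⟨η₅, hη₅, H₅⟩ := exists_uniform_Icc hhess hε
  refine ⟨min ε (min η₁ (min η₂ (min η₃ (min η₄ η₅)))), by positivity,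
    fun s v w z ζ hc hn => ?_⟩
  have g1 : min ε (min η₁ (min η₂ (min η₃ (min η₄ η₅)))) ≤ min η₁ (min η₂ (min η₃ (min η₄ η₅))) :=
    min_le_right _ _
  have g2 := g1.trans (min_le_right _ _)
  have g3 := g2.trans (min_le_right _ _)
  have g4 := g3.trans (min_le_right _ _)
  have n1 := hn.mono (g1.trans (min_le_left _ _))
  have n2 := hn.mono (g2.trans (min_le_left _ _))
  have n3 := hn.mono (g3.trans (min_le_left _ _))
  have n4 := hn.mono (g4.trans (min_le_left _ _))
  have n5 := hn.mono (g4.trans (min_le_right _ _))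
  have hs : s ≤ 1 + ε := by
    have := (abs_lt.mp (hn.mono (min_le_left _ _)).speed).2
    linarith
  have hc' := hc.mono h.radius_lt.le
  set E := ‖v 0‖ ^ 2 + ∫ t in 0..L, ‖w t‖ ^ 2 with hE
  have hV : ∀ t ∈ Icc 0 L, ‖v t‖ ^ 2 ≤ K₀ * E := fun t ht => hc.sobolev.norm_sq_le hL0 ht
  have hWE : ∫ t in 0..L, ‖w t‖ ^ 2 ≤ E := by
    have := sq_nonneg ‖v 0‖
    linarith
  have hW0 : 0 ≤ ∫ t in 0..L, ‖w t‖ ^ 2 :=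
    intervalIntegral.integral_nonneg hL fun _ _ => by positivity
  have hE0 : 0 ≤ E := hW0.trans hWE
  have hK₀0 : 0 < K₀ := by positivity
  have hKE : 0 ≤ K₀ * E := by positivity
  have iw := hc.sobolev.intervalIntegrable_sq hL
  have iζ := hc.vertical.integrable
  have iσ : IntervalIntegrable (fun t => ‖tubeD Φ δ L (v t, z t) vert‖ * ζ t) volume 0 L :=
    intervalIntegrable_mul_of_continuousOn hL ((hσ.comp (hc'.continuousOn hL) hc'.mem))
      hc.vertical.integrable
  have iθ : IntervalIntegrable (fun t => θ (v t, z t) (w t, ζ t)) volume 0 L :=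
    hc.intervalIntegrable_form hL h.contDiffOn.continuousOn
  have iM := hc.intervalIntegrable_curl hL hcurl
  have iH := hc.intervalIntegrable_hess hL hhess
  have iq := intervalIntegrable_quad_integrand h.continuousOn_axisEnergy hhess hcurl hL hc.sobolev
  have iabs : IntervalIntegrable (fun t => |ζ t - 1|) volume 0 L :=
    (iζ.sub intervalIntegrable_const).norm
  -- the coefficients at `z t` are replaced by those at `t`, and the loss of vertical speed gives
  -- the principal part of `quadForm`
  have hpt : ∀ᵐ t ∂volume.restrict (Ioc 0 L),
      (axisEnergy Φ δ L m t (w t) (w t) + axisHess θ δ' L t (v t) (v t)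
        + axisCurl θ δ' L t (v t) (w t)) / 2
        - (ε * (m * (CS + 1) + 1 / 2) * ‖w t‖ ^ 2 + ε * (K₀ * E)
          + CH * (K₀ * E) / 2 * |ζ t - 1|)
      ≤ m * (s - ‖tubeD Φ δ L (v t, z t) vert‖ * ζ t)
        + 1 / 2 * (axisCurl θ δ' L (z t) (v t) (w t) + ζ t * axisHess θ δ' L (z t) (v t) (v t))
      ∧ |ζ t - 1| ≤ 1 + 8 * ε - ζ t := by
    filter_upwards [hn.bound, ae_restrict_mem measurableSet_Ioc] with t hb ht
    replace ht := Ioc_subset_Icc_self ht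
    have hp := hc'.mem t ht
    have hz := hc.mapsTo_right ht
    have c3 := H₃ _ _ t hp ht (n3.horizontal t ht) (n3.vertical t ht)
    rw [h.coords.norm_tubeD_axis h.arc ht] at c3
    have c6 := (Real.le_norm_self _).trans
      ((transForm Φ δ L (v t, z t)).le_opNorm₂ (w t) (w t))
    have c6' : ‖transForm Φ δ L (v t, z t)‖ * ‖w t‖ * ‖w t‖ ≤ CS * ‖w t‖ * ‖w t‖ := by
      have := hbS _ hp
      gcongr
    obtain ⟨hloss, hζ⟩ := h.coords.loss_ge hp (C := CS) hε hε2
      (by have := (abs_le.mp c3).1; linarith) hs hb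
      ((c6.trans c6').trans_eq (by rw [mul_assoc, ← sq]))
    exact ⟨deficit_integrand_ge hm hε hCH (H₂ _ _ t hp ht (n2.horizontal t ht) (n2.vertical t ht))
      (H₅ _ hz t ht (n5.vertical t ht)) (H₄ _ hz t ht (n4.vertical t ht)) (hbH _ hz) (hV t ht)
      hloss, hζ⟩
  have hζ1 : ∫ t in 0..L, |ζ t - 1| ≤ 8 * ε * L :=
    hc.integral_abs_sub_one_le hL (hpt.mono fun t ht => ht.2)
  have hmain := intervalIntegral.integral_mono_ae_restrict hL
    ((iq.div_const 2).sub (((iw.const_mul (ε * (m * (CS + 1) + 1 / 2))).add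
      (intervalIntegrable_const (c := ε * (K₀ * E)))).add
        (iabs.const_mul (CH * (K₀ * E) / 2))))
    (((intervalIntegrable_const (c := s)).sub iσ |>.const_mul m).add
      ((iM.add iH).const_mul (1 / 2))) (by
        rw [← restrict_Ioc_eq_restrict_Icc]
        exact hpt.mono fun t ht => ht.1)
  rw [intervalIntegral.integral_sub (iq.div_const 2) (((iw.const_mul _).add
      intervalIntegrable_const).add (iabs.const_mul _)),
    intervalIntegral.integral_add ((iw.const_mul _).add
      intervalIntegrable_const) (iabs.const_mul _),
    intervalIntegral.integral_add (iw.const_mul _) intervalIntegrable_const,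
    intervalIntegral.integral_add (((intervalIntegrable_const (c := s)).sub iσ).const_mul m)
      ((iM.add iH).const_mul (1 / 2)),
    intervalIntegral.integral_const_mul (ε * (m * (CS + 1) + 1 / 2)),
    intervalIntegral.integral_const_mul (CH * (K₀ * E) / 2), intervalIntegral.integral_const_mul m,
    intervalIntegral.integral_const_mul (1 / 2), intervalIntegral.integral_div,
    intervalIntegral.integral_const] at hmain
  have hexp := (abs_le.mp (H₁ v w z ζ hc n1.horizontal)).1
  have herr : ∫ t in 0..L, (‖v t‖ * ‖w t‖ + ‖v t‖ ^ 2 * |ζ t|)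
      ≤ 2 * (K₀ * E) * L + E + K₀ * E * (4 * L) := by
    have h1 := hc.integral_error_le hL hV (hζ1.trans (show 8 * ε * L ≤ 4 * L by nlinarith))
    linarith
  have hdef : m * (s * L) - curveCurrent Ω (fun t => Φ (v t, z t)) 0 L B
      = m * (∫ t in 0..L, (s - ‖tubeD Φ δ L (v t, z t) vert‖ * ζ t))
        + ∫ t in 0..L, θ (v t, z t) (w t, ζ t) := by
    have h1 := h.deficit_eq hc
    rw [intervalIntegral.integral_sub (h.coords.curve hL hc').integrable.norm iσ] at h1
    rw [intervalIntegral.integral_sub intervalIntegrable_const iσ,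
      intervalIntegral.integral_const, sub_zero, smul_eq_mul]
    linarith
  have hmid : ∫ t in 0..L, (ζ t * axisLin θ δ' L (z t) (v t)
      + 1 / 2 * (axisCurl θ δ' L (z t) (v t) (w t) + ζ t * axisHess θ δ' L (z t) (v t) (v t)))
      = 1 / 2 * ∫ t in 0..L, (axisCurl θ δ' L (z t) (v t) (w t)
        + ζ t * axisHess θ δ' L (z t) (v t) (v t)) := by
    rw [← intervalIntegral.integral_const_mul]
    refine intervalIntegral.integral_congr fun t ht => ?_
    rw [uIcc_of_le hL] at ht
    rw [hlin _ (hc.mapsTo_right ht), zero_apply, mul_zero, zero_add]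
  rw [← hθ, hmid] at hexp
  rw [hdef, quadForm]
  have f1 : ε * (m * (CS + 1) + 1 / 2) * (∫ t in 0..L, ‖w t‖ ^ 2)
      ≤ ε * (m * (CS + 1) + 1 / 2) * E := by
    have hCS : 0 ≤ CS := (norm_nonneg _).trans
      (hbS _ (axis_mem_cylinder h.coords.radius_pos.le ⟨le_rfl, hL⟩))
    gcongr
  have f2 : CH * (K₀ * E) / 2 * (∫ t in 0..L, |ζ t - 1|) ≤ CH * (K₀ * E) / 2 * (8 * ε * L) := by
    gcongr
  have f3 := mul_le_mul_of_nonneg_left herr hε.le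
  rw [sub_zero, smul_eq_mul] at hmain
  linarith

end IsDeficitTube

end

end

/-! ### The dual norm of the displacement of a curve -/

section

section

variable {Ω : SmoothDomain}

theorem norm_toFun_sub_le {B : C(Ω.Closure, E3)} {K : ℝ≥0} (hB : LipschitzWith K B) {x y : E3}
    (hx : x ∈ closure Ω.carrier) (hy : y ∈ closure Ω.carrier) :
    ‖toFun Ω B x - toFun Ω B y‖ ≤ K * ‖x - y‖ := by
  rw [toFun_of_mem B hx, toFun_of_mem B hy, ← dist_eq_norm, ← dist_eq_norm]
  exact hB.dist_le_mul _ _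

theorem zero_mem_ctUnitBall (Ω : SmoothDomain) : (0 : C(Ω.Closure, E3)) ∈ ctUnitBall Ω := by
  refine ⟨fun x n _ => ?_, 0, LipschitzWith.const 0, by simp⟩
  change crossProduct 0 _ = 0
  rw [map_zero, LinearMap.zero_apply]

theorem starNorm_nonneg (T : FiniteMassCurrent Ω) : 0 ≤ starNorm Ω T :=
  Real.sSup_nonneg' ⟨_, mem_image_of_mem _ (zero_mem_ctUnitBall Ω), by simp⟩

theorem starNorm_sq_le {T : FiniteMassCurrent Ω} {a : ℝ}
    (h : ∀ B ∈ ctUnitBall Ω, T B ^ 2 ≤ a) : starNorm Ω T ^ 2 ≤ a := by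
  have ha : 0 ≤ a := (sq_nonneg _).trans (h 0 (zero_mem_ctUnitBall Ω))
  have : starNorm Ω T ≤ √a := by
    refine csSup_le ⟨_, mem_image_of_mem _ (zero_mem_ctUnitBall Ω)⟩ ?_
    rintro _ ⟨B, hB, rfl⟩
    exact Real.le_sqrt_of_sq_le (h B hB)
  calc starNorm Ω T ^ 2 ≤ √a ^ 2 := by have := starNorm_nonneg T; gcongr
    _ = a := Real.sq_sqrt ha

variable {γ : ℝ → E3} {L δ : ℝ} {Φ : E2 × ℝ → E3}

/-- Reparametrization of the axis. -/
theorem IsTubeCurve.integral_comp {v w : ℝ → E2} {z ζ : ℝ → ℝ} (hc : IsTubeCurve δ L v w z ζ)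
    (hL : 0 ≤ L) {c : ℝ → ℝ} (h : ContinuousOn c (Icc 0 L)) :
    ∫ t in 0..L, ζ t * c (z t) = ∫ t in 0..L, c t := by
  obtain ⟨s, hs, hd, h0, hsL⟩ := exists_primitive_Icc hL h
  obtain ⟨C, hC⟩ := hs.contDiffOn.exists_lipschitzOnWith one_ne_zero (convex_Icc 0 L) isCompact_Icc
  have h1 := hc.vertical.comp hL (fun x hx => (hd x hx).hasFDerivAt.hasFDerivWithinAt) hC
    hc.mapsTo_right
  have h2 := h1.sub_left_eq_integral hL
  rw [hc.left, hc.right, h0, sub_zero, hsL] at h2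
  rw [← h2]
  exact intervalIntegral.integral_congr fun t _ => by simp

/-- The two bounds express that the fields of the unit ball are Lipschitz and bounded. -/
theorem IsTubeCoordinates.exists_fieldForm_bound (h : IsTubeCoordinates Ω γ L δ Φ) (hL : 0 < L) :
    ∃ C ≥ 0, ∀ B ∈ ctUnitBall Ω, ∀ v z, (v, z) ∈ cylinder δ L →
      |fieldForm Ω B Φ δ L (v, z) vert - fieldForm Ω B Φ δ L (0, z) vert| ≤ C * ‖v‖ ∧
      ∀ w, |fieldForm Ω B Φ δ L (v, z) (horiz w)| ≤ C * ‖w‖ := by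
  obtain ⟨C₁, hC₁⟩ := h.exists_lipschitz
  have hD := h.contDiffOn_tubeD hL
  obtain ⟨C₂, hC₂⟩ := hD.exists_lipschitzOnWith two_ne_zero (convex_cylinder δ L)
    (isCompact_cylinder δ L)
  obtain ⟨C₃, hC₃⟩ := (isCompact_cylinder δ L).exists_bound_of_continuousOn hD.continuousOn
  have hC₃0 : 0 ≤ C₃ := (norm_nonneg _).trans
    (hC₃ _ (axis_mem_cylinder h.radius_pos.le ⟨le_rfl, hL.le⟩))
  refine ⟨C₁ * C₃ + C₂ + C₃, by positivity, fun B ⟨_, K, hK, hBK⟩ v z hp => ?_⟩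
  have hB1 : ‖B‖ ≤ 1 := by linarith [K.coe_nonneg]
  have hK1 : (K : ℝ) ≤ 1 := by linarith [norm_nonneg B]
  have hp0 := axis_mem_cylinder h.radius_pos.le (mem_cylinder.mp hp).2
  have hd : ‖((v, z) : E2 × ℝ) - (0, z)‖ = ‖v‖ := by
    rw [Prod.mk_sub_mk, sub_self, sub_zero]; simp [Prod.norm_def]
  have hvert : ‖vert‖ = 1 := by simp [Prod.norm_def]
  constructor
  · have e : fieldForm Ω B Φ δ L (v, z) vert - fieldForm Ω B Φ δ L (0, z) vert
        = ⟪toFun Ω B (Φ (v, z)) - toFun Ω B (Φ (0, z)), tubeD Φ δ L (v, z) vert⟫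
          + ⟪toFun Ω B (Φ (0, z)), (tubeD Φ δ L (v, z) - tubeD Φ δ L (0, z)) vert⟫ := by
      rw [fieldForm_apply, fieldForm_apply, inner_sub_left, sub_apply, inner_sub_right]
      ring
    rw [e]
    have b1 : ‖toFun Ω B (Φ (v, z)) - toFun Ω B (Φ (0, z))‖ ≤ C₁ * ‖v‖ := by
      refine (norm_toFun_sub_le hK (h.mapsTo hp) (h.mapsTo hp0)).trans ?_
      have := hC₁.dist_le_mul _ hp _ hp0
      rw [dist_eq_norm, dist_eq_norm, hd] at this
      exact (mul_le_of_le_one_left (norm_nonneg _) hK1).trans this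
    have b2 : ‖tubeD Φ δ L (v, z) vert‖ ≤ C₃ := by
      have := (tubeD Φ δ L (v, z)).le_of_opNorm_le (hC₃ _ hp) vert
      rwa [hvert, mul_one] at this
    have b3 : ‖(tubeD Φ δ L (v, z) - tubeD Φ δ L (0, z)) vert‖ ≤ C₂ * ‖v‖ := by
      have := hC₂.dist_le_mul _ hp _ hp0
      rw [dist_eq_norm, dist_eq_norm, hd] at this
      have := (tubeD Φ δ L (v, z) - tubeD Φ δ L (0, z)).le_of_opNorm_le this vert
      rwa [hvert, mul_one] at this
    have b4 := (toFun_norm_le Ω B (Φ (0, z))).trans hB1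
    refine (abs_add_le _ _).trans ?_
    have c1 := (abs_real_inner_le_norm (toFun Ω B (Φ (v, z)) - toFun Ω B (Φ (0, z)))
      (tubeD Φ δ L (v, z) vert)).trans (mul_le_mul b1 b2 (norm_nonneg _) (by positivity))
    have c2 := (abs_real_inner_le_norm (toFun Ω B (Φ (0, z)))
      ((tubeD Φ δ L (v, z) - tubeD Φ δ L (0, z)) vert)).trans
        (mul_le_mul b4 b3 (norm_nonneg _) zero_le_one)
    have c3 : 0 ≤ C₃ * ‖v‖ := by positivity
    linarith
  · intro w
    have hw : ‖horiz w‖ = ‖w‖ := by simp [Prod.norm_def]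
    have b2 := (tubeD Φ δ L (v, z)).le_of_opNorm_le (hC₃ _ hp) (horiz w)
    rw [hw] at b2
    have b4 := (toFun_norm_le Ω B (Φ (v, z))).trans hB1
    have c1 := (abs_real_inner_le_norm (toFun Ω B (Φ (v, z)))
      (tubeD Φ δ L (v, z) (horiz w))).trans (mul_le_mul b4 b2 (norm_nonneg _) zero_le_one)
    rw [fieldForm_apply]
    have c3 : 0 ≤ (C₁ * C₃ + C₂) * ‖w‖ := by positivity
    linarith

theorem IsTubeCurve.integral_sq_le {v w : ℝ → E2} {z ζ : ℝ → ℝ} (hc : IsTubeCurve δ L v w z ζ)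
    (hL : 0 < L) (a b : ℝ) :
    IntervalIntegrable (fun t => a * ‖v t‖ + b * ‖w t‖) volume 0 L ∧
    (∫ t in 0..L, (a * ‖v t‖ + b * ‖w t‖)) ^ 2
      ≤ L * (2 * a ^ 2 * (2 + 2 * L) * L + 2 * b ^ 2)
        * (‖v 0‖ ^ 2 + ∫ t in 0..L, ‖w t‖ ^ 2) := by
  have hv := (hc.continuousOn_left hL.le).norm
  have iv : IntervalIntegrable (fun t => ‖v t‖) volume 0 L :=
    ContinuousOn.intervalIntegrable_of_Icc hL.le hv
  have iw := hc.sobolev.primitive.integrable.norm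
  have iw2 := hc.sobolev.intervalIntegrable_sq hL.le
  have iv2 : IntervalIntegrable (fun t => ‖v t‖ ^ 2) volume 0 L :=
    ContinuousOn.intervalIntegrable_of_Icc hL.le (hv.pow 2)
  have ivw := intervalIntegrable_mul_of_continuousOn hL.le hv iw
  have i1 : IntervalIntegrable (fun t => a * ‖v t‖ + b * ‖w t‖) volume 0 L :=
    (iv.const_mul a).add (iw.const_mul b)
  have i2 : IntervalIntegrable (fun t => (a * ‖v t‖ + b * ‖w t‖) ^ 2) volume 0 L := by
    refine (((iv2.const_mul (a ^ 2)).add (ivw.const_mul (2 * a * b))).add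
      (iw2.const_mul (b ^ 2))).congr_ae (Eventually.of_forall fun t => ?_)
    simp only
    ring
  refine ⟨i1, (sq_integral_le hL i1 i2).trans ?_⟩
  set E := ‖v 0‖ ^ 2 + ∫ t in 0..L, ‖w t‖ ^ 2 with hE
  have h1 : ∫ t in 0..L, (a * ‖v t‖ + b * ‖w t‖) ^ 2
      ≤ ∫ t in 0..L, (2 * a ^ 2 * ((2 + 2 * L) * E) + 2 * b ^ 2 * ‖w t‖ ^ 2) := by
    refine intervalIntegral.integral_mono_on hL.le i2
      (intervalIntegrable_const.add (iw2.const_mul _)) fun t ht => ?_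
    have h2 : a ^ 2 * ‖v t‖ ^ 2 ≤ a ^ 2 * ((2 + 2 * L) * E) := by
      have := hc.sobolev.norm_sq_le hL ht
      gcongr
    nlinarith [sq_nonneg (a * ‖v t‖ - b * ‖w t‖)]
  rw [intervalIntegral.integral_add intervalIntegrable_const (iw2.const_mul _),
    intervalIntegral.integral_const_mul (2 * b ^ 2), intervalIntegral.integral_const, sub_zero,
    smul_eq_mul] at h1
  have h3 : 2 * b ^ 2 * ∫ t in 0..L, ‖w t‖ ^ 2 ≤ 2 * b ^ 2 * E := by
    have : ∫ t in 0..L, ‖w t‖ ^ 2 ≤ E := by have := sq_nonneg ‖v 0‖; linarith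
    gcongr
  calc L * ∫ t in 0..L, (a * ‖v t‖ + b * ‖w t‖) ^ 2
      ≤ L * (L * (2 * a ^ 2 * ((2 + 2 * L) * E)) + 2 * b ^ 2 * E) := by
        refine mul_le_mul_of_nonneg_left ?_ hL.le
        linarith
    _ = _ := by ring

/-- The distance of a curve to the axis, for the dual norm, is controlled by its `H¹` norm. -/
theorem IsTubeCoordinates.exists_starNorm_sq_le (h : IsTubeCoordinates Ω γ L δ Φ) (hL : 0 < L) :
    ∃ C ≥ 0, ∀ s v w z ζ, IsTubeCurve δ L v w z ζ → IsNearAxis Φ δ L 1 s v w z ζ →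
      starNorm Ω (curveCurrent Ω (fun t => Φ (v t, z t)) 0 L - curveCurrent Ω γ 0 L) ^ 2
        ≤ C * (‖v 0‖ ^ 2 + ∫ t in 0..L, ‖w t‖ ^ 2) := by
  obtain ⟨C, hC, hb⟩ := h.exists_fieldForm_bound hL
  obtain ⟨κ, hκ, hlow⟩ := h.exists_tubeD_lower_bound hL
  refine ⟨L * (2 * (2 / κ * C) ^ 2 * (2 + 2 * L) * L + 2 * C ^ 2), by positivity,
    fun s v w z ζ hc hn => starNorm_sq_le fun B hB => ?_⟩
  obtain ⟨i1, h1⟩ := hc.integral_sq_le hL (2 / κ * C) C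
  refine le_trans (sq_le_sq.mpr ?_) h1
  refine le_trans ?_ (le_abs_self _)
  have hcont : ContinuousOn (fun z => fieldForm Ω B Φ δ L (0, z) vert) (Icc 0 L) := by
    have : ContinuousOn (fun z => ⟪toFun Ω B (Φ (0, z)), tubeD Φ δ L (0, z) vert⟫) (Icc 0 L) :=
      ((continuousOn_toFun B).comp (continuousOn_axis h.radius_pos.le h.smooth.continuousOn)
        fun z hz => h.mapsTo (axis_mem_cylinder h.radius_pos.le hz)).inner
        ((continuousOn_axis h.radius_pos.le (h.contDiffOn_tubeD hL).continuousOn).clm_apply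
          continuousOn_const)
    exact this
  have hγm : MapsTo γ (Icc 0 L) (closure Ω.carrier) := fun z hz => by
    rw [← h.axis z hz]; exact h.mapsTo (axis_mem_cylinder h.radius_pos.le hz)
  have hγ : curveCurrent Ω γ 0 L B = ∫ t in 0..L, ζ t * fieldForm Ω B Φ δ L (0, z t) vert := by
    rw [hc.integral_comp hL.le hcont, Isoflux.curveCurrent_apply (h.axis_primitive hL.le) hL.le hγm]
    refine intervalIntegral.integral_congr fun t ht => ?_
    rw [uIcc_of_le hL.le] at ht
    rw [fieldForm_apply, h.axis t ht]
  have i2 : IntervalIntegrable (fun t => fieldForm Ω B Φ δ L (v t, z t) (w t, ζ t)) volume 0 L :=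
    (h.curve hL.le hc).intervalIntegrable_inner hL.le (h.mapsTo_curve hc) B
  have i3 : IntervalIntegrable (fun t => ζ t * fieldForm Ω B Φ δ L (0, z t) vert) volume 0 L := by
    have := intervalIntegrable_mul_of_continuousOn hL.le
      (hcont.comp (hc.continuousOn_right hL.le) hc.mapsTo_right) hc.vertical.integrable
    simpa only [mul_comm, Function.comp_apply] using this
  rw [sub_apply, h.curveCurrent_apply hL.le hc, hγ, ← intervalIntegral.integral_sub i2 i3,
    ← Real.norm_eq_abs]
  refine intervalIntegral.norm_integral_le_of_norm_le hL.le ?_ i1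
  have hs : s ≤ 2 := by
    have := (abs_lt.mp hn.speed).2
    linarith
  filter_upwards [(ae_restrict_iff' measurableSet_Ioc).mp hn.bound] with t hbt ht
  have hp := hc.mem t (Ioc_subset_Icc_self ht)
  obtain ⟨b1, b2⟩ := hb B hB _ _ hp
  have hζ : |ζ t| ≤ 2 / κ := by
    rw [le_div_iff₀ hκ, mul_comm]
    have e1 := (hlow _ hp (w t, ζ t)).trans ((hbt ht).trans hs)
    have e2 : |ζ t| ≤ ‖((w t, ζ t) : E2 × ℝ)‖ := by
      rw [Prod.norm_def, ← Real.norm_eq_abs]; exact le_max_right _ _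
    exact (mul_le_mul_of_nonneg_left e2 hκ.le).trans e1
  have e : fieldForm Ω B Φ δ L (v t, z t) (w t, ζ t) - ζ t * fieldForm Ω B Φ δ L (0, z t) vert
      = ζ t * (fieldForm Ω B Φ δ L (v t, z t) vert - fieldForm Ω B Φ δ L (0, z t) vert)
        + fieldForm Ω B Φ δ L (v t, z t) (horiz (w t)) := by
    rw [pair_eq (w t) (ζ t), map_add, map_smul, smul_eq_mul]; ring
  rw [e, Real.norm_eq_abs]
  refine (abs_add_le _ _).trans (add_le_add ?_ (b2 (w t)))
  rw [abs_mul, mul_assoc]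
  exact mul_le_mul hζ b1 (abs_nonneg _) (by positivity)

/-- The nondegeneracy estimate for curves in a thin tube: the deficit dominates the `H¹` norm by
coercivity, and the `H¹` norm dominates the dual norm. -/
theorem IsDeficitTube.exists_local_estimate {B : C(Ω.Closure, E3)} {δ' m : ℝ}
    (h : IsDeficitTube Ω B γ L δ δ' m Φ) (hm : 0 < m)
    (hsup : ∀ T ∈ normalCurrents Ω, T B ≤ m * ‖T‖)
    (hQ : ∀ u : ℝ → E2, IsH1 L u → (∃ z ∈ Icc 0 L, u z ≠ 0) → 0 < Q Ω B Φ L u) :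
    ∃ α > 0, ∃ η > 0, ∀ s v w z ζ, IsTubeCurve δ' L v w z ζ → IsNearAxis Φ δ L η s v w z ζ →
      α * starNorm Ω (curveCurrent Ω (fun t => Φ (v t, z t)) 0 L - curveCurrent Ω γ 0 L) ^ 2
        ≤ m * (s * L) - curveCurrent Ω (fun t => Φ (v t, z t)) 0 L B := by
  have hL := h.arc.length_pos
  obtain ⟨c, hc, hcoer⟩ := h.exists_coercive_quadForm hm hsup hQ
  obtain ⟨K, hK⟩ := h.exists_deficit_ge hm.le fun z hz => h.axisLin_eq_zero hm.le hsup hz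
  obtain ⟨C, hC, hstar⟩ := h.coords.exists_starNorm_sq_le hL
  set ε := min (1 / 2) (c / (4 * (|K| + 1))) with hε
  have hε0 : 0 < ε := by positivity
  obtain ⟨η, hη, H⟩ := hK ε hε0 (min_le_left _ _)
  refine ⟨c / (4 * (C + 1)), by positivity, min 1 η, lt_min one_pos hη,
    fun s v w z ζ hcv hn => ?_⟩
  have h1 := hstar s v w z ζ (hcv.mono h.radius_lt.le) (hn.mono (min_le_left _ _))
  have h2 := H s v w z ζ hcv (hn.mono (min_le_right _ _))
  have h3 := hcoer v w hcv.sobolev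
  set E := ‖v 0‖ ^ 2 + ∫ t in 0..L, ‖w t‖ ^ 2 with hE
  have hE0 : 0 ≤ E := add_nonneg (sq_nonneg _)
    (intervalIntegral.integral_nonneg hL.le fun _ _ => by positivity)
  have h4 : ε * (K * E) ≤ c / 4 * E := by
    have h5 : ε * (|K| + 1) ≤ c / 4 := by
      calc ε * (|K| + 1) ≤ c / (4 * (|K| + 1)) * (|K| + 1) := by
            gcongr; exact min_le_right _ _
        _ = c / 4 := by field_simp
    have h6 : ε * K ≤ ε * (|K| + 1) :=
      mul_le_mul_of_nonneg_left (by linarith [le_abs_self K]) hε0.le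
    rw [← mul_assoc]
    exact mul_le_mul_of_nonneg_right (h6.trans h5) hE0
  have h7 : c / (4 * (C + 1)) * starNorm Ω (curveCurrent Ω (fun t => Φ (v t, z t)) 0 L
      - curveCurrent Ω γ 0 L) ^ 2 ≤ c / 4 * E := by
    calc _ ≤ c / (4 * (C + 1)) * (C * E) := by gcongr
      _ ≤ c / (4 * (C + 1)) * ((C + 1) * E) := by gcongr; linarith
      _ = c / 4 * E := by field_simp
  linarith

end

end

/-! ### Boundaries of currents -/

section

theorem exists_bump (a : E3) {r : ℝ} (hr : 0 < r) :
    ∃ φ : E3 → ℝ, ContDiff ℝ ∞ φ ∧ HasCompactSupport φ ∧ (∀ x, 0 ≤ φ x) ∧ (∀ x, φ x ≤ 1) ∧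
      φ a = 1 ∧ ∀ x, r ≤ dist x a → φ x = 0 := by
  let f : ContDiffBump a := ⟨r / 2, r, half_pos hr, half_lt_self hr⟩
  exact ⟨f, f.contDiff, f.hasCompactSupport, fun x => f.nonneg, fun x => f.le_one,
    f.one_of_mem_closedBall (Metric.mem_closedBall_self (half_pos hr).le),
    fun x hx => f.zero_of_le_dist hx⟩

/-- If `δ_x - δ_y = c (δ_a - δ_b)` with `a ≠ b` and `c > 0`, then `x = a`, `y = b` and `c = 1`. -/
theorem endpoints_eq {a b x y : E3} {c : ℝ} (hab : a ≠ b) (hc : 0 < c)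
    (h : ∀ φ : E3 → ℝ, ContDiff ℝ ∞ φ → HasCompactSupport φ → φ x - φ y = c * (φ a - φ b)) :
    x = a ∧ y = b ∧ c = 1 := by
  have hd : 0 < dist a b := dist_pos.mpr hab
  have hx : x = a := by
    by_contra hne
    obtain ⟨φ, h1, h2, h3, -, h4, h5⟩ := exists_bump a (lt_min hd (dist_pos.mpr hne))
    have := h φ h1 h2
    rw [h4, h5 x (min_le_right _ _), h5 b ((min_le_left _ _).trans_eq (dist_comm a b))] at this
    linarith [h3 y]
  have hy : y = b := by
    by_contra hne
    obtain ⟨φ, h1, h2, h3, -, h4, h5⟩ := exists_bump b (lt_min hd (dist_pos.mpr hne))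
    have := h φ h1 h2
    rw [h4, h5 y (min_le_right _ _), h5 a (min_le_left _ _)] at this
    linarith [h3 x]
  refine ⟨hx, hy, ?_⟩
  obtain ⟨φ, h1, h2, h3, -, h4, h5⟩ := exists_bump a hd
  have := h φ h1 h2
  rw [hx, hy, h4, h5 b (dist_comm a b).le] at this
  linarith

section

variable {Ω : SmoothDomain} {B : C(Ω.Closure, E3)} {Γ₀ : FiniteMassCurrent Ω}

/-- A maximizing sequence whose boundaries, relative to the mass, tend to zero has a weak limit,
after normalization, which is a maximizer without boundary; this contradicts uniqueness, as the
boundary of `Γ₀` is not zero. -/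
theorem MaximizesRatio.false_of_boundary_tendsto_zero (hmax : MaximizesRatio Ω B Γ₀)
    (hm : 0 < ratio Ω B Γ₀) (hunique : ∀ T, MaximizesRatio Ω B T → ∃ c : ℝ, T = c • Γ₀)
    (hΓ₀ : ∃ (φ : E3 → ℝ) (hφ : ContDiff ℝ ∞ φ), HasCompactSupport φ ∧
      Γ₀ (gradField Ω φ hφ) ≠ 0) {𝒰 : Ultrafilter ℕ} {T : ℕ → FiniteMassCurrent Ω}
    (hR : Tendsto (fun n => ratio Ω B (T n)) 𝒰 (𝓝 (ratio Ω B Γ₀)))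
    (hbd : ∀ (φ : E3 → ℝ) (hφ : ContDiff ℝ ∞ φ), HasCompactSupport φ →
      Tendsto (fun n => T n (gradField Ω φ hφ) / ‖T n‖) 𝒰 (𝓝 0)) : False := by
  obtain ⟨S, hS1, hS⟩ := exists_weak_limit 𝒰 (T := fun n => ‖T n‖⁻¹ • T n) fun n => by
    rw [norm_smul, norm_inv, norm_norm]
    exact inv_mul_le_one
  have happ : ∀ n B', (‖T n‖⁻¹ • T n) B' = T n B' / ‖T n‖ := fun n B' => by
    rw [smul_apply, smul_eq_mul, div_eq_inv_mul]
  simp only [happ] at hS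
  have hSB : S B = ratio Ω B Γ₀ := tendsto_nhds_unique (hS B) hR
  have hSb : ∀ (φ : E3 → ℝ) (hφ : ContDiff ℝ ∞ φ), HasCompactSupport φ →
      S (gradField Ω φ hφ) = 0 := fun φ hφ hc => tendsto_nhds_unique (hS _) (hbd φ hφ hc)
  have hSN : S ∈ normalCurrents Ω :=
    ⟨⟨0, fun φ hφ hc _ => (hSb φ hφ hc).le⟩, fun φ hφ hc _ => hSb φ hφ hc⟩
  have hS0 : S ≠ 0 := by
    rintro rfl
    rw [zero_apply] at hSB
    exact hm.ne hSB
  have hnorm : ‖S‖ = 1 := by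
    refine le_antisymm hS1 ?_
    have := hmax.apply_le hSN
    rw [hSB] at this
    exact le_of_mul_le_mul_left (by rwa [mul_one]) hm
  have hratio : ratio Ω B S = ratio Ω B Γ₀ := by rw [ratio, hnorm, div_one, hSB]
  obtain ⟨c, hc⟩ := hunique S ⟨hSN, hS0, fun T' hT' h0 => by rw [hratio]; exact hmax.2.2 T' hT' h0⟩
  obtain ⟨φ, hφ, hφc, hne⟩ := hΓ₀
  have := hSb φ hφ hφc
  rw [hc, smul_apply, smul_eq_mul] at this
  rcases mul_eq_zero.mp this with rfl | h0
  · exact hS0 (by rw [hc, zero_smul])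
  · exact hne h0

/-- A short arc between two points of the boundary has a small ratio, because the field is normal
to the boundary while the chord is almost tangent to it. -/
theorem exists_radius_short_arc (hB : IsNormalOnBoundary Ω B) {x : E3}
    (hx : x ∈ frontier Ω.carrier) {ε : ℝ} (hε : 0 < ε) :
    ∃ r > 0, ∀ (γ : ℝ → E3) (s : ℝ≥0) (L : ℝ), 0 ≤ L → LipschitzOnWith s γ (Icc 0 L) →
      MapsTo γ (Icc 0 L) (closure Ω.carrier) → γ 0 ∈ frontier Ω.carrier →
      γ L ∈ frontier Ω.carrier → (∀ t ∈ Icc 0 L, ‖γ t - x‖ < r) →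
      |curveCurrent Ω γ 0 L B| ≤ ε * (s * L) := by
  obtain ⟨ρ, hρ⟩ := Ω.smooth_boundary x hx
  set D := fderiv ℝ ρ x with hD
  obtain ⟨c, hc⟩ : ∃ c : ℝ, ∀ ξ, ⟪toFun Ω B x, ξ⟫ = c * D ξ := by
    have hn : D (gradient ρ x) ≠ 0 := by
      rw [hD, ← inner_gradient, real_inner_self_eq_norm_sq]
      exact pow_ne_zero 2 (norm_ne_zero_iff.mpr hρ.2.1)
    refine ⟨⟪toFun Ω B x, gradient ρ x⟫ / D (gradient ρ x), fun ξ => ?_⟩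
    have h1 : D (ξ - (D ξ / D (gradient ρ x)) • gradient ρ x) = 0 := by
      rw [map_sub, map_smul, smul_eq_mul, div_mul_cancel₀ _ hn, sub_self]
    have h2 := inner_eq_zero_of_tangent hB hx hρ h1
    rw [inner_sub_right, real_inner_smul_right, sub_eq_zero] at h2
    rw [h2]; ring
  have hε₂ : 0 < ε / (2 * (|c| + 1)) := by positivity
  obtain ⟨r₁, hr₁, H₁⟩ := exists_uniform_toFun B (show 0 < ε / 4 by positivity)
  have hstrict := ((hρ.1.contDiffAt (x := x)).hasStrictFDerivAt (by simp)).isLittleO.def hε₂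
  obtain ⟨r₂, hr₂, H₂⟩ := Metric.eventually_nhds_iff.mp hstrict
  obtain ⟨r₃, hr₃, H₃⟩ := Metric.eventually_nhds_iff.mp hρ.eventually_eq_zero
  refine ⟨min (r₁ / 2) (min r₂ r₃), by positivity, fun γ s L hL hs hm h0 h1 hr => ?_⟩
  have hr1 : ∀ t ∈ Icc 0 L, ‖γ t - x‖ < r₁ / 2 := fun t ht =>
    (hr t ht).trans_le (min_le_left _ _)
  have hr2 : ∀ t ∈ Icc 0 L, dist (γ t) x < r₂ := fun t ht => by
    rw [dist_eq_norm]
    exact (hr t ht).trans_le ((min_le_right _ _).trans (min_le_left _ _))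
  have hr3 : ∀ t ∈ Icc 0 L, dist (γ t) x < r₃ := fun t ht => by
    rw [dist_eq_norm]
    exact (hr t ht).trans_le ((min_le_right _ _).trans (min_le_right _ _))
  have hz : (0 : ℝ) ∈ Icc 0 L := ⟨le_rfl, hL⟩
  have hl : L ∈ Icc 0 L := ⟨hL, le_rfl⟩
  have hp := IsPrimitiveOn.of_lipschitzOnWith hL hs
  have hlen := integral_norm_deriv_le hL hs
  rw [sub_zero] at hlen
  have hsum := abs_curveCurrent_sub_sum_le hp hL hm B (ε := ε / 4) (N := 1)
    (t := fun i => i * L) (fun i j hij => by simp only; gcongr) (by simp) (by simp)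
    (fun i hi t ht => by
      obtain rfl : i = 0 := by omega
      simp only [Nat.cast_zero, zero_mul, zero_add, Nat.cast_one, one_mul] at ht ⊢
      refine H₁ _ (hm ht) _ (hm hz) ?_
      have h3 := norm_sub_le_norm_sub_add_norm_sub (γ t) x (γ 0)
      rw [norm_sub_rev x] at h3
      linarith [hr1 t ht, hr1 0 hz])
  rw [Finset.sum_range_one] at hsum
  simp only [Nat.cast_zero, zero_mul, zero_add, Nat.cast_one, one_mul] at hsum
  have hchord : ‖γ L - γ 0‖ ≤ s * L := by
    have := hs.dist_le_mul _ hl _ hz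
    rwa [dist_eq_norm, Real.dist_eq, sub_zero, abs_of_nonneg hL] at this
  have hsL : 0 ≤ (s : ℝ) * L := (norm_nonneg _).trans hchord
  have b1 : |⟪toFun Ω B (γ 0) - toFun Ω B x, γ L - γ 0⟫| ≤ ε / 4 * (s * L) := by
    refine (abs_real_inner_le_norm _ _).trans (mul_le_mul ?_ hchord (norm_nonneg _) (by positivity))
    refine H₁ _ (hm hz) _ (frontier_subset_closure hx) ?_
    linarith [hr1 0 hz]
  have b2 : |⟪toFun Ω B x, γ L - γ 0⟫| ≤ ε / 2 * (s * L) := by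
    have h4 := H₂ (y := (γ L, γ 0)) (by
      rw [Prod.dist_eq]; exact max_lt (hr2 L hl) (hr2 0 hz))
    simp only [H₃ (hr3 L hl) h1, H₃ (hr3 0 hz) h0, sub_self, zero_sub, norm_neg,
      Real.norm_eq_abs] at h4
    rw [hc, abs_mul]
    calc |c| * |D (γ L - γ 0)| ≤ (|c| + 1) * (ε / (2 * (|c| + 1)) * (s * L)) := by
          refine mul_le_mul (by linarith) (h4.trans ?_) (abs_nonneg _) (by positivity)
          gcongr
      _ = ε / 2 * (s * L) := by field_simp
  have b3 : ε / 4 * ∫ t in 0..L, ‖deriv γ t‖ ≤ ε / 4 * (s * L) := by gcongr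
  rw [inner_sub_left] at b1
  rw [abs_le] at *
  constructor <;> linarith [b1.1, b1.2, b2.1, b2.2, hsum.1, hsum.2]

end

end

/-! ### Lifting curves to the tube -/

section

section

variable {Ω : SmoothDomain} {γ : ℝ → E3} {L δ : ℝ} {Φ : E2 × ℝ → E3}

theorem norm_deriv_le_ae {E : Type*} [NormedAddCommGroup E] [NormedSpace ℝ E] {p : ℝ → E}
    {a b : ℝ} {K : ℝ≥0} (h : LipschitzOnWith K p (Icc a b)) :
    ∀ᵐ t ∂volume.restrict (Ioc a b), ‖deriv p t‖ ≤ K :=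
  ae_restrict_Ioc_of_Ioo
    (Eventually.of_forall fun _ ht => norm_deriv_le_of_lipschitzOnWith_Icc h ht)

theorem isSobolev_of_lipschitzOnWith (hL : 0 ≤ L) {v : ℝ → E2} {K : ℝ≥0}
    (h : LipschitzOnWith K v (Icc 0 L)) : IsSobolev L v (deriv v) := by
  have hp := IsPrimitiveOn.of_lipschitzOnWith hL h
  exact ⟨MemLp.of_bound (hp.integrableOn hL).aestronglyMeasurable K (norm_deriv_le_ae h), hp⟩

/-- A Lipschitz curve with values in the image of the tube is a tube curve, with the same bound on
the speed. -/
theorem IsTubeCoordinates.exists_lift (h : IsTubeCoordinates Ω γ L δ Φ) (hL : 0 < L)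
    {γ₁ : ℝ → E3} {s : ℝ≥0} (hs : LipschitzOnWith s γ₁ (Icc 0 L)) {v : ℝ → E2} {z : ℝ → ℝ}
    (hp : ∀ t ∈ Icc 0 L, (v t, z t) ∈ cylinder δ L)
    (hΦ : ∀ t ∈ Icc 0 L, Φ (v t, z t) = γ₁ t) (h0 : z 0 = 0) (h1 : z L = L) :
    ∃ w ζ, IsTubeCurve δ L v w z ζ ∧
      ∀ᵐ t ∂volume.restrict (Ioc 0 L), ‖tubeD Φ δ L (v t, z t) (w t, ζ t)‖ ≤ s := by
  obtain ⟨κ, hκ, hexp⟩ := h.exists_expansion hL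
  have hlip : LipschitzOnWith (s / κ.toNNReal) (fun t => (v t, z t)) (Icc 0 L) := by
    refine LipschitzOnWith.of_dist_le_mul fun x hx y hy => ?_
    have e1 := hexp _ (hp x hx) _ (hp y hy)
    rw [hΦ x hx, hΦ y hy, ← dist_eq_norm, ← dist_eq_norm] at e1
    have e2 := e1.trans (hs.dist_le_mul x hx y hy)
    rw [NNReal.coe_div, Real.coe_toNNReal κ hκ.le, div_mul_eq_mul_div, le_div_iff₀ hκ, mul_comm]
    exact e2
  have hv : LipschitzOnWith (1 * (s / κ.toNNReal)) v (Icc 0 L) :=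
    LipschitzWith.prod_fst.comp_lipschitzOnWith hlip
  have hz : LipschitzOnWith (1 * (s / κ.toNNReal)) z (Icc 0 L) :=
    LipschitzWith.prod_snd.comp_lipschitzOnWith hlip
  have hc : IsTubeCurve δ L v (deriv v) z (deriv z) :=
    ⟨isSobolev_of_lipschitzOnWith hL.le hv, IsPrimitiveOn.of_lipschitzOnWith hL.le hz, hp, h0, h1⟩
  refine ⟨deriv v, deriv z, hc, ?_⟩
  have hd := ((h.curve hL.le hc).congr_left hL.le fun t ht => (hΦ t ht).symm).deriv_ae_eq hL.le
  filter_upwards [hd, norm_deriv_le_ae hs] with t e1 e2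
  rwa [← e1]

/-- A curve from `∂Ω` to `∂Ω` which is close to the axis is a tube curve. -/
theorem IsTubeCoordinates.exists_tubeCurve_of_close (h : IsTubeCoordinates Ω γ L δ Φ)
    (hγ : IsSmoothSimpleArc Ω γ L) {δ' η : ℝ} (hδ' : 0 < δ') (hδδ' : δ' < δ) (hη : 0 < η) :
    ∃ r > 0, ∀ (γ₁ : ℝ → E3) (s : ℝ≥0), LipschitzOnWith s γ₁ (Icc 0 L) →
      MapsTo γ₁ (Icc 0 L) (closure Ω.carrier) → γ₁ 0 ∈ frontier Ω.carrier →
      γ₁ L ∈ frontier Ω.carrier → |(s : ℝ) - 1| < r → (∀ t ∈ Icc 0 L, ‖γ₁ t - γ t‖ < r) →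
      ∃ v w z ζ, IsTubeCurve δ' L v w z ζ ∧ IsNearAxis Φ δ L η s v w z ζ ∧
        EqOn γ₁ (fun t => Φ (v t, z t)) (Icc 0 L) := by
  have hL := hγ.length_pos
  obtain ⟨κ, hκ, hexp⟩ := h.exists_expansion hL
  obtain ⟨U, hU, hγU, hUΦ⟩ := h.nhd
  obtain ⟨ε, hε, hthick⟩ := (isCompact_Icc.image_of_continuousOn
    hγ.smooth.continuousOn).exists_thickening_subset_open hU hγU
  set μ := min η (min δ' (L / 2)) with hμ
  have hμ0 : 0 < μ := by positivity
  refine ⟨min ε (min (κ * μ) η), by positivity, fun γ₁ s hs hm h0 h1 hs1 hr => ?_⟩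
  have hex : ∀ t, t ∈ Icc 0 L → ∃ p ∈ cylinder δ L, Φ p = γ₁ t := fun t ht => by
    refine hUΦ ⟨hthick ?_, hm ht⟩
    rw [Metric.mem_thickening_iff]
    refine ⟨γ t, mem_image_of_mem γ ht, ?_⟩
    rw [dist_eq_norm]
    exact (hr t ht).trans_le (min_le_left _ _)
  choose! p hp hΦ using hex
  have hclose : ∀ t ∈ Icc 0 L, ‖p t - (0, t)‖ < μ := fun t ht => by
    have e1 := hexp _ (hp t ht) _ (axis_mem_cylinder h.radius_pos.le ht)
    rw [hΦ t ht, h.axis t ht] at e1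
    have e2 := (hr t ht).trans_le ((min_le_right _ _).trans (min_le_left _ _))
    exact lt_of_mul_lt_mul_left (e1.trans_lt e2) hκ.le
  have hv : ∀ t ∈ Icc 0 L, ‖(p t).1‖ < μ := fun t ht => by
    refine lt_of_le_of_lt ?_ (hclose t ht)
    have := norm_fst_le (p t - (0, t))
    rwa [Prod.fst_sub, sub_zero] at this
  have hz : ∀ t ∈ Icc 0 L, |(p t).2 - t| < μ := fun t ht => by
    refine lt_of_le_of_lt ?_ (hclose t ht)
    have := norm_snd_le (p t - (0, t))
    rwa [Prod.snd_sub, Real.norm_eq_abs] at this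
  have hμη : μ ≤ η := min_le_left _ _
  have hμδ : μ ≤ δ' := (min_le_right _ _).trans (min_le_left _ _)
  have hμL : μ ≤ L / 2 := (min_le_right _ _).trans (min_le_right _ _)
  have hbase : ∀ t ∈ Icc 0 L, γ₁ t ∈ frontier Ω.carrier → (p t).2 = 0 ∨ (p t).2 = L :=
    fun t ht hf => h.eq_zero_or_eq_of_mem_frontier (v := (p t).1)
      ((hv t ht).trans (hμδ.trans_lt hδδ')) (hp t ht).2 (by rw [Prod.mk.eta, hΦ t ht]; exact hf)
  have hl : (0 : ℝ) ∈ Icc 0 L := ⟨le_rfl, hL.le⟩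
  have hr' : L ∈ Icc 0 L := ⟨hL.le, le_rfl⟩
  have e0 : (p 0).2 = 0 := (hbase 0 hl h0).resolve_right fun he => by
    have := (abs_lt.mp (hz 0 hl)).2
    rw [he] at this; linarith
  have e1 : (p L).2 = L := (hbase L hr' h1).resolve_left fun he => by
    have := (abs_lt.mp (hz L hr')).1
    rw [he] at this; linarith
  obtain ⟨w, ζ, hc, hb⟩ := h.exists_lift hL hs (v := fun t => (p t).1) (z := fun t => (p t).2)
    hp hΦ e0 e1
  exact ⟨_, w, _, ζ, ⟨hc.sobolev, hc.vertical, fun t ht => mem_cylinder.mpr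
    ⟨(hv t ht).le.trans hμδ, (hp t ht).2⟩, e0, e1⟩,
    ⟨fun t ht => (hv t ht).trans_le hμη, fun t ht => (hz t ht).trans_le hμη,
      hs1.trans_le ((min_le_right _ _).trans (min_le_right _ _)), hb⟩, fun t ht => (hΦ t ht).symm⟩

/-- A curve of speed at most `1` carrying the same current as the axis stays on the axis: a field
which extends the unit tangent vector of the axis, and is shorter elsewhere, has the circulation
`L` along the curve. -/
theorem IsTubeCoordinates.mem_image_of_current_eq (h : IsTubeCoordinates Ω γ L δ Φ)
    (hγ : IsSmoothSimpleArc Ω γ L) {γ₁ : ℝ → E3} (hs : LipschitzOnWith 1 γ₁ (Icc 0 L))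
    (hm : MapsTo γ₁ (Icc 0 L) (closure Ω.carrier))
    (he : curveCurrent Ω γ₁ 0 L = curveCurrent Ω γ 0 L) {t : ℝ} (ht : t ∈ Icc 0 L) :
    γ₁ t ∈ γ '' Icc 0 L := by
  have hL := hγ.length_pos
  have hnv : ∀ z ∈ Icc 0 L, ‖tubeD Φ δ L (0, z) vert‖ = 1 := fun z hz => h.norm_tubeD_axis hγ hz
  have hvel : ContinuousOn (fun z => tubeD Φ δ L (0, z) vert) (Icc 0 L) :=
    (continuousOn_axis h.radius_pos.le (h.contDiffOn_tubeD hL).continuousOn).clm_apply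
      continuousOn_const
  obtain ⟨B, hB1, hB⟩ := exists_field_extension hγ.smooth.continuousOn hγ.mapsTo hγ.simple hvel
    fun z hz => (hnv z hz).le
  have hK : IsClosed (γ '' Icc 0 L) :=
    (isCompact_Icc.image_of_continuousOn hγ.smooth.continuousOn).isClosed
  have hKne : (γ '' Icc 0 L).Nonempty := ⟨γ 0, mem_image_of_mem γ ⟨le_rfl, hL.le⟩⟩
  have hpos : ∀ x : E3, 0 < 1 + Metric.infDist x (γ '' Icc 0 L) := fun x => by
    have := Metric.infDist_nonneg (x := x) (s := γ '' Icc 0 L)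
    linarith
  let B' : C(Ω.Closure, E3) :=
    ⟨fun x => (1 + Metric.infDist (x : E3) (γ '' Icc 0 L))⁻¹ • B x, by
      have hc : Continuous fun x : Ω.Closure => 1 + Metric.infDist (x : E3) (γ '' Icc 0 L) :=
        continuous_const.add ((Metric.continuous_infDist_pt _).comp continuous_subtype_val)
      exact (hc.inv₀ fun x => (hpos x).ne').smul B.continuous⟩
  have hB' : ∀ x ∈ closure Ω.carrier,
      toFun Ω B' x = (1 + Metric.infDist x (γ '' Icc 0 L))⁻¹ • toFun Ω B x := fun x hx => by
    rw [toFun_of_mem B' hx, toFun_of_mem B hx]; rfl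
  have hB'1 : ∀ x ∈ closure Ω.carrier,
      ‖toFun Ω B' x‖ ≤ (1 + Metric.infDist x (γ '' Icc 0 L))⁻¹ := fun x hx => by
    rw [hB' x hx, norm_smul, norm_inv, Real.norm_eq_abs, abs_of_pos (hpos x)]
    exact mul_le_of_le_one_right (inv_nonneg.mpr (hpos x).le) ((toFun_norm_le Ω B x).trans hB1)
  have hle1 : ∀ x ∈ closure Ω.carrier, ‖toFun Ω B' x‖ ≤ 1 := fun x hx =>
    (hB'1 x hx).trans (inv_le_one_of_one_le₀ (by
      have := Metric.infDist_nonneg (x := x) (s := γ '' Icc 0 L)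
      linarith))
  have hval : curveCurrent Ω γ 0 L B' = L := by
    rw [Isoflux.curveCurrent_apply (h.axis_primitive hL.le) hL.le hγ.mapsTo,
      intervalIntegral.integral_congr (g := fun _ => (1 : ℝ)) fun z hz => ?_]
    · simp
    · rw [uIcc_of_le hL.le] at hz
      change ⟪toFun Ω B' (γ z), tubeD Φ δ L (0, z) vert⟫ = 1
      rw [hB' _ (hγ.mapsTo hz), hB z hz, Metric.infDist_zero_of_mem (mem_image_of_mem γ hz),
        add_zero, inv_one, one_smul, real_inner_self_eq_norm_sq, hnv z hz, one_pow]
  have hp := IsPrimitiveOn.of_lipschitzOnWith hL.le hs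
  have hcont : ContinuousOn (fun t => ‖toFun Ω B' (γ₁ t)‖) (Icc 0 L) :=
    ((continuousOn_toFun B').comp hs.continuousOn hm).norm
  have hupper : curveCurrent Ω γ₁ 0 L B' ≤ ∫ t in 0..L, ‖toFun Ω B' (γ₁ t)‖ := by
    rw [Isoflux.curveCurrent_apply hp hL.le hm]
    refine intervalIntegral.integral_mono_ae_restrict hL.le
      (hp.intervalIntegrable_inner hL.le hm B')
      (ContinuousOn.intervalIntegrable_of_Icc hL.le hcont) ?_
    rw [← restrict_Ioc_eq_restrict_Icc]
    filter_upwards [norm_deriv_le_ae hs] with t hd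
    exact (real_inner_le_norm _ _).trans
      (mul_le_of_le_one_right (norm_nonneg _) (by simpa using hd))
  have hint : ∫ t in 0..L, (1 - ‖toFun Ω B' (γ₁ t)‖) ≤ 0 := by
    rw [intervalIntegral.integral_sub intervalIntegrable_const
      (ContinuousOn.intervalIntegrable_of_Icc hL.le hcont), intervalIntegral.integral_const,
      sub_zero, smul_eq_mul, mul_one]
    rw [he, hval] at hupper
    linarith
  by_contra hnot
  refine absurd hint (not_le.mpr (intervalIntegral.integral_pos hL (continuousOn_const.sub hcont)
    (fun x hx => sub_nonneg.mpr (hle1 _ (hm (Ioc_subset_Icc_self hx)))) ⟨t, ht, ?_⟩))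
  have hd : 0 < Metric.infDist (γ₁ t) (γ '' Icc 0 L) :=
    (hK.notMem_iff_infDist_pos hKne).mp hnot
  have h1 : (1 + Metric.infDist (γ₁ t) (γ '' Icc 0 L))⁻¹ < 1 := inv_lt_one_of_one_lt₀ (by linarith)
  linarith [hB'1 _ (hm ht)]

/-- A curve of speed at most `1` carrying the same current as the axis, with the same endpoints,
coincides with the axis. -/
theorem IsTubeCoordinates.eqOn_of_current_eq (h : IsTubeCoordinates Ω γ L δ Φ)
    (hγ : IsSmoothSimpleArc Ω γ L) {γ₁ : ℝ → E3} (hs : LipschitzOnWith 1 γ₁ (Icc 0 L))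
    (hm : MapsTo γ₁ (Icc 0 L) (closure Ω.carrier))
    (he : curveCurrent Ω γ₁ 0 L = curveCurrent Ω γ 0 L) (h0 : γ₁ 0 = γ 0) (h1 : γ₁ L = γ L) :
    EqOn γ₁ γ (Icc 0 L) := by
  have hL := hγ.length_pos
  have hl : (0 : ℝ) ∈ Icc 0 L := ⟨le_rfl, hL.le⟩
  have hr : L ∈ Icc 0 L := ⟨hL.le, le_rfl⟩
  have hex : ∀ t, t ∈ Icc 0 L → ∃ z ∈ Icc 0 L, γ z = γ₁ t := fun t ht =>
    h.mem_image_of_current_eq hγ hs hm he ht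
  choose! z hz hγz using hex
  have e0 : z 0 = 0 := hγ.simple (hz 0 hl) hl ((hγz 0 hl).trans h0)
  have e1 : z L = L := hγ.simple (hz L hr) hr ((hγz L hr).trans h1)
  obtain ⟨w, ζ, hc, hb⟩ := h.exists_lift hL hs (v := fun _ => 0) (z := z)
    (fun t ht => axis_mem_cylinder h.radius_pos.le (hz t ht))
    (fun t ht => (h.axis _ (hz t ht)).trans (hγz t ht)) e0 e1
  have hζ : ∀ᵐ t ∂volume.restrict (Icc 0 L), ζ t ≤ 1 := by
    rw [← restrict_Ioc_eq_restrict_Icc]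
    filter_upwards [hb, ae_restrict_mem measurableSet_Ioc] with t hbt ht
    have hzt := hz t (Ioc_subset_Icc_self ht)
    have := h.norm_tubeD_sq (axis_mem_cylinder h.radius_pos.le hzt) (w t) (ζ t)
    rw [h.norm_tubeD_axis hγ hzt, one_mul] at this
    rw [NNReal.coe_one] at hbt
    nlinarith [sq_nonneg ‖tubeD Φ δ L (0, z t) (horiz (w t))‖,
      norm_nonneg (tubeD Φ δ L (0, z t) (w t, ζ t))]
  -- as `z` moves from `0` to `L` in time `L` with speed at most `1`, it is the identity
  have hinc : ∀ x ∈ Icc 0 L, ∀ y ∈ Icc 0 L, x ≤ y → z y - z x ≤ y - x := by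
    intro x hx y hy hxy
    rw [hc.vertical.sub_eq hL.le hx hy]
    calc ∫ s in x..y, ζ s ≤ ∫ s in x..y, (1 : ℝ) := by
          refine intervalIntegral.integral_mono_ae_restrict hxy
            (hc.vertical.integrable.mono_set ?_) intervalIntegrable_const
            (ae_restrict_of_ae_restrict_of_subset (Icc_subset_Icc hx.1 hy.2) hζ)
          rw [uIcc_of_le hxy, uIcc_of_le hL.le]
          exact Icc_subset_Icc hx.1 hy.2
      _ = y - x := by simp
  intro t ht
  have i1 := hinc 0 hl t ht ht.1
  have i2 := hinc t ht L hr ht.2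
  rw [e0] at i1
  rw [e1] at i2
  rw [← hγz t ht, show z t = t by linarith]

end

end

/-! ### Compactness of maximizing sequences -/

section

/-- The curve `γ : [0, L] → Ω̄` joins two points of `∂Ω` with speed at most `s`. -/
structure IsBoundaryArc (Ω : SmoothDomain) (γ : ℝ → E3) (L : ℝ) (s : ℝ≥0) : Prop where
  lipschitz : LipschitzOnWith s γ (Icc 0 L)
  mapsTo : MapsTo γ (Icc 0 L) (closure Ω.carrier)
  left : γ 0 ∈ frontier Ω.carrier
  right : γ L ∈ frontier Ω.carrier

namespace IsBoundaryArc

variable {Ω : SmoothDomain} {γ : ℝ → E3} {L : ℝ} {s : ℝ≥0}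

theorem primitive (h : IsBoundaryArc Ω γ L s) (hL : 0 ≤ L) : IsPrimitiveOn γ (deriv γ) 0 L :=
  IsPrimitiveOn.of_lipschitzOnWith hL h.lipschitz

theorem mem_normalCurrents (h : IsBoundaryArc Ω γ L s) (hL : 0 ≤ L) :
    curveCurrent Ω γ 0 L ∈ normalCurrents Ω :=
  curveCurrent_mem_normalCurrents (h.primitive hL) hL h.mapsTo (Or.inl ⟨h.left, h.right⟩)

theorem norm_le (h : IsBoundaryArc Ω γ L s) (hL : 0 ≤ L) : ‖curveCurrent Ω γ 0 L‖ ≤ s * L := by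
  refine (norm_curveCurrent_le (h.primitive hL) hL h.mapsTo).trans ?_
  have := integral_norm_deriv_le hL h.lipschitz
  rwa [sub_zero] at this

end IsBoundaryArc

theorem IsSmoothSimpleArc.isBoundaryArc {Ω : SmoothDomain} {γ : ℝ → E3} {L : ℝ}
    (h : IsSmoothSimpleArc Ω γ L) : ∃ s, IsBoundaryArc Ω γ L s := by
  obtain ⟨s, hs⟩ := h.smooth.exists_lipschitzOnWith (by simp) (convex_Icc 0 L) isCompact_Icc
  exact ⟨s, hs, h.mapsTo, h.left_mem, h.right_mem⟩

section

variable {Ω : SmoothDomain} {L : ℝ}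

/-- A curve of the class `X` is a loop, without boundary, or an arc parametrized on `[0, L]` with
constant speed. -/
theorem mem_normalCurrents_and_cases (hL : 0 < L) {Γ : FiniteMassCurrent Ω}
    (hΓ : Γ ∈ simpleCurves Ω) : Γ ∈ normalCurrents Ω ∧
    ((∀ (φ : E3 → ℝ) (hφ : ContDiff ℝ ∞ φ), HasCompactSupport φ → Γ (gradField Ω φ hφ) = 0) ∨
      ∃ (γ : ℝ → E3) (s : ℝ≥0), 0 < s ∧ IsBoundaryArc Ω γ L s ∧ curveCurrent Ω γ 0 L = Γ ∧
        ‖Γ‖ = s * L) := by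
  obtain ⟨γ, a, b, hab, ⟨K, hK⟩, hm, hcase, rfl⟩ := hΓ
  have hp := IsPrimitiveOn.of_lipschitzOnWith hab.le hK
  rcases hcase with ⟨hinj, ha, hb⟩ | ⟨-, heq⟩
  · refine ⟨curveCurrent_mem_normalCurrents hp hab.le hm (Or.inl ⟨ha, hb⟩), Or.inr ?_⟩
    obtain ⟨γ₁, s, hs, h1, h2, h3, h4, h5, h6⟩ := exists_constant_speed hL hab hK hm hinj
    exact ⟨γ₁, s, hs, ⟨h1, h2, h3 ▸ ha, h4 ▸ hb⟩, h5, h6⟩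
  · refine ⟨curveCurrent_mem_normalCurrents hp hab.le hm (Or.inr heq), Or.inl ?_⟩
    intro φ hφ hc
    rw [curveCurrent_gradField hp hab.le hm hφ hc, heq, sub_self]

theorem MaximizesRatio.ratio_le {B : C(Ω.Closure, E3)} {Γ₀ T : FiniteMassCurrent Ω}
    (h : MaximizesRatio Ω B Γ₀) (hT : T ∈ normalCurrents Ω) : ratio Ω B T ≤ ratio Ω B Γ₀ := by
  rcases eq_or_ne T 0 with rfl | h0
  · have : ratio Ω B 0 = 0 := by simp [ratio]
    rw [this]; exact h.ratio_nonneg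
  · exact h.2.2 T hT h0

variable {γ : ℝ → E3} {δ : ℝ} {Φ : E2 × ℝ → E3} {B : C(Ω.Closure, E3)}

theorem IsSmoothSimpleArc.exists_gradField_ne_zero (hγ : IsSmoothSimpleArc Ω γ L) :
    ∃ (φ : E3 → ℝ) (hφ : ContDiff ℝ ∞ φ), HasCompactSupport φ ∧
      curveCurrent Ω γ 0 L (gradField Ω φ hφ) ≠ 0 := by
  have hL := hγ.length_pos
  obtain ⟨s, hs⟩ := hγ.isBoundaryArc
  have hne : γ 0 ≠ γ L := fun h => hL.ne (hγ.simple ⟨le_rfl, hL.le⟩ ⟨hL.le, le_rfl⟩ h)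
  obtain ⟨φ, hφ, hc, -, -, h1, h0⟩ := exists_bump (γ L) (dist_pos.mpr hne)
  refine ⟨φ, hφ, hc, ?_⟩
  rw [curveCurrent_gradField (hs.primitive hL.le) hL.le hs.mapsTo hφ hc, h1, h0 _ le_rfl]
  norm_num

/-- If a boundary arc carries a positive multiple of the current of the axis, then the two currents
agree, and so do the endpoints. -/
theorem IsBoundaryArc.eq_of_eq_smul (hγ : IsSmoothSimpleArc Ω γ L) {g : ℝ → E3} {s : ℝ≥0}
    (hg : IsBoundaryArc Ω g L s) {c : ℝ} (hc : 0 < c)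
    (h : curveCurrent Ω g 0 L = c • curveCurrent Ω γ 0 L) : c = 1 ∧ g 0 = γ 0 ∧ g L = γ L := by
  have hL := hγ.length_pos
  obtain ⟨s₀, hs₀⟩ := hγ.isBoundaryArc
  have hne : γ L ≠ γ 0 := fun h => hL.ne (hγ.simple ⟨le_rfl, hL.le⟩ ⟨hL.le, le_rfl⟩ h.symm)
  obtain ⟨h1, h2, h3⟩ := endpoints_eq (x := g L) (y := g 0) hne hc fun φ hφ hφc => by
    rw [← curveCurrent_gradField (hs₀.primitive hL.le) hL.le hs₀.mapsTo hφ hφc,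
      ← curveCurrent_gradField (hg.primitive hL.le) hL.le hg.mapsTo hφ hφc, h, smul_apply,
      smul_eq_mul]
  exact ⟨h3, h2, h1⟩

/-- An arc on which the ratio is maximal is the axis. -/
theorem IsBoundaryArc.eqOn_of_maximizes (hmax : MaximizesRatio Ω B (curveCurrent Ω γ 0 L))
    (hm : 0 < ratio Ω B (curveCurrent Ω γ 0 L))
    (hunique : ∀ T, MaximizesRatio Ω B T → ∃ c : ℝ, T = c • curveCurrent Ω γ 0 L)
    (hγ : IsSmoothSimpleArc Ω γ L) (hΦ : IsTubeCoordinates Ω γ L δ Φ) {g : ℝ → E3} {s : ℝ≥0}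
    (hs : 0 < s) (hg : IsBoundaryArc Ω g L s)
    (hval : curveCurrent Ω g 0 L B = ratio Ω B (curveCurrent Ω γ 0 L) * (s * L)) :
    s = 1 ∧ EqOn g γ (Icc 0 L) := by
  have hL := hγ.length_pos
  set m := ratio Ω B (curveCurrent Ω γ 0 L) with hmdef
  have hs' : (0 : ℝ) < s := hs
  have hTN := hg.mem_normalCurrents hL.le
  have hnorm : ‖curveCurrent Ω g 0 L‖ = s * L := by
    refine le_antisymm (hg.norm_le hL.le) ?_
    have := hmax.apply_le hTN
    rw [hval] at this
    exact le_of_mul_le_mul_left this hm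
  have hT0 : curveCurrent Ω g 0 L ≠ 0 := norm_pos_iff.mp (by rw [hnorm]; positivity)
  have hratio : ratio Ω B (curveCurrent Ω g 0 L) = m := by
    rw [ratio, hnorm, hval, mul_div_cancel_right₀ _ (by positivity)]
  obtain ⟨c, hc⟩ := hunique _ ⟨hTN, hT0, fun T hT h0 => by rw [hratio]; exact hmax.2.2 T hT h0⟩
  have hΓB : curveCurrent Ω γ 0 L B = m * L := by
    rw [hmdef, ratio, hΦ.norm_axis_current hγ, div_mul_cancel₀ _ hL.ne']
  have hcs : c = s := by
    have h1 : curveCurrent Ω g 0 L B = c * (m * L) := by rw [hc, smul_apply, smul_eq_mul, hΓB]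
    rw [hval] at h1
    have h2 : m * L * c = m * L * s := by linarith
    exact mul_left_cancel₀ (by positivity) h2
  obtain ⟨hc1, e0, e1⟩ := hg.eq_of_eq_smul hγ (hcs ▸ hs') hc
  have hs1 : s = 1 := by
    rw [hcs] at hc1
    exact_mod_cast hc1
  subst hs1
  exact ⟨rfl, hΦ.eqOn_of_current_eq hγ hg.lipschitz hg.mapsTo (by rw [hc, hc1, one_smul]) e0 e1⟩

/-- Subsequences of bounded speed converge, along an ultrafilter. -/
theorem exists_arc_limit (hL : 0 < L) {𝒰 : Ultrafilter ℕ} {g : ℕ → ℝ → E3} {s : ℕ → ℝ≥0} {M : ℝ≥0}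
    (hg : ∀ n, IsBoundaryArc Ω (g n) L (s n)) (hM : ∀ᶠ n in (𝒰 : Filter ℕ), s n ≤ M) :
    ∃ (g₁ : ℝ → E3) (s₁ : ℝ≥0), IsBoundaryArc Ω g₁ L s₁ ∧
      Tendsto (fun n => (s n : ℝ)) 𝒰 (𝓝 s₁) ∧
      (∀ B, Tendsto (fun n => curveCurrent Ω (g n) 0 L B) 𝒰 (𝓝 (curveCurrent Ω g₁ 0 L B))) ∧
      ∀ ε > 0, ∀ᶠ n in (𝒰 : Filter ℕ), ∀ t ∈ Icc 0 L, ‖g n t - g₁ t‖ ≤ ε := by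
  obtain ⟨s₁, hs₁, hs⟩ : ∃ s₁ ∈ Icc 0 M, (𝒰.map s : Filter ℝ≥0) ≤ 𝓝 s₁ :=
    isCompact_Icc.ultrafilter_le_nhds (𝒰.map s) (by
      rw [Ultrafilter.coe_map, le_principal_iff, mem_map]
      filter_upwards [hM] with n hn using ⟨zero_le, hn⟩)
  have hst : Tendsto (fun n => (s n : ℝ)) 𝒰 (𝓝 s₁) := (NNReal.tendsto_coe).mpr hs
  have hlim : ∀ t, t ∈ Icc 0 L → ∃ x ∈ closure Ω.carrier, Tendsto (fun n => g n t) 𝒰 (𝓝 x) :=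
    fun t ht => by
      obtain ⟨x, hx, hx'⟩ := Ω.isBounded.isCompact_closure.ultrafilter_le_nhds
        (𝒰.map fun n => g n t) (by
          rw [Ultrafilter.coe_map, le_principal_iff, mem_map]
          exact Eventually.of_forall fun n => (hg n).mapsTo ht)
      exact ⟨x, hx, hx'⟩
  choose! g₁ hg₁m hg₁ using hlim
  have hl : (0 : ℝ) ∈ Icc 0 L := ⟨le_rfl, hL.le⟩
  have hr : L ∈ Icc 0 L := ⟨hL.le, le_rfl⟩
  have hlip : LipschitzOnWith s₁ g₁ (Icc 0 L) := by
    refine LipschitzOnWith.of_dist_le_mul fun x hx y hy => ?_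
    exact le_of_tendsto_of_tendsto ((hg₁ x hx).dist (hg₁ y hy)) (hst.mul_const _)
      (Eventually.of_forall fun n => (hg n).lipschitz.dist_le_mul x hx y hy)
  have harc : IsBoundaryArc Ω g₁ L s₁ :=
    ⟨hlip, hg₁m, isClosed_frontier.mem_of_tendsto (hg₁ 0 hl) (Eventually.of_forall fun n =>
      (hg n).left), isClosed_frontier.mem_of_tendsto (hg₁ L hr) (Eventually.of_forall fun n =>
      (hg n).right)⟩
  refine ⟨g₁, s₁, harc, hst, fun B => ?_, fun ε hε => ?_⟩
  · exact tendsto_curveCurrent hL (Λ := M) (hM.mono fun n hn => (hg n).lipschitz.weaken hn)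
      (Eventually.of_forall fun n => (hg n).mapsTo) (hlip.weaken hs₁.2) hg₁m hg₁ B
  · have hδ : ∀ {f : ℝ → E3} {ε : ℝ}, 0 < ε → LipschitzOnWith M f (Icc 0 L) →
        ∀ x ∈ Icc 0 L, ∀ y ∈ Icc 0 L, |x - y| < ε / (M + 1) → ‖f x - f y‖ ≤ ε := by
      intro f ε hε hf x hx y hy hxy
      have h1 := hf.dist_le_mul x hx y hy
      rw [dist_eq_norm, Real.dist_eq] at h1
      rw [lt_div_iff₀ (by positivity)] at hxy
      nlinarith [abs_nonneg (x - y)]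
    exact eventually_uniform_of_pointwise
      (fun ε hε => ⟨ε / (M + 1), by positivity, hM.mono fun n hn =>
        hδ hε ((hg n).lipschitz.weaken hn)⟩)
      (fun ε hε => ⟨ε / (M + 1), by positivity, hδ hε (hlip.weaken hs₁.2)⟩) hg₁ hε

/-- Along a maximizing sequence of arcs, the speed remains bounded: the boundary of an arc has mass
`2`, which is negligible if the arc is long. -/
theorem MaximizesRatio.exists_eventually_speed_le {Γ₀ : FiniteMassCurrent Ω}
    (hmax : MaximizesRatio Ω B Γ₀) (hm : 0 < ratio Ω B Γ₀)
    (hunique : ∀ T, MaximizesRatio Ω B T → ∃ c : ℝ, T = c • Γ₀)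
    (hΓ₀ : ∃ (φ : E3 → ℝ) (hφ : ContDiff ℝ ∞ φ), HasCompactSupport φ ∧
      Γ₀ (gradField Ω φ hφ) ≠ 0) (hL : 0 < L) {𝒰 : Ultrafilter ℕ}
    {g : ℕ → ℝ → E3} {s : ℕ → ℝ≥0} (hg : ∀ n, IsBoundaryArc Ω (g n) L (s n))
    (hn : ∀ n, ‖curveCurrent Ω (g n) 0 L‖ = s n * L)
    (hR : Tendsto (fun n => ratio Ω B (curveCurrent Ω (g n) 0 L)) 𝒰 (𝓝 (ratio Ω B Γ₀))) :
    ∃ M : ℝ≥0, ∀ᶠ n in (𝒰 : Filter ℕ), s n ≤ M := by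
  by_contra! hcon
  have hs : Tendsto s 𝒰 atTop := tendsto_atTop.mpr fun M => by
    filter_upwards [hcon M] with n h using h.le
  have hs' : Tendsto (fun n => (s n : ℝ) * L) 𝒰 atTop :=
    (NNReal.tendsto_coe_atTop.mpr hs).atTop_mul_const hL
  refine hmax.false_of_boundary_tendsto_zero hm hunique hΓ₀ hR fun φ hφ hc => ?_
  obtain ⟨C, hC⟩ := hφ.continuous.bounded_above_of_compact_support hc
  refine squeeze_zero_norm (a := fun n => 2 * C / (s n * L)) (fun n => ?_)
    (tendsto_const_nhds.div_atTop hs')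
  rw [curveCurrent_gradField ((hg n).primitive hL.le) hL.le (hg n).mapsTo hφ hc, hn n, norm_div,
    Real.norm_of_nonneg (show 0 ≤ (s n : ℝ) * L by positivity)]
  have h1 := norm_sub_le (φ (g n L)) (φ (g n 0))
  have h2 : ‖φ (g n L) - φ (g n 0)‖ ≤ 2 * C := by linarith [hC (g n L), hC (g n 0)]
  gcongr

/-- A maximizing sequence of arcs of constant speed converges to the axis. -/
theorem eventually_close_of_maximizing (hmax : MaximizesRatio Ω B (curveCurrent Ω γ 0 L))
    (hm : 0 < ratio Ω B (curveCurrent Ω γ 0 L))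
    (hunique : ∀ T, MaximizesRatio Ω B T → ∃ c : ℝ, T = c • curveCurrent Ω γ 0 L)
    (hγ : IsSmoothSimpleArc Ω γ L) (hΦ : IsTubeCoordinates Ω γ L δ Φ)
    (hB : IsNormalOnBoundary Ω B) {𝒰 : Ultrafilter ℕ}
    {g : ℕ → ℝ → E3} {s : ℕ → ℝ≥0} (hs : ∀ n, 0 < s n) (hg : ∀ n, IsBoundaryArc Ω (g n) L (s n))
    (hn : ∀ n, ‖curveCurrent Ω (g n) 0 L‖ = s n * L)
    (hR : Tendsto (fun n => ratio Ω B (curveCurrent Ω (g n) 0 L)) 𝒰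
      (𝓝 (ratio Ω B (curveCurrent Ω γ 0 L)))) {r : ℝ} (hr : 0 < r) :
    ∀ᶠ n in (𝒰 : Filter ℕ), |(s n : ℝ) - 1| < r ∧ ∀ t ∈ Icc 0 L, ‖g n t - γ t‖ < r := by
  have hL := hγ.length_pos
  set m := ratio Ω B (curveCurrent Ω γ 0 L) with hmdef
  obtain ⟨M, hM⟩ := hmax.exists_eventually_speed_le hm hunique hγ.exists_gradField_ne_zero hL hg hn
    hR
  obtain ⟨g₁, s₁, hg₁, hs₁, hcur, hunif⟩ := exists_arc_limit hL hg hM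
  have hval : ∀ n, curveCurrent Ω (g n) 0 L B
      = ratio Ω B (curveCurrent Ω (g n) 0 L) * (s n * L) := fun n => by
    have : (0 : ℝ) < s n := hs n
    rw [ratio, hn n, div_mul_cancel₀ _ (by positivity)]
  -- if the arcs shrink to a point, their ratio is eventually at most `m / 2`
  have hpos : 0 < s₁ := by
    rw [pos_iff_ne_zero]
    rintro rfl
    obtain ⟨r₁, hr₁, H⟩ := exists_radius_short_arc hB hg₁.left (half_pos hm)
    have hconst : ∀ t ∈ Icc 0 L, g₁ t = g₁ 0 := fun t ht => by
      have := hg₁.lipschitz.dist_le_mul t ht 0 ⟨le_rfl, hL.le⟩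
      rw [NNReal.coe_zero, zero_mul] at this
      exact dist_le_zero.mp this
    have hle : ∀ᶠ n in (𝒰 : Filter ℕ), ratio Ω B (curveCurrent Ω (g n) 0 L) ≤ m / 2 := by
      filter_upwards [hunif (r₁ / 2) (half_pos hr₁)] with n hclose
      have h1 := H (g n) (s n) L hL.le (hg n).lipschitz (hg n).mapsTo (hg n).left (hg n).right
        fun t ht => by
          have := hclose t ht
          rw [hconst t ht] at this
          linarith
      rw [hval n] at h1
      have hsn : (0 : ℝ) < s n := hs n
      exact le_of_mul_le_mul_right ((le_abs_self _).trans h1) (by positivity)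
    have := le_of_tendsto hR hle
    linarith
  have hlimval : curveCurrent Ω g₁ 0 L B = m * (s₁ * L) := by
    refine tendsto_nhds_unique (hcur B) ?_
    simp only [hval]
    exact hR.mul (hs₁.mul_const L)
  obtain ⟨rfl, heq⟩ := hg₁.eqOn_of_maximizes hmax hm hunique hγ hΦ hpos hlimval
  have hs₁' : ∀ᶠ n in (𝒰 : Filter ℕ), |(s n : ℝ) - 1| < r := by
    filter_upwards [Metric.tendsto_nhds.mp hs₁ r hr] with n h
    rwa [Real.dist_eq, NNReal.coe_one] at h
  filter_upwards [hs₁', hunif (r / 2) (half_pos hr)] with n h1 h2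
  refine ⟨h1, fun t ht => ?_⟩
  rw [← heq ht]
  exact (h2 t ht).trans_lt (half_lt_self hr)

theorem tendsto_ratio_of_lt {Γ₀ : FiniteMassCurrent Ω} (hmax : MaximizesRatio Ω B Γ₀)
    {T : ℕ → FiniteMassCurrent Ω} (hT : ∀ n, T n ∈ normalCurrents Ω)
    (h : ∀ n, ratio Ω B Γ₀ - ratio Ω B (T n) < 1 / (n + 1 : ℝ)) :
    Tendsto (fun n => ratio Ω B (T n)) (hyperfilter ℕ) (𝓝 (ratio Ω B Γ₀)) := by
  have h1 : Tendsto (fun n => ratio Ω B (T n)) atTop (𝓝 (ratio Ω B Γ₀)) := by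
    refine tendsto_of_tendsto_of_tendsto_of_le_of_le
      (g := fun n : ℕ => ratio Ω B Γ₀ - 1 / (n + 1 : ℝ)) ?_ tendsto_const_nhds
      (fun n => ?_) fun n => hmax.ratio_le (hT n)
    · simpa using tendsto_const_nhds.sub (tendsto_one_div_add_atTop_nhds_zero_nat (𝕜 := ℝ))
    · have := h n
      simp only
      linarith
  exact h1.mono_left Nat.hyperfilter_le_atTop

/-- Curves whose ratio is almost maximal are close to the axis. -/
theorem exists_close (hmax : MaximizesRatio Ω B (curveCurrent Ω γ 0 L))
    (hm : 0 < ratio Ω B (curveCurrent Ω γ 0 L))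
    (hunique : ∀ T, MaximizesRatio Ω B T → ∃ c : ℝ, T = c • curveCurrent Ω γ 0 L)
    (hγ : IsSmoothSimpleArc Ω γ L) (hΦ : IsTubeCoordinates Ω γ L δ Φ)
    (hB : IsNormalOnBoundary Ω B) {r : ℝ} (hr : 0 < r) :
    ∃ ε > 0, ∀ Γ ∈ simpleCurves Ω, ratio Ω B (curveCurrent Ω γ 0 L) - ratio Ω B Γ < ε →
      ∃ (g : ℝ → E3) (s : ℝ≥0), 0 < s ∧ IsBoundaryArc Ω g L s ∧ curveCurrent Ω g 0 L = Γ ∧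
        ‖Γ‖ = s * L ∧ |(s : ℝ) - 1| < r ∧ ∀ t ∈ Icc 0 L, ‖g t - γ t‖ < r := by
  have hL := hγ.length_pos
  have hpos : ∀ n : ℕ, (0 : ℝ) < 1 / (n + 1 : ℝ) := fun n => by positivity
  have hloop : ∃ ε > 0, ∀ Γ ∈ normalCurrents Ω, (∀ (φ : E3 → ℝ) (hφ : ContDiff ℝ ∞ φ),
      HasCompactSupport φ → Γ (gradField Ω φ hφ) = 0) →
      ε ≤ ratio Ω B (curveCurrent Ω γ 0 L) - ratio Ω B Γ := by
    by_contra! hcon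
    choose T hTN hT0 hTR using fun n : ℕ => hcon _ (hpos n)
    refine hmax.false_of_boundary_tendsto_zero hm hunique hγ.exists_gradField_ne_zero
      (tendsto_ratio_of_lt hmax hTN hTR) fun φ hφ hc => ?_
    simp only [hT0 _ φ hφ hc, zero_div]
    exact tendsto_const_nhds
  have harc : ∃ ε > 0, ∀ (g : ℝ → E3) (s : ℝ≥0), 0 < s → IsBoundaryArc Ω g L s →
      ‖curveCurrent Ω g 0 L‖ = s * L →
      ratio Ω B (curveCurrent Ω γ 0 L) - ratio Ω B (curveCurrent Ω g 0 L) < ε →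
      |(s : ℝ) - 1| < r ∧ ∀ t ∈ Icc 0 L, ‖g t - γ t‖ < r := by
    by_contra! hcon
    choose g s hs hg hn hR hbad using fun n : ℕ => hcon _ (hpos n)
    obtain ⟨n, h1, h2⟩ := (eventually_close_of_maximizing hmax hm hunique hγ hΦ hB hs hg hn
      (tendsto_ratio_of_lt hmax (fun n => (hg n).mem_normalCurrents hL.le) hR) hr).exists
    obtain ⟨t, ht, h3⟩ := hbad n h1
    exact absurd (h2 t ht) (not_lt.mpr h3)
  obtain ⟨ε₁, hε₁, H₁⟩ := hloop
  obtain ⟨ε₂, hε₂, H₂⟩ := harc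
  refine ⟨min ε₁ ε₂, lt_min hε₁ hε₂, fun Γ hΓ hlt => ?_⟩
  obtain ⟨hN, h0 | ⟨g, s, hs, hg, rfl, hn⟩⟩ := mem_normalCurrents_and_cases hL hΓ
  · exact absurd (hlt.trans_le (min_le_left _ _)) (not_lt.mpr (H₁ Γ hN h0))
  · obtain ⟨h1, h2⟩ := H₂ g s hs hg hn (hlt.trans_le (min_le_right _ _))
    exact ⟨g, s, hs, hg, rfl, hn, h1, h2⟩

end

end

/-! ### The nondegeneracy estimate -/

section

section

variable {Ω : SmoothDomain} {L : ℝ} {γ : ℝ → E3} {δ : ℝ} {Φ : E2 × ℝ → E3} {B : C(Ω.Closure, E3)}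

theorem IsSmoothSimpleArc.mem_simpleCurves (hγ : IsSmoothSimpleArc Ω γ L) :
    curveCurrent Ω γ 0 L ∈ simpleCurves Ω := by
  obtain ⟨s, hs⟩ := hγ.isBoundaryArc
  exact ⟨γ, 0, L, hγ.length_pos, ⟨s, hs.lipschitz⟩, hγ.mapsTo,
    Or.inl ⟨hγ.simple, hγ.left_mem, hγ.right_mem⟩, rfl⟩

theorem eq_of_mem_simpleCurves_of_maximizes
    (hmax : MaximizesRatio Ω B (curveCurrent Ω γ 0 L))
    (hm : 0 < ratio Ω B (curveCurrent Ω γ 0 L))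
    (hunique : ∀ T, MaximizesRatio Ω B T → ∃ c : ℝ, T = c • curveCurrent Ω γ 0 L)
    (hγ : IsSmoothSimpleArc Ω γ L) {Γ : FiniteMassCurrent Ω} (hΓ : Γ ∈ simpleCurves Ω)
    (hΓmax : MaximizesRatio Ω B Γ) : Γ = curveCurrent Ω γ 0 L := by
  obtain ⟨c, hc⟩ := hunique Γ hΓmax
  obtain ⟨-, h0 | ⟨g, s, -, hg, rfl, -⟩⟩ := mem_normalCurrents_and_cases hγ.length_pos hΓ
  · obtain ⟨φ, hφ, hφc, hne⟩ := hγ.exists_gradField_ne_zero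
    have h1 := h0 φ hφ hφc
    rw [hc, smul_apply, smul_eq_mul] at h1
    have hc0 := (mul_eq_zero.mp h1).resolve_right hne
    exact absurd (by rw [hc, hc0, zero_smul]) hΓmax.2.1
  · have hpos : ∀ {T : FiniteMassCurrent Ω}, T ≠ 0 → 0 < ratio Ω B T → 0 < T B :=
      fun h0 h => (div_pos_iff_of_pos_right (norm_pos_iff.mpr h0)).mp h
    have h1 := hpos hΓmax.2.1 (hm.trans_le (hΓmax.ratio_le hmax.1))
    have h2 := hpos hmax.2.1 hm
    rw [hc, smul_apply, smul_eq_mul] at h1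
    obtain ⟨hc1, -⟩ := hg.eq_of_eq_smul hγ (pos_of_mul_pos_left h1 h2.le) hc
    rw [hc, hc1, one_smul]

/-- The quadratic estimate near the axis, and compactness away from it. -/
theorem exists_nondegeneracy (hmax : MaximizesRatio Ω B (curveCurrent Ω γ 0 L))
    (hunique : ∀ T, MaximizesRatio Ω B T → ∃ c : ℝ, T = c • curveCurrent Ω γ 0 L)
    (hm : 0 < ratio Ω B (curveCurrent Ω γ 0 L)) (hγ : IsSmoothSimpleArc Ω γ L)
    (hΦ : IsTubeCoordinates Ω γ L δ Φ) (hB : IsNormalOnBoundary Ω B) (hreg : IsC2Near Ω B γ L)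
    (hQ : ∀ u : ℝ → E2, IsH1 L u → (∃ z ∈ Icc 0 L, u z ≠ 0) → 0 < Q Ω B Φ L u) :
    ∃ α : ℝ, 0 < α ∧ ∀ Γ ∈ simpleCurves Ω,
      α * min (starNorm Ω (Γ - curveCurrent Ω γ 0 L) ^ 2) 1
        ≤ ratio Ω B (curveCurrent Ω γ 0 L) - ratio Ω B Γ := by
  have hL := hγ.length_pos
  set m := ratio Ω B (curveCurrent Ω γ 0 L) with hmdef
  have hval : curveCurrent Ω γ 0 L B = m * L := by
    rw [hmdef, ratio, hΦ.norm_axis_current hγ, div_mul_cancel₀ _ hL.ne']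
  obtain ⟨δ', hT⟩ := hΦ.exists_isDeficitTube hγ hB hreg hval
  obtain ⟨α, hα, η, hη, Hloc⟩ := hT.exists_local_estimate hm (fun T hT => hmax.apply_le hT) hQ
  obtain ⟨r, hr, Hlift⟩ := hΦ.exists_tubeCurve_of_close hγ hT.radius_pos hT.radius_lt hη
  obtain ⟨ε, hε, Hclose⟩ := exists_close hmax hm hunique hγ hΦ hB (lt_min hr one_pos)
  refine ⟨min (α / (2 * L)) ε, by positivity, fun Γ hΓ => ?_⟩
  rcases lt_or_ge (m - ratio Ω B Γ) ε with hlt | hge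
  · obtain ⟨g, s, hs, hg, rfl, hn, hs1, hclose⟩ := Hclose Γ hΓ hlt
    obtain ⟨v, w, z, ζ, hc, hnear, heq⟩ := Hlift g s hg.lipschitz hg.mapsTo hg.left hg.right
      (hs1.trans_le (min_le_left _ _)) fun t ht => (hclose t ht).trans_le (min_le_left _ _)
    have hcur : curveCurrent Ω g 0 L = curveCurrent Ω (fun t => Φ (v t, z t)) 0 L := by
      have hc' := hc.mono hT.radius_lt.le
      ext1 B'
      rw [curveCurrent_apply ((hΦ.curve hL.le hc').congr_left hL.le heq) hL.le hg.mapsTo,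
        curveCurrent_apply (hΦ.curve hL.le hc') hL.le (hΦ.mapsTo_curve hc')]
      refine intervalIntegral.integral_congr fun t ht => ?_
      rw [uIcc_of_le hL.le] at ht
      simp only [heq ht]
    have h1 := Hloc s v w z ζ hc hnear
    rw [← hcur] at h1
    have hs0 : (0 : ℝ) < s := hs
    have hs2 : (s : ℝ) ≤ 2 := by
      have := (abs_lt.mp (hs1.trans_le (min_le_right _ _))).2
      linarith
    have h2 : m - ratio Ω B (curveCurrent Ω g 0 L)
        = (m * (s * L) - curveCurrent Ω g 0 L B) / (s * L) := by
      rw [ratio, hn]; field_simp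
    rw [h2, le_div_iff₀ (by positivity)]
    refine le_trans ?_ h1
    calc _ ≤ α / (2 * L) * starNorm Ω (curveCurrent Ω g 0 L - curveCurrent Ω γ 0 L) ^ 2
          * (2 * L) := by
          gcongr
          · exact min_le_left _ _
          · exact min_le_left _ _
      _ = _ := by field_simp
  · refine le_trans ?_ hge
    calc _ ≤ ε * 1 := by
          gcongr
          · exact min_le_right _ _
          · exact min_le_right _ _
      _ = ε := mul_one ε

end

end

end Isoflux

open Isoflux
theorem proposition3 (Ω : SmoothDomain) (B₀ : C(Ω.Closure, E3)) (hB₀ : IsCT Ω B₀)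
    (γ₀ : ℝ → E3) (L₀ : ℝ) (hγ₀ : IsSmoothSimpleArc Ω γ₀ L₀) (hreg : IsC2Near Ω B₀ γ₀ L₀)
    (Γ₀ : FiniteMassCurrent Ω) (hΓ₀ : Γ₀ = curveCurrent Ω γ₀ 0 L₀)
    (hmax : MaximizesRatio Ω B₀ Γ₀)
    (hunique : ∀ T, MaximizesRatio Ω B₀ T → ∃ c : ℝ, T = c • Γ₀)
    (hsecond : HasNegDefSecondDeriv Ω B₀ γ₀ L₀) :
    (Γ₀ ∈ simpleCurves Ω ∧ ∀ Γ ∈ simpleCurves Ω, MaximizesRatio Ω B₀ Γ → Γ = Γ₀) ∧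
    ∃ α : ℝ, 0 < α ∧ ∀ Γ ∈ simpleCurves Ω,
      α * min (starNorm Ω (Γ - Γ₀) ^ 2) 1 ≤ ratio Ω B₀ Γ₀ - ratio Ω B₀ Γ := by
  subst hΓ₀
  obtain ⟨δ, Φ, hΦ, hQ⟩ := hsecond
  have hm := hmax.ratio_pos hΦ hγ₀.length_pos.le hQ
  exact ⟨⟨hγ₀.mem_simpleCurves, fun Γ hΓ h =>
    eq_of_mem_simpleCurves_of_maximizes hmax hm hunique hγ₀ hΓ h⟩,
    exists_nondegeneracy hmax hunique hm hγ₀ hΦ hB₀.2 hreg hQ⟩
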